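/- Let $k$ be a field. **Quasi-algebras.** A quasi-algebra $\mathcal Z$ over $k$ is a family of $k$-vector spaces $\mathcal Z_{n_1,\dots,n_m}$ ($m\ge 0$, $n_t\in\mathbb Z$) with $\mathcal Z_\varnothing$ identified with $k$, together with linear quasi-multiplication maps $\mathcal Z_{n_1,\dots,n_m}\to\mathcal Z_{n_1,\dots,n_t+n_{t+1},\dots,n_m}$ and quasi-unit maps $\mathcal Z_{n_1,\dots,n_m}\to\mathcal Z_{n_1,\dots,n_t,0,n_{t+1},\dots,n_m}$ satisfying the identities that hold for the maps induced by the multiplication and the unit on the tensor products $Z_{n_1}\otimes_k\dots\otimes_k Z_{n_m}$ of the components of a graded associative algebra $Z$ with unit (quasi-multiplications at disjoint pairs of adjacent indices commute; the two ways of adding up three consecutive indices agree; quasi-units commute with each other and with the quasi-multiplications; inserting an index $0$ and then adding it to a neighbouring index is the identity). It is positive if $\mathcal Z_{n_1,\dots,n_m}=0$ whenever some $n_t<0$, and all quasi-unit maps are isomorphisms. **Complexes.** For a graded algebra $Z$ with $Z_0=k$ and $Z_n=0$ for $n<0$, let $B_n$ be the component of internal degree $n$ of its reduced bar complex $k\leftarrow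 Z_+\leftarrow Z_+\otimes Z_+\leftarrow\cdots$. The terms of the complex $Z_{l_p}\otimes\dots\otimes Z_{l_0}\otimes B_{n_1}\otimes\dots\otimes B_{n_q}$ (the factors $Z_{l_r}$ being placed in homological degree $0$) are direct sums of tensor products of components of $Z$; replacing each $Z_{n'_1}\otimes\dots\otimes Z_{n'_{m'}}$ by the component $\mathcal Z_{n'_1,\dots,n'_{m'}}$ of a positive quasi-algebra, and multiplications by quasi-multiplications, one obtains a complex $\mathcal E_{l_p,\dots,l_0;n_1,\dots,n_q}$. In the same way $B_{n_1}\otimes\dots\otimes B_{n_m}$ gives a complex $\mathcal B_{n_1,\dots,n_m}$. The positive quasi-algebra $\mathcal Z$ is called Koszul if each complex $\mathcal B_{n_1,\dots,n_m}$ ($m\ge 0$, $n_t\ge 0$) has no homology except in the homological degree $n_1+\dots+n_m$. **Koszul algebras and modules.** A nonnegatively graded $k$-algebra $A$ is Koszul if $A_0=k$ and $\operatorname{Tor}^A_{ij}(k,k)=0$ for $i\ne j$, where $i$ is the homological and $j$ the internal degree. A nonnegatively graded left module $M$ over a Koszul algebra $A$ is Koszul if $\operatorname{Tor}^A_{ij}(k,M)=0$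 for $i\neq j$. **Theorem.** Let $A$ be a Koszul algebra and $\mathcal Z$ a positive quasi-algebra over $k$. Suppose that $A$ acts in $\mathcal Z$ from the left, that is, for all $p,q\ge 0$, $n\ge 0$ and $l_p,\dots,l_1,n_0,\dots,n_q\ge 0$ there are given linear maps $$A_n\otimes_k\mathcal Z_{l_p,\dots,l_1,n_0,\dots,n_q}\longrightarrow\mathcal Z_{l_p,\dots,l_1,n+n_0,n_1,\dots,n_q}$$ which make $\bigoplus_{n_0\ge 0}\mathcal Z_{l_p,\dots,l_1,n_0,\dots,n_q}$ a graded left $A$-module for all fixed $l_p,\dots,l_1,n_1,\dots,n_q$ and commute with the quasi-multiplications $\mathcal Z_{l_p,\dots,l_1,n_0,\dots,n_q}\to\mathcal Z_{l_p,\dots,l_1,n_0,\dots,n_t+n_{t+1},\dots,n_q}$ for all $0\le t<q$. Applied at the index $l_0$, this gives an action $A_n\otimes_k\mathcal E_{l_p,\dots,l_0;n_1,\dots,n_q}\to\mathcal E_{l_p,\dots,l_1,n+l_0;n_1,\dots,n_q}$ on complexes, hence on their homology. Suppose that for all $p,q\ge 0$ and all $l_p,\dots,l_1,n_1,\dots,n_q\ge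 1$ the graded $A$-module $$\bigoplus_{l_0=1}^\infty H_{n_1+\dots+n_q}(\mathcal E_{l_p,\dots,l_1,l_0;n_1,\dots,n_q})$$ is Koszul in the grading shifted by $1$ (so that the summand with $l_0=1$ is placed in degree $0$). Then the quasi-algebra $\mathcal Z$ is Koszul. -/

import Mathlib

open CategoryTheory TensorProduct

universe u

namespace QuasiKoszul

/-! ### Graded modules, the bar complex, `Tor`, and Koszulity over a graded algebra -/

section Graded

variable {k A : Type u} [Field k] [Ring A] [Algebra k A]
  (𝒜 : ℕ → Submodule k A) [GradedAlgebra 𝒜]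

/-- A nonnegatively graded left module `M = ⨁ M_i` over the graded `k`-algebra `A = ⨁ 𝒜 n`,
given by its components. The action map `𝒜 n × M_i → M_{n+i}` is written with an arbitrary target
index `j` together with a proof of `n + i = j`. -/
structure GradedModule where
  obj : ℕ → Type u
  [addCommGroup : ∀ i, AddCommGroup (obj i)]
  [module : ∀ i, Module k (obj i)]
  act : ∀ {n i j : ℕ}, n + i = j → 𝒜 n →ₗ[k] obj i →ₗ[k] obj j
  one_act : ∀ {i : ℕ} (h : 0 + i = i) (x : obj i), act h ⟨1, SetLike.one_mem_graded 𝒜⟩ x = x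
  mul_act : ∀ {m n i j l : ℕ} (h₁ : n + i = j) (h₂ : m + j = l) (h : (m + n) + i = l)
    (a : 𝒜 m) (b : 𝒜 n) (x : obj i),
    act h ⟨a.1 * b.1, SetLike.mul_mem_graded a.2 b.2⟩ x = act h₂ a (act h₁ b x)

attribute [instance] GradedModule.addCommGroup GradedModule.module

variable {𝒜}

namespace GradedModule

/-- The index set of the degree `j` part of `A₊ ⊗ M`, where `A₊ = A_1 ⊕ A_2 ⊕ ⋯`. -/
abbrev PlusIndex (j : ℕ) : Type := {p : ℕ × ℕ // 0 < p.1 ∧ p.1 + p.2 = j}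

/-- Left multiplication by the first factor in homogeneous components. -/
def leftMul {m n l : ℕ} (h : m + n = l) : 𝒜 m →ₗ[k] 𝒜 n →ₗ[k] 𝒜 l :=
  LinearMap.mk₂ k
    (fun a b => ⟨a.1 * b.1, h ▸ SetLike.mul_mem_graded a.2 b.2⟩)
    (fun a a' b => Subtype.ext (add_mul a.1 a'.1 b.1))
    (fun c a b => Subtype.ext (smul_mul_assoc c a.1 b.1))
    (fun a b b' => Subtype.ext (mul_add a.1 b.1 b'.1))
    (fun c a b => Subtype.ext (mul_smul_comm c a.1 b.1))

theorem PlusIndex.raise {n i j : ℕ} (h : n + i = j) (p : PlusIndex i) :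
    0 < n + p.1.1 ∧ (n + p.1.1) + p.1.2 = j :=
  ⟨Nat.add_pos_right _ p.2.1, by rw [add_assoc, p.2.2, h]⟩

variable (M : GradedModule 𝒜)

/-- The underlying vector space of the degree `j` component of `A₊ ⊗ₖ M`. -/
abbrev PlusObj (j : ℕ) : Type u :=
  DirectSum (PlusIndex j) fun p => 𝒜 p.1.1 ⊗[k] M.obj p.1.2

instance (j : ℕ) : AddCommGroup (M.PlusObj j) := Module.addCommMonoidToAddCommGroup k

/-- The homogeneous element `b ⊗ x` of `A₊ ⊗ₖ M`, as a linear map on a tensor product. -/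
def inc {j : ℕ} (p : PlusIndex j) : 𝒜 p.1.1 ⊗[k] M.obj p.1.2 →ₗ[k] M.PlusObj j :=
  DirectSum.lof k (PlusIndex j) (fun p => 𝒜 p.1.1 ⊗[k] M.obj p.1.2) p

theorem inc_congr {j : ℕ} (p q : PlusIndex j) (b : 𝒜 p.1.1) (b' : 𝒜 q.1.1)
    (x : M.obj p.1.2) (h₁ : p.1.1 = q.1.1) (h₂ : q.1.2 = p.1.2) (hb : b.1 = b'.1) :
    M.inc p (b ⊗ₜ x) = M.inc q (b' ⊗ₜ (h₂ ▸ x)) := by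
  obtain ⟨⟨p1, p2⟩, hp⟩ := p
  obtain ⟨⟨q1, q2⟩, hq⟩ := q
  dsimp only at h₁ h₂
  subst h₁
  subst h₂
  obtain rfl : b = b' := Subtype.ext hb
  rfl

variable {M} in
theorem plus_ext {j : ℕ} {N : Type*} [AddCommGroup N] [Module k N]
    {f g : M.PlusObj j →ₗ[k] N}
    (h : ∀ (p : PlusIndex j) (b : 𝒜 p.1.1) (x : M.obj p.1.2),
      f (M.inc p (b ⊗ₜ x)) = g (M.inc p (b ⊗ₜ x))) : f = g :=
  DirectSum.linearMap_ext k fun p => TensorProduct.ext' fun b x => h p b x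

/-- The action of `A` on `A₊ ⊗ₖ M` by `a (b ⊗ x) = ab ⊗ x`. -/
def plusAct {n i j : ℕ} (h : n + i = j) : 𝒜 n →ₗ[k] M.PlusObj i →ₗ[k] M.PlusObj j :=
  LinearMap.flip <| DirectSum.toModule k (PlusIndex i) _ fun p => LinearMap.flip <|
    LinearMap.mk₂ k
      (fun a z => M.inc ⟨(n + p.1.1, p.1.2), PlusIndex.raise h p⟩
        (LinearMap.rTensor (M.obj p.1.2) (leftMul rfl a) z))
      (fun a a' z => by simp [LinearMap.rTensor_add])
      (fun c a z => by simp [LinearMap.rTensor_smul])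
      (fun a z z' => by simp)
      (fun c a z => by simp)

theorem plusAct_inc {n i j : ℕ} (h : n + i = j) (a : 𝒜 n) (p : PlusIndex i)
    (b : 𝒜 p.1.1) (x : M.obj p.1.2) :
    M.plusAct h a (M.inc p (b ⊗ₜ x)) =
      M.inc ⟨(n + p.1.1, p.1.2), PlusIndex.raise h p⟩ (leftMul rfl a b ⊗ₜ x) := by
  simp only [plusAct, inc, LinearMap.flip_apply, DirectSum.toModule_lof, LinearMap.mk₂_apply,
    LinearMap.rTensor_tmul]

/-- The graded `A`-module `A₊ ⊗ₖ M`, with `A` acting on the first factor. -/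
def plus : GradedModule 𝒜 where
  obj := M.PlusObj
  act h := M.plusAct h
  one_act h x := by
    suffices M.plusAct h ⟨1, SetLike.one_mem_graded 𝒜⟩ = LinearMap.id from
      LinearMap.congr_fun this x
    refine plus_ext fun p b x => ?_
    rw [plusAct_inc]
    refine M.inc_congr ⟨(0 + p.1.1, p.1.2), PlusIndex.raise h p⟩ p _ b x (zero_add _) rfl ?_
    exact one_mul _
  mul_act {m n i j l} h₁ h₂ h a b x := by
    suffices M.plusAct h ⟨a.1 * b.1, SetLike.mul_mem_graded a.2 b.2⟩ =
        M.plusAct h₂ a ∘ₗ M.plusAct h₁ b from LinearMap.congr_fun this x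
    refine plus_ext fun p c x => ?_
    rw [LinearMap.comp_apply, plusAct_inc, plusAct_inc, plusAct_inc]
    refine M.inc_congr ⟨(m + n + p.1.1, p.1.2), PlusIndex.raise h p⟩
      ⟨(m + (n + p.1.1), p.1.2), PlusIndex.raise h₂ ⟨(n + p.1.1, p.1.2), PlusIndex.raise h₁ p⟩⟩
      _ _ x (add_assoc _ _ _) rfl ?_
    exact mul_assoc _ _ _

/-- The homogeneous element `b ⊗ x` of `A₊ ⊗ₖ M`. -/
def plusMk {j : ℕ} (p : PlusIndex j) (b : 𝒜 p.1.1) (x : M.obj p.1.2) : M.plus.obj j :=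
  M.inc p (b ⊗ₜ x)

/-- The linear map out of `A₊ ⊗ₖ M` given by bilinear maps on homogeneous components. -/
def plusDesc {j : ℕ} {N : Type u} [AddCommGroup N] [Module k N]
    (f : ∀ p : PlusIndex j, 𝒜 p.1.1 →ₗ[k] M.obj p.1.2 →ₗ[k] N) : M.plus.obj j →ₗ[k] N :=
  DirectSum.toModule k (PlusIndex j) N fun p => TensorProduct.lift (f p)

theorem plusDesc_mk {j : ℕ} {N : Type u} [AddCommGroup N] [Module k N]
    (f : ∀ p : PlusIndex j, 𝒜 p.1.1 →ₗ[k] M.obj p.1.2 →ₗ[k] N) (p : PlusIndex j)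
    (b : 𝒜 p.1.1) (x : M.obj p.1.2) : M.plusDesc f (M.plusMk p b x) = f p b x :=
  (DirectSum.toModule_lof k p _).trans (TensorProduct.lift.tmul _ _)

theorem plus_hom_ext {j : ℕ} {N : Type u} [AddCommGroup N] [Module k N]
    {f g : M.plus.obj j →ₗ[k] N}
    (h : ∀ (p : PlusIndex j) (b : 𝒜 p.1.1) (x : M.obj p.1.2),
      f (M.plusMk p b x) = g (M.plusMk p b x)) : f = g :=
  plus_ext h

theorem plus_act_mk {n i j : ℕ} (h : n + i = j) (a : 𝒜 n) (p : PlusIndex i)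
    (b : 𝒜 p.1.1) (x : M.obj p.1.2) :
    M.plus.act h a (M.plusMk p b x) =
      M.plusMk ⟨(n + p.1.1, p.1.2), PlusIndex.raise h p⟩ (leftMul rfl a b) x :=
  M.plusAct_inc h a p b x

/-- The linear map `x ↦ b ⊗ x`, linearly in `b`. -/
def plusMkHom {j : ℕ} (p : PlusIndex j) : 𝒜 p.1.1 →ₗ[k] M.obj p.1.2 →ₗ[k] M.plus.obj j :=
  LinearMap.mk₂ k (M.plusMk p)
    (fun b b' x => by
      change M.inc p _ = M.inc p _ + M.inc p _
      rw [TensorProduct.add_tmul, map_add])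
    (fun c b x => by
      change M.inc p _ = c • M.inc p _
      rw [← TensorProduct.smul_tmul', map_smul])
    (fun b x x' => by
      change M.inc p _ = M.inc p _ + M.inc p _
      rw [TensorProduct.tmul_add, map_add])
    (fun c b x => by
      change M.inc p _ = c • M.inc p _
      rw [TensorProduct.tmul_smul, map_smul])

theorem plusMkHom_apply {j : ℕ} (p : PlusIndex j) (b : 𝒜 p.1.1) (x : M.obj p.1.2) :
    M.plusMkHom p b x = M.plusMk p b x := rfl

/-- The action map `A₊ ⊗ₖ M → M`, `b ⊗ x ↦ b x`, in degree `j`. -/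
def plusCounit (j : ℕ) : M.plus.obj j →ₗ[k] M.obj j :=
  M.plusDesc fun p => M.act p.2.2

theorem plusCounit_mk {j : ℕ} (p : PlusIndex j) (b : 𝒜 p.1.1) (x : M.obj p.1.2) :
    M.plusCounit j (M.plusMk p b x) = M.act p.2.2 b x :=
  M.plusDesc_mk _ p b x

/-- The map `id ⊗ f : A₊ ⊗ₖ M → A₊ ⊗ₖ N` induced by a degree-preserving linear map `f`. -/
def plusMap {M N : GradedModule 𝒜} (f : ∀ j, M.obj j →ₗ[k] N.obj j) (j : ℕ) :
    M.plus.obj j →ₗ[k] N.plus.obj j :=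
  M.plusDesc fun p => (N.plusMkHom p).compl₂ (f p.1.2)

theorem plusMap_mk {M N : GradedModule 𝒜} (f : ∀ j, M.obj j →ₗ[k] N.obj j) {j : ℕ}
    (p : PlusIndex j) (b : 𝒜 p.1.1) (x : M.obj p.1.2) :
    plusMap f j (M.plusMk p b x) = N.plusMk p b (f p.1.2 x) :=
  M.plusDesc_mk _ p b x

theorem plusMap_act {M N : GradedModule 𝒜} (f : ∀ j, M.obj j →ₗ[k] N.obj j) {n i j : ℕ}
    (h : n + i = j) (a : 𝒜 n) (z : M.plus.obj i) :
    plusMap f j (M.plus.act h a z) = N.plus.act h a (plusMap f i z) := by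
  suffices plusMap f j ∘ₗ M.plus.act h a = N.plus.act h a ∘ₗ plusMap f i from
    LinearMap.congr_fun this z
  refine M.plus_hom_ext fun q c y => ?_
  rw [LinearMap.comp_apply, LinearMap.comp_apply, plusMap_mk, plus_act_mk, plus_act_mk,
    plusMap_mk]

theorem plusCounit_act {n i j : ℕ} (h : n + i = j) (a : 𝒜 n) (z : M.plus.obj i) :
    M.plusCounit j (M.plus.act h a z) = M.act h a (M.plusCounit i z) := by
  suffices M.plusCounit j ∘ₗ M.plus.act h a = M.act h a ∘ₗ M.plusCounit i from
    LinearMap.congr_fun this z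
  refine M.plus_hom_ext fun q c y => ?_
  rw [LinearMap.comp_apply, LinearMap.comp_apply, plus_act_mk, plusCounit_mk, plusCounit_mk]
  exact M.mul_act q.2.2 h _ a c y

theorem plusCounit_plusMap {M N : GradedModule 𝒜} (f : ∀ j, M.obj j →ₗ[k] N.obj j) (j : ℕ)
    (hf : ∀ {n i j : ℕ} (h : n + i = j) (a : 𝒜 n) (x : M.obj i),
      f j (M.act h a x) = N.act h a (f i x)) (z : M.plus.obj j) :
    N.plusCounit j (plusMap f j z) = f j (M.plusCounit j z) := by
  suffices N.plusCounit j ∘ₗ plusMap f j = f j ∘ₗ M.plusCounit j from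
    LinearMap.congr_fun this z
  refine M.plus_hom_ext fun p b x => ?_
  rw [LinearMap.comp_apply, LinearMap.comp_apply, plusMap_mk, plusCounit_mk, plusCounit_mk, hf]

theorem plusMap_plusMap {L M N : GradedModule 𝒜} (f : ∀ j, L.obj j →ₗ[k] M.obj j)
    (g : ∀ j, M.obj j →ₗ[k] N.obj j) (hfg : ∀ j x, g j (f j x) = 0) (j : ℕ)
    (z : L.plus.obj j) : plusMap g j (plusMap f j z) = 0 := by
  suffices plusMap g j ∘ₗ plusMap f j = 0 from LinearMap.congr_fun this z
  refine L.plus_hom_ext fun p b x => ?_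
  rw [LinearMap.comp_apply, plusMap_mk, plusMap_mk, hfg, ← plusMkHom_apply, map_zero,
    LinearMap.zero_apply]

theorem plusMap_sub {M N : GradedModule 𝒜} (f g : ∀ j, M.obj j →ₗ[k] N.obj j) (j : ℕ)
    (z : M.plus.obj j) :
    plusMap (fun j => f j - g j) j z = plusMap f j z - plusMap g j z := by
  suffices plusMap (fun j => f j - g j) j = plusMap f j - plusMap g j from
    LinearMap.congr_fun this z
  refine M.plus_hom_ext fun p b x => ?_
  rw [LinearMap.sub_apply, plusMap_mk, plusMap_mk, plusMap_mk, LinearMap.sub_apply,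
    ← plusMkHom_apply, ← plusMkHom_apply, ← plusMkHom_apply, map_sub]

/-- Given `f : A₊ ⊗ M → M`, the map `A₊ ⊗ A₊ ⊗ M → A₊ ⊗ M`, `a ⊗ y ↦ a y - a ⊗ f y`. -/
def barStep (f : ∀ j, M.plus.obj j →ₗ[k] M.obj j) (j : ℕ) :
    M.plus.plus.obj j →ₗ[k] M.plus.obj j :=
  M.plus.plusCounit j - plusMap f j

theorem barStep_counit (j : ℕ) (z : M.plus.plus.obj j) :
    M.plusCounit j (M.barStep M.plusCounit j z) = 0 := by
  rw [barStep, LinearMap.sub_apply, map_sub,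
    plusCounit_plusMap M.plusCounit j (fun h a x => M.plusCounit_act h a x) z, sub_self]

theorem barStep_barStep (f : ∀ j, M.plus.obj j →ₗ[k] M.obj j)
    (hf : ∀ j z, f j (M.barStep f j z) = 0) (j : ℕ) (z : M.plus.plus.plus.obj j) :
    M.barStep f j (M.plus.barStep (M.barStep f) j z) = 0 := by
  have h₁ := plusMap_plusMap (M.barStep f) f hf j z
  have h₂ : M.plus.plusCounit j (plusMap (M.barStep f) j z) =
      M.plus.plusCounit j (M.plus.plus.plusCounit j z) -
        plusMap f j (M.plus.plus.plusCounit j z) := by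
    have := plusMap_sub M.plus.plusCounit (plusMap f) j z
    change plusMap (M.barStep f) j z = _ at this
    rw [this, map_sub,
      plusCounit_plusMap M.plus.plusCounit j (fun h a x => M.plus.plusCounit_act h a x) z,
      plusCounit_plusMap (plusMap f) j (fun h a x => plusMap_act f h a x) z]
  rw [barStep, barStep, LinearMap.sub_apply, LinearMap.sub_apply, map_sub, map_sub, h₁, h₂,
    sub_zero, sub_sub_cancel, sub_self]

/-- `bar M i = A₊ ⊗ₖ ⋯ ⊗ₖ A₊ ⊗ₖ M` with `i` factors `A₊`. -/
def bar : ℕ → GradedModule 𝒜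
  | 0 => M
  | i + 1 => (bar i).plus

/-- The differential of the reduced bar complex,
`d (a₁ ⊗ ⋯ ⊗ a_{i+1} ⊗ x) = ∑_{1 ≤ s ≤ i} (-1)^(s-1) a₁ ⊗ ⋯ ⊗ a_s a_{s+1} ⊗ ⋯ ⊗ x
  + (-1)^i a₁ ⊗ ⋯ ⊗ a_i ⊗ a_{i+1} x`,
in the recursive form `d (a ⊗ x) = a x` for `x` in `M`, and `d (a ⊗ y) = a y - a ⊗ d y` for `y`
in `A₊ ⊗ ⋯ ⊗ A₊ ⊗ M`. -/
def barD : ∀ i j : ℕ, (M.bar (i + 1)).obj j →ₗ[k] (M.bar i).obj j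
  | 0 => M.plusCounit
  | i + 1 => (M.bar i).barStep (barD i)

theorem barD_barD : ∀ (i j : ℕ) (z : (M.bar (i + 2)).obj j), M.barD i j (M.barD (i + 1) j z) = 0
  | 0 => M.barStep_counit
  | i + 1 => (M.bar i).barStep_barStep (M.barD i) (barD_barD i)

/-- The component of internal degree `j` of the reduced bar complex of `A` with coefficients
in `M`, `⋯ → A₊ ⊗ A₊ ⊗ M → A₊ ⊗ M → M`. -/
noncomputable def barComplex (j : ℕ) : ChainComplex (ModuleCat.{u} k) ℕ :=
  ChainComplex.of (fun i => ModuleCat.of k ((M.bar i).obj j))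
    (fun i => ModuleCat.ofHom (M.barD i j))
    (fun i => ModuleCat.hom_ext (LinearMap.ext fun z => M.barD_barD i j z))

/-- `Tor^A_{ij}(k, M)`: homological degree `i`, internal degree `j`. -/
noncomputable def tor (i j : ℕ) : ModuleCat.{u} k := (M.barComplex j).homology i

/-- A graded module (over a Koszul algebra) is Koszul if `Tor^A_{ij}(k, M) = 0` for `i ≠ j`. -/
def IsKoszul : Prop := ∀ i j : ℕ, i ≠ j → Limits.IsZero (M.tor i j)

end GradedModule

variable (𝒜)

/-- The homogeneous components of the augmentation `A → A_0 = k`. -/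
noncomputable def augmentation (h : Function.Bijective (algebraMap k (𝒜 0))) :
    ∀ n, 𝒜 n →ₗ[k] k
  | 0 => (LinearEquiv.ofBijective (Algebra.linearMap k (𝒜 0)) h).symm.toLinearMap
  | _ + 1 => 0

variable {𝒜} in
theorem augmentation_zero_spec (h : Function.Bijective (algebraMap k (𝒜 0))) (a : 𝒜 0) :
    algebraMap k A (augmentation 𝒜 h 0 a) = a.1 :=
  congrArg Subtype.val
    ((LinearEquiv.ofBijective (Algebra.linearMap k (𝒜 0)) h).apply_symm_apply a)

theorem algebraMap_injective_of_bijective (h : Function.Bijective (algebraMap k (𝒜 0))) :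
    Function.Injective (algebraMap k A) :=
  fun _ _ e => h.1 (Subtype.ext e)

/-- The graded `A`-module `k = A/A₊`, placed in degree `0`. -/
noncomputable def trivialModule (h : Function.Bijective (algebraMap k (𝒜 0))) :
    GradedModule 𝒜 where
  obj i := (if i = 0 then ⊤ else ⊥ : Submodule k k)
  act {n i j} hij := LinearMap.mk₂ k
    (fun a x => ⟨augmentation 𝒜 h n a * x.1, by
      rcases n with _ | n
      · obtain rfl : i = j := by omega
        exact Submodule.smul_mem _ (augmentation 𝒜 h 0 a) x.2
      · change (0 : k) * x.1 ∈ _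
        rw [zero_mul]
        exact Submodule.zero_mem _⟩)
    (fun a a' x => Subtype.ext (by simp [add_mul]))
    (fun c a x => Subtype.ext (by simp [mul_assoc]))
    (fun a x x' => Subtype.ext (by simp [mul_add]))
    (fun c a x => Subtype.ext (by simp [mul_left_comm]))
  one_act {i} hi x := Subtype.ext (by
    have : augmentation 𝒜 h 0 ⟨1, SetLike.one_mem_graded 𝒜⟩ = 1 :=
      algebraMap_injective_of_bijective 𝒜 h (by rw [augmentation_zero_spec, map_one])
    simp [this])
  mul_act {m n i j l} h₁ h₂ h₃ a b x := Subtype.ext (by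
    suffices augmentation 𝒜 h (m + n) ⟨a.1 * b.1, SetLike.mul_mem_graded a.2 b.2⟩ =
        augmentation 𝒜 h m a * augmentation 𝒜 h n b by
      simp [this, mul_assoc]
    rcases n with _ | n
    · rcases m with _ | m
      · exact algebraMap_injective_of_bijective 𝒜 h (by
          rw [map_mul, augmentation_zero_spec h a, augmentation_zero_spec h b]
          exact augmentation_zero_spec h ⟨a.1 * b.1, _⟩)
      · exact (zero_mul _).symm
    · exact (mul_zero _).symm)

/-- A nonnegatively graded algebra `A` is Koszul if `A_0 = k` and `Tor^A_{ij}(k, k) = 0`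
for `i ≠ j`. -/
def IsKoszulAlgebra : Prop :=
  ∃ h : Function.Bijective (algebraMap k (𝒜 0)), (trivialModule 𝒜 h).IsKoszul

end Graded

/-! ### Words of indices -/

/-- `Merge t x y`: the word `y` is obtained from the word `x` by replacing the two consecutive
entries `a, b` in positions `t, t + 1` (counted from `0`) by the single entry `a + b`. -/
inductive Merge {ι : Type} [Add ι] : ℕ → List ι → List ι → Prop
  | head (a b : ι) (v : List ι) : Merge 0 (a :: b :: v) ((a + b) :: v)
  | cons (c : ι) {t : ℕ} {x y : List ι} : Merge t x y → Merge (t + 1) (c :: x) (c :: y)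

/-- `InsertZero t x y`: the word `y` is obtained from the word `x` by inserting an entry `0` after
the first `t` entries. -/
inductive InsertZero {ι : Type} [Zero ι] : ℕ → List ι → List ι → Prop
  | head (v : List ι) : InsertZero 0 v (0 :: v)
  | cons (c : ι) {t : ℕ} {x y : List ι} : InsertZero t x y → InsertZero (t + 1) (c :: x) (c :: y)

/-- `Raise n p x y`: the word `y` is obtained from the word `x` by replacing the entry `a` in
position `p` (counted from `0`) by `n + a`. -/
inductive Raise (n : ℕ) : ℕ → List ℕ → List ℕ → Prop
  | head (a : ℕ) (v : List ℕ) : Raise n 0 (a :: v) ((n + a) :: v)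
  | cons (c : ℕ) {p : ℕ} {x y : List ℕ} : Raise n p x y → Raise n (p + 1) (c :: x) (c :: y)

/-- A word of natural numbers, regarded as a word of integers. -/
def castWord (x : List ℕ) : List ℤ := x.map (fun a : ℕ => (a : ℤ))

theorem Merge.cast {t : ℕ} {x y : List ℕ} (h : Merge t x y) :
    Merge t (castWord x) (castWord y) := by
  induction h with
  | head a b v => exact Merge.head (a : ℤ) (b : ℤ) (castWord v)
  | cons c _ ih => exact Merge.cons (c : ℤ) ih

theorem Merge.append_left {t : ℕ} {x y : List ℕ} (h : Merge t x y) (l : List ℕ) :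
    Merge (l.length + t) (l ++ x) (l ++ y) := by
  induction l with
  | nil => simpa using h
  | cons a l ih =>
    have := Merge.cons a ih
    rwa [show l.length + t + 1 = (a :: l).length + t by simp; omega] at this

theorem Merge.unique {t : ℕ} {x y y' : List ℕ} (h : Merge t x y) (h' : Merge t x y') :
    y = y' := by
  induction h generalizing y' with
  | head => cases h'; rfl
  | cons c _ ih =>
    cases h' with
    | cons _ h' => rw [ih h']

theorem Merge.length_eq {t : ℕ} {x y : List ℕ} (h : Merge t x y) : x.length = y.length + 1 := by
  induction h with
  | head => rfl
  | cons c _ ih => simp [ih]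

theorem Merge.lt_length {t : ℕ} {x y : List ℕ} (h : Merge t x y) : t + 1 < x.length := by
  induction h with
  | head => simp
  | cons c _ ih => simpa using ih

theorem Merge.exchange {s t : ℕ} (hst : s ≤ t) {x y w : List ℕ} (h₁ : Merge (t + 1) x y)
    (h₂ : Merge s y w) : ∃ y', Merge s x y' ∧ Merge t y' w := by
  induction h₂ generalizing t x with
  | head a b v =>
    cases h₁ with
    | cons _ h₁ =>
      cases h₁ with
      | head b₁ b₂ _ =>
        refine ⟨_, Merge.head _ _ _, ?_⟩
        rw [← add_assoc]
        exact Merge.head _ _ _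
      | cons _ h₁ => exact ⟨_, Merge.head _ _ _, Merge.cons _ h₁⟩
  | cons c h₂ ih =>
    obtain ⟨t, rfl⟩ : ∃ t', t = t' + 1 := ⟨t - 1, by omega⟩
    cases h₁ with
    | cons _ h₁ =>
      obtain ⟨y', h, h'⟩ := ih (by omega) h₁
      exact ⟨_, Merge.cons _ h, Merge.cons _ h'⟩

theorem Merge.exchange' {s t : ℕ} (hst : s ≤ t) {x y w : List ℕ} (h₁ : Merge s x y)
    (h₂ : Merge t y w) : ∃ y', Merge (t + 1) x y' ∧ Merge s y' w := by
  induction h₁ generalizing t w with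
  | head a b v =>
    cases h₂ with
    | head _ c v =>
      refine ⟨_, Merge.cons _ (Merge.head _ _ _), ?_⟩
      rw [add_assoc]
      exact Merge.head _ _ _
    | cons _ h₂ => exact ⟨_, Merge.cons _ (Merge.cons _ h₂), Merge.head _ _ _⟩
  | cons c h₁ ih =>
    obtain ⟨t, rfl⟩ : ∃ t', t = t' + 1 := ⟨t - 1, by omega⟩
    cases h₂ with
    | cons _ h₂ =>
      obtain ⟨y', h, h'⟩ := ih (by omega) h₂
      exact ⟨_, Merge.cons _ h, Merge.cons _ h'⟩

/-- The word obtained from a word by adding up the entries in positions `t` and `t + 1`. -/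
def mergeAt : ℕ → List ℕ → List ℕ
  | 0, a :: b :: v => (a + b) :: v
  | t + 1, a :: v => a :: mergeAt t v
  | _, v => v

theorem merge_mergeAt {t : ℕ} {x : List ℕ} (h : t + 1 < x.length) : Merge t x (mergeAt t x) := by
  induction t generalizing x with
  | zero =>
    match x, h with
    | a :: b :: v, _ => exact Merge.head a b v
  | succ t ih =>
    match x, h with
    | a :: v, h => exact Merge.cons a (ih (by simpa using h))

theorem Raise.append_right {n p : ℕ} {x y : List ℕ} (h : Raise n p x y) (w : List ℕ) :
    Raise n p (x ++ w) (y ++ w) := by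
  induction h with
  | head a v => exact Raise.head a (v ++ w)
  | cons c _ ih => exact Raise.cons c ih

theorem Raise.length_eq {n p : ℕ} {x y : List ℕ} (h : Raise n p x y) : y.length = x.length := by
  induction h with
  | head => rfl
  | cons c _ ih => simp [ih]

theorem Raise.lt_length {n p : ℕ} {x y : List ℕ} (h : Raise n p x y) : p < x.length := by
  induction h with
  | head => simp
  | cons c _ ih => simpa using ih

theorem Raise.last {n i j : ℕ} (h : n + i = j) (l : List ℕ) :
    Raise n l.length (l ++ [i + 1]) (l ++ [j + 1]) := by
  induction l with
  | nil =>
    subst h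
    exact Raise.head (i + 1) []
  | cons c l ih => exact Raise.cons c ih

/-- `Refines w n`, for `n = (n_1, …, n_q)`: the word `w` is the concatenation of a composition of
`n_1` (a finite sequence of positive integers with sum `n_1`), …, a composition of `n_q`. -/
def Refines (w n : List ℕ) : Prop :=
  ∃ W : List (List ℕ), W.flatten = w ∧ W.map List.sum = n ∧ ∀ a ∈ w, 0 < a

theorem Merge.pos {t : ℕ} {x y : List ℕ} (h : Merge t x y) (hx : ∀ a ∈ x, 0 < a) :
    ∀ a ∈ y, 0 < a := by
  induction h with
  | head a b v =>
    have ha : 0 < a := hx a (by simp)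
    intro c hc
    rcases List.mem_cons.1 hc with rfl | hc
    · omega
    · exact hx c (by simp [hc])
  | cons c _ ih =>
    intro d hd
    rcases List.mem_cons.1 hd with rfl | hd
    · exact hx _ (by simp)
    · exact ih (fun a ha => hx a (by simp [ha])) d hd

theorem Merge.sum_eq {t : ℕ} {x y : List ℕ} (h : Merge t x y) : x.sum = y.sum := by
  induction h with
  | head a b v => simp [add_assoc]
  | cons c _ ih => simp [ih]

theorem Merge.split {t : ℕ} {x u v : List ℕ} (h : Merge t x (u ++ v)) :
    (∃ u', x = u' ++ v ∧ Merge t u' u) ∨ ∃ v' s, x = u ++ v' ∧ Merge s v' v := by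
  induction u generalizing t x with
  | nil => exact Or.inr ⟨x, t, rfl, h⟩
  | cons a u ih =>
    rw [List.cons_append] at h
    generalize hy : u ++ v = y at h
    generalize ha : a = a' at h
    cases h with
    | head b c _ =>
      subst hy
      exact Or.inl ⟨b :: c :: u, rfl, ha ▸ Merge.head b c u⟩
    | cons _ h =>
      subst hy ha
      rcases ih h with ⟨u', rfl, h'⟩ | ⟨v', s, rfl, h'⟩
      · exact Or.inl ⟨a :: u', rfl, Merge.cons a h'⟩
      · exact Or.inr ⟨v', s, rfl, h'⟩

theorem Merge.refines {t : ℕ} {x y n : List ℕ} (h : Merge t x y) (hx : ∀ a ∈ x, 0 < a)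
    (hy : Refines y n) : Refines x n := by
  obtain ⟨W, rfl, rfl, -⟩ := hy
  suffices ∃ W' : List (List ℕ), W'.flatten = x ∧ W'.map List.sum = W.map List.sum by
    obtain ⟨W', h₁, h₂⟩ := this
    exact ⟨W', h₁, h₂, hx⟩
  clear hx
  induction W generalizing t x with
  | nil =>
    rw [List.flatten_nil] at h
    cases h
  | cons u W ih =>
    rw [List.flatten_cons] at h
    rcases h.split with ⟨u', rfl, h'⟩ | ⟨v', s, rfl, h'⟩
    · exact ⟨u' :: W, rfl, by simp [h'.sum_eq]⟩
    · obtain ⟨W', rfl, h₂⟩ := ih h'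
      exact ⟨u :: W', rfl, by simp [h₂]⟩

/-! ### Quasi-algebras -/

/-- A (quasi-associative graded) quasi-algebra over the field `k`. The quasi-multiplication
`Z_{…,a,b,…} → Z_{…,a+b,…}` and the quasi-unit `Z_{…} → Z_{…,0,…}` are indexed by proofs that the
target word is obtained from the source word by the corresponding operation in position `t`. -/
structure QuasiAlgebra (k : Type u) [Field k] where
  obj : List ℤ → Type u
  [addCommGroup : ∀ x, AddCommGroup (obj x)]
  [module : ∀ x, Module k (obj x)]
  mul : ∀ {t : ℕ} {x y : List ℤ}, Merge t x y → obj x →ₗ[k] obj y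
  unit : ∀ {t : ℕ} {x y : List ℤ}, InsertZero t x y → obj x →ₗ[k] obj y
  /-- Quasi-multiplications at disjoint pairs of positions commute (`s < t`), and the two ways of
  multiplying three consecutive entries agree (`s = t`). -/
  mul_mul : ∀ {s t : ℕ} {x y y' w : List ℤ}, s ≤ t →
    ∀ (h₁ : Merge (t + 1) x y) (h₂ : Merge s y w) (h₁' : Merge s x y') (h₂' : Merge t y' w),
      mul h₂ ∘ₗ mul h₁ = mul h₂' ∘ₗ mul h₁'
  unit_unit : ∀ {s t : ℕ} {x y y' w : List ℤ}, s ≤ t →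
    ∀ (h₁ : InsertZero t x y) (h₂ : InsertZero s y w)
      (h₁' : InsertZero s x y') (h₂' : InsertZero (t + 1) y' w),
      unit h₂ ∘ₗ unit h₁ = unit h₂' ∘ₗ unit h₁'
  /-- A quasi-unit commutes with a quasi-multiplication to the left of it. -/
  mul_unit_of_lt : ∀ {s t : ℕ} {x y y' w : List ℤ}, s < t →
    ∀ (h₁ : InsertZero (t + 1) x y) (h₂ : Merge s y w)
      (h₁' : Merge s x y') (h₂' : InsertZero t y' w),
      mul h₂ ∘ₗ unit h₁ = unit h₂' ∘ₗ mul h₁'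
  /-- A quasi-unit commutes with a quasi-multiplication to the right of it. -/
  mul_unit_of_ge : ∀ {s t : ℕ} {x y y' w : List ℤ}, t ≤ s →
    ∀ (h₁ : InsertZero t x y) (h₂ : Merge (s + 1) y w)
      (h₁' : Merge s x y') (h₂' : InsertZero t y' w),
      mul h₂ ∘ₗ unit h₁ = unit h₂' ∘ₗ mul h₁'
  /-- Multiplying the inserted `0` with the next entry gives the identity. -/
  mul_unit_left : ∀ {t : ℕ} {x y : List ℤ} (h₁ : InsertZero t x y) (h₂ : Merge t y x),
    mul h₂ ∘ₗ unit h₁ = LinearMap.id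
  /-- Multiplying the previous entry with the inserted `0` gives the identity. -/
  mul_unit_right : ∀ {t : ℕ} {x y : List ℤ} (h₁ : InsertZero (t + 1) x y) (h₂ : Merge t y x),
    mul h₂ ∘ₗ unit h₁ = LinearMap.id
  /-- The identification of the component of the empty word with `k`. -/
  emptyEquiv : obj [] ≃ₗ[k] k

attribute [instance] QuasiAlgebra.addCommGroup QuasiAlgebra.module

namespace QuasiAlgebra

section

variable {k : Type u} [Field k] (Z : QuasiAlgebra k)

/-- The components with a negative index vanish. -/
def IsNonnegative : Prop := ∀ x : List ℤ, (∃ a ∈ x, a < 0) → Subsingleton (Z.obj x)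

/-- A positive quasi-algebra: nonnegative, and all the quasi-unit maps are isomorphisms. -/
def IsPositive : Prop :=
  Z.IsNonnegative ∧
    ∀ {t : ℕ} {x y : List ℤ} (h : InsertZero t x y), Function.Bijective (Z.unit h)

/-- The components with nonnegative indices. -/
abbrev comp (x : List ℕ) : Type u := Z.obj (castWord x)

/-- The quasi-multiplications between the components with nonnegative indices. -/
def nmul {t : ℕ} {x y : List ℕ} (h : Merge t x y) : Z.comp x →ₗ[k] Z.comp y := Z.mul h.cast

theorem nmul_nmul {s t t' : ℕ} {x y y' w : List ℕ} (hst : s ≤ t) (ht : t' = t + 1)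
    (h₁ : Merge t' x y) (h₂ : Merge s y w) (h₁' : Merge s x y') (h₂' : Merge t y' w)
    (z : Z.comp x) : Z.nmul h₂ (Z.nmul h₁ z) = Z.nmul h₂' (Z.nmul h₁' z) := by
  subst ht
  exact LinearMap.congr_fun (Z.mul_mul hst h₁.cast h₂.cast h₁'.cast h₂'.cast) z

/-! ### The complexes `E_{l_p, …, l_0; n_1, …, n_q}` and `B_{n_1, …, n_m}` -/

/-- The index set for the term of homological degree `i` of `B_{n_1} ⊗ ⋯ ⊗ B_{n_q}`. -/
abbrev BarWord (n : List ℕ) (i : ℕ) : Type := {w : List ℕ // w.length = i ∧ Refines w n}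

variable (l n : List ℕ)

/-- The term of homological degree `i` of the complex `E_{l; n}`. -/
abbrev BarObj (i : ℕ) : Type u := DirectSum (BarWord n i) fun w => Z.comp (l ++ w.1)

variable {n} in
/-- The inclusion of the component indexed by `w`. -/
def inc {i : ℕ} (w : BarWord n i) : Z.comp (l ++ w.1) →ₗ[k] Z.BarObj l n i :=
  DirectSum.lof k (BarWord n i) (fun w => Z.comp (l ++ w.1)) w

open Classical in
/-- The map which multiplies the entries in positions `t, t + 1` of the word `w = (w_0, w_1, …)`,
on those components for which both of these entries belong to one of the factors `B_{n_s}`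
(that is, the resulting word still refines `n`); it is zero on the other components. -/
noncomputable def face (i t : ℕ) : Z.BarObj l n (i + 1) →ₗ[k] Z.BarObj l n i :=
  DirectSum.toModule k (BarWord n (i + 1)) _ fun w =>
    if h : t + 1 < w.1.length ∧ Refines (mergeAt t w.1) n then
      Z.inc l ⟨mergeAt t w.1,
          Nat.succ_injective ((merge_mergeAt h.1).length_eq.symm.trans w.2.1), h.2⟩ ∘ₗ
        Z.nmul ((merge_mergeAt h.1).append_left l)
    else 0

/-- The differential `∑_t (-1)^t (multiplication of the entries in positions t, t + 1)` of the
tensor product of the reduced bar complexes. -/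
noncomputable def barD (i : ℕ) : Z.BarObj l n (i + 1) →ₗ[k] Z.BarObj l n i :=
  ∑ t ∈ Finset.range i, (-1 : k) ^ t • Z.face l n i t

variable {l n}

theorem barObj_ext {i : ℕ} {N : Type*} [AddCommGroup N] [Module k N]
    {f g : Z.BarObj l n i →ₗ[k] N}
    (h : ∀ (w : BarWord n i) (z : Z.comp (l ++ w.1)), f (Z.inc l w z) = g (Z.inc l w z)) :
    f = g :=
  DirectSum.linearMap_ext k fun w => LinearMap.ext fun z => h w z

theorem face_inc {i t : ℕ} (w : BarWord n (i + 1)) (w' : BarWord n i) (h : Merge t w.1 w'.1)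
    (z : Z.comp (l ++ w.1)) :
    Z.face l n i t (Z.inc l w z) = Z.inc l w' (Z.nmul (h.append_left l) z) := by
  have hw : w'.1 = mergeAt t w.1 := h.unique (merge_mergeAt h.lt_length)
  obtain ⟨w', hw'⟩ := w'
  subst hw
  unfold face
  conv_lhs => arg 2; rw [inc]
  rw [DirectSum.toModule_lof, dif_pos ⟨h.lt_length, hw'.2⟩]
  rfl

theorem face_inc_eq_zero {i t : ℕ} (w : BarWord n (i + 1))
    (h : ∀ w' : BarWord n i, ¬ Merge t w.1 w'.1) (z : Z.comp (l ++ w.1)) :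
    Z.face l n i t (Z.inc l w z) = 0 := by
  unfold face
  conv_lhs => arg 2; rw [inc]
  rw [DirectSum.toModule_lof, dif_neg]
  · rfl
  · rintro ⟨h₁, h₂⟩
    exact h ⟨_, Nat.succ_injective ((merge_mergeAt h₁).length_eq.symm.trans w.2.1), h₂⟩
      (merge_mergeAt h₁)

theorem face_face {i s t : ℕ} (hst : s ≤ t) :
    Z.face l n i s ∘ₗ Z.face l n (i + 1) (t + 1) = Z.face l n i t ∘ₗ Z.face l n (i + 1) s := by
  have pos : ∀ {i} (w : BarWord n i), ∀ a ∈ w.1, 0 < a := fun w => by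
    obtain ⟨_, _, _, h⟩ := w.2.2
    exact h
  refine Z.barObj_ext fun w z => ?_
  rw [LinearMap.comp_apply, LinearMap.comp_apply]
  by_cases h : ∃ (y : BarWord n (i + 1)) (v : BarWord n i), Merge (t + 1) w.1 y.1 ∧ Merge s y.1 v.1
  · obtain ⟨y, v, h₁, h₂⟩ := h
    obtain ⟨y', h₁', h₂'⟩ := h₁.exchange hst h₂
    have hy' : Refines y' n := h₂'.refines (h₁'.pos (pos w)) v.2.2
    rw [Z.face_inc w y h₁, Z.face_inc y v h₂,
      Z.face_inc w ⟨y', by rw [h₂'.length_eq, v.2.1], hy'⟩ h₁', Z.face_inc _ v h₂']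
    congr 1
    exact Z.nmul_nmul (by omega) (by omega) _ _ _ _ z
  · have hL : Z.face l n i s (Z.face l n (i + 1) (t + 1) (Z.inc l w z)) = 0 := by
      by_cases h₁ : ∃ y : BarWord n (i + 1), Merge (t + 1) w.1 y.1
      · obtain ⟨y, h₁⟩ := h₁
        rw [Z.face_inc w y h₁, Z.face_inc_eq_zero y fun v h₂ => h ⟨y, v, h₁, h₂⟩]
      · rw [Z.face_inc_eq_zero w fun y h₂ => h₁ ⟨y, h₂⟩, map_zero]
    have hR : Z.face l n i t (Z.face l n (i + 1) s (Z.inc l w z)) = 0 := by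
      by_cases h₁ : ∃ y : BarWord n (i + 1), Merge s w.1 y.1
      · obtain ⟨y, h₁⟩ := h₁
        rw [Z.face_inc w y h₁, Z.face_inc_eq_zero y]
        intro v h₂
        obtain ⟨y', h₁', h₂'⟩ := h₁.exchange' hst h₂
        exact h ⟨⟨y', by rw [h₂'.length_eq, v.2.1],
          h₂'.refines (h₁'.pos (pos w)) v.2.2⟩, v, h₁', h₂'⟩
      · rw [Z.face_inc_eq_zero w fun y h₂ => h₁ ⟨y, h₂⟩, map_zero]
    rw [hL, hR]

theorem barD_apply (i : ℕ) (z : Z.BarObj l n (i + 1)) :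
    Z.barD l n i z = ∑ t ∈ Finset.range i, (-1 : k) ^ t • Z.face l n i t z := by
  rw [barD, LinearMap.sum_apply]
  rfl

theorem barD_comp_barD (i : ℕ) : Z.barD l n i ∘ₗ Z.barD l n (i + 1) = 0 := by
  refine LinearMap.ext fun z => ?_
  have e : (Z.barD l n i ∘ₗ Z.barD l n (i + 1)) z =
      ∑ p ∈ Finset.range i ×ˢ Finset.range (i + 1),
        (-1 : k) ^ (p.1 + p.2) • (Z.face l n i p.1 (Z.face l n (i + 1) p.2 z)) := by
    rw [LinearMap.comp_apply, barD_apply, barD_apply, Finset.sum_product]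
    refine Finset.sum_congr rfl fun s _ => ?_
    rw [map_sum, Finset.smul_sum]
    refine Finset.sum_congr rfl fun t _ => ?_
    rw [map_smul, smul_smul, pow_add]
  have ff : ∀ {s t : ℕ}, s ≤ t → Z.face l n i s (Z.face l n (i + 1) (t + 1) z) =
      Z.face l n i t (Z.face l n (i + 1) s z) :=
    fun hst => LinearMap.congr_fun (Z.face_face hst) z
  rw [e, LinearMap.zero_apply]
  refine Finset.sum_involution
    (fun p _ => if p.1 < p.2 then (p.2 - 1, p.1) else (p.2, p.1 + 1)) ?_ ?_ ?_ ?_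
  · rintro ⟨s, t⟩ _
    dsimp only
    split_ifs with hst
    · obtain ⟨t, rfl⟩ : ∃ t', t = t' + 1 := ⟨t - 1, by omega⟩
      simp only [add_tsub_cancel_right]
      rw [ff (show s ≤ t by omega), ← add_smul,
        show (-1 : k) ^ (s + (t + 1)) + (-1) ^ (t + s) = 0 by ring, zero_smul]
    · dsimp only
      rw [ff (show t ≤ s by omega), ← add_smul,
        show (-1 : k) ^ (s + t) + (-1) ^ (t + (s + 1)) = 0 by ring, zero_smul]
  · rintro ⟨s, t⟩ _ _
    dsimp only
    split_ifs with hst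
    · intro h
      simp only [Prod.mk.injEq] at h
      omega
    · intro h
      simp only [Prod.mk.injEq] at h
      omega
  · rintro ⟨s, t⟩ h
    simp only [Finset.mem_product, Finset.mem_range] at h ⊢
    split_ifs with hst <;> dsimp only <;> omega
  · rintro ⟨s, t⟩ h
    by_cases hst : s < t
    · simp only [hst, if_true]
      rw [if_neg (by omega)]
      simp only [Prod.mk.injEq, true_and]
      omega
    · simp only [hst, if_false]
      rw [if_pos (by omega)]
      simp

variable (l n)

/-- The complex `E_{l_p, …, l_0; n_1, …, n_q}`: in `Z_{l_p} ⊗ ⋯ ⊗ Z_{l_0} ⊗ B_{n_1} ⊗ ⋯ ⊗ B_{n_q}`,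
where `B_n` is the degree `n` component of the reduced bar complex of a positively graded algebra
`Z`, all the tensor products of graded components of the algebra are replaced by the components of
the quasi-algebra. Here `l = (l_p, …, l_0)` and `n = (n_1, …, n_q)`. -/
noncomputable def barComplex : ChainComplex (ModuleCat.{u} k) ℕ :=
  ChainComplex.of (fun i => ModuleCat.of k (Z.BarObj l n i))
    (fun i => ModuleCat.ofHom (Z.barD l n i))
    (fun i => ModuleCat.hom_ext (Z.barD_comp_barD i))

/-- A (positive) quasi-algebra is Koszul if each complex `B_{n_1, …, n_m}` has no homology except
in the homological degree `n_1 + ⋯ + n_m`. -/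
def IsKoszul : Prop :=
  ∀ (n : List ℕ) (i : ℕ), i ≠ n.sum → Limits.IsZero ((Z.barComplex [] n).homology i)

end

/-! ### Left actions of a graded algebra in a quasi-algebra -/

section Action

variable {k A : Type u} [Field k] [Ring A] [Algebra k A]
  (𝒜 : ℕ → Submodule k A) [GradedAlgebra 𝒜] (Z : QuasiAlgebra k)

/-- A left action of the graded algebra `A = ⨁ 𝒜 n` in the quasi-algebra `Z`: maps
`𝒜 n ⊗ Z_{l_p, …, l_1, n_0, …, n_q} → Z_{l_p, …, l_1, n + n_0, n_1, …, n_q}` for each position `p`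
of the entry `n_0`, making the direct sum over `n_0` a graded `A`-module and commuting with the
quasi-multiplications of the entries `n_t, n_{t+1}`, `t ≥ 0`. -/
structure LeftAction where
  act : ∀ {n p : ℕ} {x y : List ℕ}, Raise n p x y → 𝒜 n →ₗ[k] Z.comp x →ₗ[k] Z.comp y
  one_act : ∀ {p : ℕ} {x : List ℕ} (h : Raise 0 p x x) (z : Z.comp x),
    act h ⟨1, SetLike.one_mem_graded 𝒜⟩ z = z
  mul_act : ∀ {m n p : ℕ} {x y w : List ℕ} (h₁ : Raise n p x y) (h₂ : Raise m p y w)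
    (h : Raise (m + n) p x w) (a : 𝒜 m) (b : 𝒜 n) (z : Z.comp x),
    act h ⟨a.1 * b.1, SetLike.mul_mem_graded a.2 b.2⟩ z = act h₂ a (act h₁ b z)
  act_mul : ∀ {n p t : ℕ} {x x' y y' : List ℕ}, p ≤ t →
    ∀ (h₁ : Merge t x y) (h₂ : Merge t x' y') (h : Raise n p x x') (h' : Raise n p y y')
      (a : 𝒜 n) (z : Z.comp x), act h' a (Z.nmul h₁ z) = Z.nmul h₂ (act h a z)

namespace LeftAction

variable {𝒜} {Z} (α : LeftAction 𝒜 Z)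

/-- The action of `a` on the terms of the complexes `E_{l; n}`, for `l'` obtained from `l` by
adding the degree of `a` to the entry in position `p`. -/
noncomputable def barAct {m p : ℕ} {l l' : List ℕ} (h : Raise m p l l') (n : List ℕ) (a : 𝒜 m)
    (i : ℕ) : Z.BarObj l n i →ₗ[k] Z.BarObj l' n i :=
  DirectSum.toModule k (BarWord n i) _ fun w => Z.inc l' w ∘ₗ α.act (h.append_right w.1) a

theorem barAct_inc {m p : ℕ} {l l' : List ℕ} (h : Raise m p l l') {n : List ℕ} (a : 𝒜 m)
    {i : ℕ} (w : BarWord n i) (z : Z.comp (l ++ w.1)) :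
    α.barAct h n a i (Z.inc l w z) = Z.inc l' w (α.act (h.append_right w.1) a z) := by
  unfold barAct
  conv_lhs => arg 2; rw [inc]
  rw [DirectSum.toModule_lof]
  rfl

theorem face_barAct {m p : ℕ} {l l' : List ℕ} (h : Raise m p l l') (n : List ℕ) (a : 𝒜 m)
    (i t : ℕ) : Z.face l' n i t ∘ₗ α.barAct h n a (i + 1) =
      α.barAct h n a i ∘ₗ Z.face l n i t := by
  refine Z.barObj_ext fun w z => ?_
  rw [LinearMap.comp_apply, LinearMap.comp_apply, barAct_inc]
  by_cases hw : ∃ w' : BarWord n i, Merge t w.1 w'.1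
  · obtain ⟨w', hw⟩ := hw
    rw [Z.face_inc w w' hw, Z.face_inc w w' hw, barAct_inc]
    congr 1
    have key : ∀ (s : ℕ) (hs : s = l.length + t) (h₂ : Merge s (l' ++ w.1) (l' ++ w'.1)),
        Z.nmul h₂ (α.act (h.append_right w.1) a z) =
          α.act (h.append_right w'.1) a (Z.nmul (hw.append_left l) z) := by
      rintro s rfl h₂
      exact (α.act_mul (h.lt_length.le.trans (Nat.le_add_right _ _)) _ _ _ _ a z).symm
    exact key _ (by rw [h.length_eq]) _
  · rw [Z.face_inc_eq_zero w fun w' h' => hw ⟨w', h'⟩,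
      Z.face_inc_eq_zero w fun w' h' => hw ⟨w', h'⟩, map_zero]

/-- The action of `a` as a morphism of complexes `E_{l; n} → E_{l'; n}`. -/
noncomputable def barHom {m p : ℕ} {l l' : List ℕ} (h : Raise m p l l') (n : List ℕ) (a : 𝒜 m) :
    Z.barComplex l n ⟶ Z.barComplex l' n where
  f i := ModuleCat.ofHom (α.barAct h n a i)
  comm' i j hij := by
    obtain rfl : j + 1 = i := hij
    simp only [barComplex, ChainComplex.of_d]
    refine ModuleCat.hom_ext ?_
    change Z.barD l' n j ∘ₗ α.barAct h n a (j + 1) = α.barAct h n a j ∘ₗ Z.barD l n j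
    refine LinearMap.ext fun z => ?_
    rw [LinearMap.comp_apply, LinearMap.comp_apply, barD_apply, barD_apply, map_sum]
    refine Finset.sum_congr rfl fun t _ => ?_
    rw [map_smul]
    congr 1
    exact LinearMap.congr_fun (α.face_barAct h n a j t) z

theorem barHom_add {m p : ℕ} {l l' : List ℕ} (h : Raise m p l l') (n : List ℕ) (a b : 𝒜 m) :
    α.barHom h n (a + b) = α.barHom h n a + α.barHom h n b := by
  refine HomologicalComplex.hom_ext _ _ fun i => ModuleCat.hom_ext ?_
  refine Z.barObj_ext fun w z => ?_
  change α.barAct h n (a + b) i (Z.inc l w z) =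
    α.barAct h n a i (Z.inc l w z) + α.barAct h n b i (Z.inc l w z)
  rw [barAct_inc, barAct_inc, barAct_inc, map_add, LinearMap.add_apply, map_add]

theorem barHom_smul {m p : ℕ} {l l' : List ℕ} (h : Raise m p l l') (n : List ℕ) (c : k)
    (a : 𝒜 m) : α.barHom h n (c • a) = c • α.barHom h n a := by
  refine HomologicalComplex.hom_ext _ _ fun i => ModuleCat.hom_ext ?_
  refine Z.barObj_ext fun w z => ?_
  change α.barAct h n (c • a) i (Z.inc l w z) = c • α.barAct h n a i (Z.inc l w z)
  rw [barAct_inc, barAct_inc, map_smul, LinearMap.smul_apply, map_smul]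

theorem barHom_one {p : ℕ} {l : List ℕ} (h : Raise 0 p l l) (n : List ℕ) :
    α.barHom h n ⟨1, SetLike.one_mem_graded 𝒜⟩ = 𝟙 _ := by
  refine HomologicalComplex.hom_ext _ _ fun i => ModuleCat.hom_ext ?_
  refine Z.barObj_ext fun w z => ?_
  change α.barAct h n _ i (Z.inc l w z) = Z.inc l w z
  rw [barAct_inc, α.one_act]

theorem barHom_mul {m₁ m₂ p : ℕ} {l l' l'' : List ℕ} (h₁ : Raise m₂ p l l') (h₂ : Raise m₁ p l' l'')
    (h : Raise (m₁ + m₂) p l l'') (n : List ℕ) (a : 𝒜 m₁) (b : 𝒜 m₂) :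
    α.barHom h n ⟨a.1 * b.1, SetLike.mul_mem_graded a.2 b.2⟩ =
      α.barHom h₁ n b ≫ α.barHom h₂ n a := by
  refine HomologicalComplex.hom_ext _ _ fun i => ModuleCat.hom_ext ?_
  refine Z.barObj_ext fun w z => ?_
  change α.barAct h n _ i (Z.inc l w z) = α.barAct h₂ n a i (α.barAct h₁ n b i (Z.inc l w z))
  rw [barAct_inc, barAct_inc, barAct_inc]
  congr 1
  exact α.mul_act _ _ _ a b z

/-- The action of `a` on the homology of the complexes `E_{l; n}`. -/
noncomputable def homologyAct {m p : ℕ} {l l' : List ℕ} (h : Raise m p l l') (n : List ℕ) (i : ℕ)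
    (a : 𝒜 m) : (Z.barComplex l n).homology i →ₗ[k] (Z.barComplex l' n).homology i :=
  (HomologicalComplex.homologyMap (α.barHom h n a) i).hom

theorem homologyAct_add {m p : ℕ} {l l' : List ℕ} (h : Raise m p l l') (n : List ℕ) (i : ℕ)
    (a b : 𝒜 m) : α.homologyAct h n i (a + b) = α.homologyAct h n i a + α.homologyAct h n i b := by
  unfold homologyAct
  rw [barHom_add, HomologicalComplex.homologyMap_add, ModuleCat.hom_add]

theorem homologyAct_smul {m p : ℕ} {l l' : List ℕ} (h : Raise m p l l') (n : List ℕ) (i : ℕ)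
    (c : k) (a : 𝒜 m) : α.homologyAct h n i (c • a) = c • α.homologyAct h n i a := by
  unfold homologyAct
  have : HomologicalComplex.homologyMap (c • α.barHom h n a) i =
      c • HomologicalComplex.homologyMap (α.barHom h n a) i :=
    ShortComplex.homologyMap_smul
      ((HomologicalComplex.shortComplexFunctor _ _ i).map (α.barHom h n a)) c
  rw [barHom_smul, this, ModuleCat.hom_smul]

theorem homologyAct_one {p : ℕ} {l : List ℕ} (h : Raise 0 p l l) (n : List ℕ) (i : ℕ) :
    α.homologyAct h n i ⟨1, SetLike.one_mem_graded 𝒜⟩ = LinearMap.id := by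
  unfold homologyAct
  rw [barHom_one, HomologicalComplex.homologyMap_id, ModuleCat.hom_id]

theorem homologyAct_mul {m₁ m₂ p : ℕ} {l l' l'' : List ℕ} (h₁ : Raise m₂ p l l')
    (h₂ : Raise m₁ p l' l'') (h : Raise (m₁ + m₂) p l l'') (n : List ℕ) (i : ℕ) (a : 𝒜 m₁)
    (b : 𝒜 m₂) :
    α.homologyAct h n i ⟨a.1 * b.1, SetLike.mul_mem_graded a.2 b.2⟩ =
      α.homologyAct h₂ n i a ∘ₗ α.homologyAct h₁ n i b := by
  unfold homologyAct
  rw [α.barHom_mul h₁ h₂ h, HomologicalComplex.homologyMap_comp, ModuleCat.hom_comp]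

/-- The graded `A`-module `⨁_{l_0 ≥ 1} H_{n_1 + ⋯ + n_q}(E_{l_p, …, l_1, l_0; n_1, …, n_q})` in the
grading shifted by `1`: the summand with the index `l_0` is placed in degree `l_0 - 1`.
Here `l = (l_p, …, l_1)` and `n = (n_1, …, n_q)`. -/
noncomputable def homologyModule (l n : List ℕ) : GradedModule 𝒜 where
  obj j := (Z.barComplex (l ++ [j + 1]) n).homology n.sum
  act h :=
    { toFun := α.homologyAct (Raise.last h l) n n.sum
      map_add' := α.homologyAct_add (Raise.last h l) n n.sum
      map_smul' := α.homologyAct_smul (Raise.last h l) n n.sum }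
  one_act h z := LinearMap.congr_fun (α.homologyAct_one (Raise.last h l) n n.sum) z
  mul_act h₁ h₂ h a b z := LinearMap.congr_fun
    (α.homologyAct_mul (Raise.last h₁ l) (Raise.last h₂ l) (Raise.last h l) n n.sum a b) z

end LeftAction

end Action

end QuasiAlgebra

end QuasiKoszul

/-!
The complexes `E_{l; n} = Z_{l_p} ⊗ ⋯ ⊗ Z_{l_1} ⊗ B_{n_1} ⊗ ⋯ ⊗ B_{n_q}` with positive `l` and `n`
are shown to have homology in the degree `n_1 + ⋯ + n_q` only, by induction on this sum; the
complexes `B_{n_1, …, n_m}` are those with empty `l`, and zero entries of `n` can be omitted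
(`isZero_homology_congr`). Let the first entry of `n` be `c + 1`, and denote the list of
the other entries by `n` again.

**The first letter.** The terms of `E_{l; c + 1, n}` in positive homological degrees, for all `c`,
form a complex of graded `A`-modules `X`, with `A` acting on the first letter of the word which
follows `l` (`headComplex`). The operation `a ⋆ -` of inserting the element `a = a · 1` of positive
degree as a new letter in that place (`prepend`) is a null homotopy of the action of `a`. The
iterated operation `a₁ ⊗ ⋯ ⊗ a_i ⊗ x ↦ a₁ ⋆ (⋯ ⋆ (a_i ⋆ x))` then maps the total complex of the bar
double complex `A₊^{⊗ i} ⊗ X_s` to `X` up to a shift, and restricts to the identity on the column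
`i = 0`. Hence the homology of `X` vanishes wherever that of the total complex does
(`exists_of_totExact`).

**The filtration.** A word refining `c + 1, n` consists of a first letter `c - m + 1` and a word
refining `m, n`, where `m` is omitted if it is `0`. The first letter does not decrease under the
differential, so that `X` is filtered by complexes of graded `A`-modules with the successive
quotients `⨁_j E_{l, j + 1; m, n}`, on which the multiplications involving the first letter vanish
(`headFiltration`). It remains to treat the bar double complexes of these quotients
(`Filtration.totExact`).

**The quotients.** As `m ≤ c`, the induction assumption applies to `E_{l, j + 1; m, n}`: its
homology is concentrated in the degree `h = m + n_1 + ⋯ + n_q`, and a `k`-linear retraction onto it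
identifies the homology of the total complex with `Tor^A(k, H_h)` shifted by `h`
(`Retraction.totExact`). The Koszulity of the homology module places this homology in the total
degree `c + n_1 + ⋯ + n_q` when the internal degree is `c - m`, which is the assertion for
`E_{l; c + 1, n}` once the homological degree lowered by `1` in `X` is restored.
-/

namespace QuasiKoszul

/-! ### Functoriality of the bar construction -/

namespace GradedModule

variable {k A : Type u} [Field k] [Ring A] [Algebra k A]
  {𝒜 : ℕ → Submodule k A} [GradedAlgebra 𝒜] {L M N P : GradedModule 𝒜}

/-- The map `A₊ ⊗ ⋯ ⊗ A₊ ⊗ M → A₊ ⊗ ⋯ ⊗ A₊ ⊗ N` induced by a degree-preserving `k`-linear map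
`f : M → N`. The map `f` need not respect the action of `A`. -/
def barMap (f : ∀ j, M.obj j →ₗ[k] N.obj j) : ∀ i j, (M.bar i).obj j →ₗ[k] (N.bar i).obj j
  | 0 => f
  | i + 1 => plusMap (barMap f i)

theorem PlusIndex.add_right {a b c i m j : ℕ} (hp : 0 < a ∧ a + b = i) (h : i + m = j)
    (hbc : b + m = c) : 0 < a ∧ a + c = j := ⟨hp.1, by omega⟩

/-- The element `a ⊗ x` of `A₊ ⊗ (A₊ ⊗ ⋯ ⊗ A₊ ⊗ M)`, in degree `j`. -/
def barMk (M : GradedModule 𝒜) {s j a b : ℕ} (hp : 0 < a ∧ a + b = j) (y : 𝒜 a)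
    (x : (M.bar s).obj b) : (M.bar (s + 1)).obj j :=
  (M.bar s).plusMk ⟨(a, b), hp⟩ y x

theorem barMk_add {s j a b : ℕ} (hp : 0 < a ∧ a + b = j) (y : 𝒜 a) (x x' : (M.bar s).obj b) :
    M.barMk hp y (x + x') = M.barMk hp y x + M.barMk hp y x' :=
  map_add ((M.bar s).plusMkHom ⟨(a, b), hp⟩ y) x x'

theorem barMk_zero {s j a b : ℕ} (hp : 0 < a ∧ a + b = j) (y : 𝒜 a) :
    M.barMk hp y (0 : (M.bar s).obj b) = 0 :=
  map_zero ((M.bar s).plusMkHom ⟨(a, b), hp⟩ y)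

theorem bar_hom_ext {s j : ℕ} {V : Type u} [AddCommGroup V] [Module k V]
    {f g : (M.bar (s + 1)).obj j →ₗ[k] V}
    (h : ∀ (a b : ℕ) (hp : 0 < a ∧ a + b = j) (y : 𝒜 a) (x : (M.bar s).obj b),
      f (M.barMk hp y x) = g (M.barMk hp y x)) : f = g :=
  (M.bar s).plus_hom_ext fun p y x => h p.1.1 p.1.2 p.2 y x

theorem act_barMk {s n i j a b : ℕ} (h : n + i = j) (c : 𝒜 n) (hp : 0 < a ∧ a + b = i) (y : 𝒜 a)
    (x : (M.bar s).obj b) :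
    (M.bar (s + 1)).act h c (M.barMk hp y x) =
      M.barMk ⟨Nat.add_pos_right _ hp.1, by rw [add_assoc, hp.2, h]⟩
        (⟨c.1 * y.1, SetLike.mul_mem_graded c.2 y.2⟩ : 𝒜 (n + a)) x :=
  (M.bar s).plus_act_mk h c ⟨(a, b), hp⟩ y x

theorem barMap_barMk (f : ∀ j, M.obj j →ₗ[k] N.obj j) {s j a b : ℕ} (hp : 0 < a ∧ a + b = j)
    (y : 𝒜 a) (x : (M.bar s).obj b) :
    barMap f (s + 1) j (M.barMk hp y x) = N.barMk hp y (barMap f s b x) :=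
  plusMap_mk _ ⟨(a, b), hp⟩ y x

theorem barD_zero_barMk {j a b : ℕ} (hp : 0 < a ∧ a + b = j) (y : 𝒜 a)
    (x : (M.bar 0).obj b) : M.barD 0 j (M.barMk hp y x) = (M.bar 0).act hp.2 y x :=
  M.plusCounit_mk ⟨(a, b), hp⟩ y x

theorem barD_succ_barMk {s j a b : ℕ} (hp : 0 < a ∧ a + b = j) (y : 𝒜 a)
    (x : (M.bar (s + 1)).obj b) :
    M.barD (s + 1) j (M.barMk hp y x) =
      (M.bar (s + 1)).act hp.2 y x - M.barMk hp y (M.barD s b x) :=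
  congrArg₂ (fun u v : (M.bar (s + 1)).obj j => u - v)
    ((M.bar (s + 1)).plusCounit_mk ⟨(a, b), hp⟩ y x) (plusMap_mk (M.barD s) ⟨(a, b), hp⟩ y x)

/-- The bilinear map `(y, x) ↦ y ⊗ x` into `A₊ ⊗ (A₊ ⊗ ⋯ ⊗ A₊ ⊗ M)`. -/
def barMkHom (M : GradedModule 𝒜) {s j a b : ℕ} (hp : 0 < a ∧ a + b = j) :
    𝒜 a →ₗ[k] (M.bar s).obj b →ₗ[k] (M.bar (s + 1)).obj j :=
  (M.bar s).plusMkHom ⟨(a, b), hp⟩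

/-- The linear map out of `A₊ ⊗ (A₊ ⊗ ⋯ ⊗ A₊ ⊗ M)` given by bilinear maps on homogeneous
components. -/
def barDesc (M : GradedModule 𝒜) {s j : ℕ} {V : Type u} [AddCommGroup V] [Module k V]
    (f : ∀ a b : ℕ, 0 < a ∧ a + b = j → (𝒜 a →ₗ[k] (M.bar s).obj b →ₗ[k] V)) :
    (M.bar (s + 1)).obj j →ₗ[k] V :=
  (M.bar s).plusDesc fun p => f p.1.1 p.1.2 p.2

theorem barDesc_barMk {s j : ℕ} {V : Type u} [AddCommGroup V] [Module k V]
    (f : ∀ a b : ℕ, 0 < a ∧ a + b = j → (𝒜 a →ₗ[k] (M.bar s).obj b →ₗ[k] V)) {a b : ℕ}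
    (hp : 0 < a ∧ a + b = j) (y : 𝒜 a) (x : (M.bar s).obj b) :
    M.barDesc f (M.barMk hp y x) = f a b hp y x :=
  (M.bar s).plusDesc_mk _ ⟨(a, b), hp⟩ y x

theorem barMap_comp {f : ∀ j, L.obj j →ₗ[k] M.obj j} {g : ∀ j, M.obj j →ₗ[k] N.obj j}
    {e : ∀ j, L.obj j →ₗ[k] N.obj j} (h : ∀ j x, g j (f j x) = e j x) (i j : ℕ)
    (z : (L.bar i).obj j) : barMap g i j (barMap f i j z) = barMap e i j z := by
  induction i generalizing j with
  | zero => exact h j z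
  | succ i ih =>
    suffices barMap g (i + 1) j ∘ₗ barMap f (i + 1) j = barMap e (i + 1) j from
      LinearMap.congr_fun this z
    refine bar_hom_ext fun a b hp y x => ?_
    rw [LinearMap.comp_apply, barMap_barMk, barMap_barMk, barMap_barMk, ih]

theorem barMap_eq_self {f : ∀ j, M.obj j →ₗ[k] M.obj j} {j : ℕ} (h : ∀ j' ≤ j, ∀ x, f j' x = x)
    (i : ℕ) (z : (M.bar i).obj j) : barMap f i j z = z := by
  induction i generalizing j with
  | zero => exact h j le_rfl z
  | succ i ih =>
    suffices barMap f (i + 1) j = LinearMap.id from LinearMap.congr_fun this z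
    refine bar_hom_ext fun a b hp y x => ?_
    rw [barMap_barMk, LinearMap.id_apply,
      ih fun j' hj' => h j' (by omega)]

theorem barMap_add {f g e : ∀ j, M.obj j →ₗ[k] N.obj j} (h : ∀ j x, f j x + g j x = e j x)
    (i j : ℕ) (z : (M.bar i).obj j) : barMap f i j z + barMap g i j z = barMap e i j z := by
  induction i generalizing j with
  | zero => exact h j z
  | succ i ih =>
    suffices barMap f (i + 1) j + barMap g (i + 1) j = barMap e (i + 1) j from
      LinearMap.congr_fun this z
    refine bar_hom_ext fun a b hp y x => ?_
    rw [LinearMap.add_apply, barMap_barMk, barMap_barMk, barMap_barMk, ← ih, barMk_add]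

theorem barMap_eq_zero {f : ∀ j, M.obj j →ₗ[k] N.obj j} (h : ∀ j x, f j x = 0)
    (i j : ℕ) (z : (M.bar i).obj j) : barMap f i j z = 0 := by
  have := barMap_add (f := f) (g := f) (e := f) (fun j x => by rw [h, add_zero]) i j z
  exact left_eq_add.1 this.symm

theorem barMap_act {e : ∀ j, M.obj j →ₗ[k] N.obj j} {f : ∀ j, N.obj j →ₗ[k] P.obj j}
    {g : ∀ j, M.obj j →ₗ[k] P.obj j}
    (h : ∀ {n i j : ℕ} (hij : n + i = j) (a : 𝒜 n) (x : M.obj i),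
      f j (N.act hij a (e i x)) = P.act hij a (g i x))
    (i : ℕ) {n r s : ℕ} (hrs : n + r = s) (a : 𝒜 n) (z : (M.bar i).obj r) :
    barMap f i s ((N.bar i).act hrs a (barMap e i r z)) =
      (P.bar i).act hrs a (barMap g i r z) := by
  cases i with
  | zero => exact h hrs a z
  | succ i =>
    have hfe : ∀ j x, f j (e j x) = g j x := fun j x => by
      rw [← N.one_act (zero_add j) (e j x), h, P.one_act]
    refine (plusMap_act _ hrs a _).trans ?_
    exact congrArg _ (barMap_comp hfe (i + 1) r z)

/-- The bar differential only involves the action of `A` on `M` through the products `a x`; hence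
an identity `f (a (e x)) = a (g x)` carries over to it. -/
theorem barMap_barD {e : ∀ j, M.obj j →ₗ[k] N.obj j} {f : ∀ j, N.obj j →ₗ[k] P.obj j}
    {g : ∀ j, M.obj j →ₗ[k] P.obj j}
    (h : ∀ {n i j : ℕ} (hij : n + i = j) (a : 𝒜 n) (x : M.obj i),
      f j (N.act hij a (e i x)) = P.act hij a (g i x))
    (i j : ℕ) (z : (M.bar (i + 1)).obj j) :
    barMap f i j (N.barD i j (barMap e (i + 1) j z)) = P.barD i j (barMap g (i + 1) j z) := by
  induction i generalizing j with
  | zero =>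
    suffices barMap f 0 j ∘ₗ N.barD 0 j ∘ₗ barMap e 1 j = P.barD 0 j ∘ₗ barMap g 1 j from
      LinearMap.congr_fun this z
    refine bar_hom_ext fun a b hp y x => ?_
    simp only [LinearMap.comp_apply, barMap_barMk]
    exact (congrArg _ (barD_zero_barMk hp y _)).trans
      ((h hp.2 y x).trans (barD_zero_barMk hp y _).symm)
  | succ i ih =>
    suffices barMap f (i + 1) j ∘ₗ N.barD (i + 1) j ∘ₗ barMap e (i + 2) j =
        P.barD (i + 1) j ∘ₗ barMap g (i + 2) j from LinearMap.congr_fun this z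
    refine bar_hom_ext fun a b hp y x => ?_
    simp only [LinearMap.comp_apply, barMap_barMk, barD_succ_barMk, map_sub]
    rw [barMap_act h (i + 1), ih]

theorem barMap_barD_of_linear {f : ∀ j, M.obj j →ₗ[k] N.obj j}
    (h : ∀ {n i j : ℕ} (hij : n + i = j) (a : 𝒜 n) (x : M.obj i),
      f j (M.act hij a x) = N.act hij a (f i x))
    (i j : ℕ) (z : (M.bar (i + 1)).obj j) :
    barMap f i j (M.barD i j z) = N.barD i j (barMap f (i + 1) j z) := by
  have := barMap_barD (e := fun _ => LinearMap.id) h i j z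
  rwa [barMap_eq_self fun _ _ _ => rfl] at this

/-! ### Maps shifting the internal degree -/

variable {m : ℕ}

/-- The map on bar constructions induced by `k`-linear maps `M_i → N_{i + m}`. -/
def barUp (f : ∀ i j, i + m = j → (M.obj i →ₗ[k] N.obj j)) :
    ∀ s i j, i + m = j → ((M.bar s).obj i →ₗ[k] (N.bar s).obj j)
  | 0 => f
  | s + 1 => fun _ _ h => M.barDesc fun _ b hp =>
      (N.barMkHom (PlusIndex.add_right hp h rfl)).compl₂ (barUp f s b (b + m) rfl)

theorem PlusIndex.sub_right {a b c i m j : ℕ} (hp : 0 < a ∧ a + b = i) (h : j + m = i)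
    (hbc : c + m = b) : 0 < a ∧ a + c = j := ⟨hp.1, by omega⟩

/-- The map on bar constructions induced by `k`-linear maps `M_{j + m} → N_j`; it vanishes on
`a₁ ⊗ ⋯ ⊗ a_s ⊗ x` if the degree of `x` is less than `m`. -/
def barDown (f : ∀ i j, j + m = i → (M.obj i →ₗ[k] N.obj j)) :
    ∀ s i j, j + m = i → ((M.bar s).obj i →ₗ[k] (N.bar s).obj j)
  | 0 => f
  | s + 1 => fun _ _ h => M.barDesc fun _ b hp =>
      if hb : m ≤ b then
        (N.barMkHom (PlusIndex.sub_right hp h (Nat.sub_add_cancel hb))).compl₂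
          (barDown f s b (b - m) (Nat.sub_add_cancel hb))
      else 0

theorem barUp_barMk (f : ∀ i j, i + m = j → (M.obj i →ₗ[k] N.obj j)) (s : ℕ) {i j : ℕ}
    (h : i + m = j) {a b c : ℕ} (hp : 0 < a ∧ a + b = i) (hq : 0 < a ∧ a + c = j) (hbc : b + m = c)
    (y : 𝒜 a) (x : (M.bar s).obj b) :
    barUp f (s + 1) i j h (M.barMk hp y x) = N.barMk hq y (barUp f s b c hbc x) := by
  subst hbc
  rw [barUp, barDesc_barMk]
  rfl

theorem barDown_barMk (f : ∀ i j, j + m = i → (M.obj i →ₗ[k] N.obj j)) (s : ℕ) {i j : ℕ}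
    (h : j + m = i) {a b c : ℕ} (hp : 0 < a ∧ a + b = i) (hq : 0 < a ∧ a + c = j) (hbc : c + m = b)
    (y : 𝒜 a) (x : (M.bar s).obj b) :
    barDown f (s + 1) i j h (M.barMk hp y x) = N.barMk hq y (barDown f s b c hbc x) := by
  obtain rfl : c = b - m := by omega
  rw [barDown, barDesc_barMk, dif_pos (show m ≤ b by omega)]
  rfl

theorem barDown_barMk_of_lt (f : ∀ i j, j + m = i → (M.obj i →ₗ[k] N.obj j)) (s : ℕ) {i j : ℕ}
    (h : j + m = i) {a b : ℕ} (hp : 0 < a ∧ a + b = i) (hb : b < m)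
    (y : 𝒜 a) (x : (M.bar s).obj b) :
    barDown f (s + 1) i j h (M.barMk hp y x) = 0 := by
  rw [barDown, barDesc_barMk, dif_neg (show ¬ m ≤ b by omega)]
  rfl

theorem barMap_barUp {f : ∀ i j, i + m = j → (M.obj i →ₗ[k] N.obj j)}
    {g : ∀ j, N.obj j →ₗ[k] P.obj j} {e : ∀ i j, i + m = j → (M.obj i →ₗ[k] P.obj j)}
    (h : ∀ i j (hij : i + m = j) x, g j (f i j hij x) = e i j hij x) (s i j : ℕ) (hij : i + m = j)
    (z : (M.bar s).obj i) : barMap g s j (barUp f s i j hij z) = barUp e s i j hij z := by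
  induction s generalizing i j with
  | zero => exact h i j hij z
  | succ s ih =>
    suffices barMap g (s + 1) j ∘ₗ barUp f (s + 1) i j hij = barUp e (s + 1) i j hij from
      LinearMap.congr_fun this z
    refine bar_hom_ext fun a b hp y x => ?_
    have hq : 0 < a ∧ a + (b + m) = j := ⟨hp.1, by omega⟩
    rw [LinearMap.comp_apply, barUp_barMk f s hij hp hq rfl, barUp_barMk e s hij hp hq rfl,
      barMap_barMk, ih]

theorem barDown_barMap {f : ∀ j, M.obj j →ₗ[k] N.obj j}
    {g : ∀ i j, j + m = i → (N.obj i →ₗ[k] P.obj j)}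
    {e : ∀ i j, j + m = i → (M.obj i →ₗ[k] P.obj j)}
    (h : ∀ i j (hij : j + m = i) x, g i j hij (f i x) = e i j hij x) (s i j : ℕ) (hij : j + m = i)
    (z : (M.bar s).obj i) : barDown g s i j hij (barMap f s i z) = barDown e s i j hij z := by
  induction s generalizing i j with
  | zero => exact h i j hij z
  | succ s ih =>
    suffices barDown g (s + 1) i j hij ∘ₗ barMap f (s + 1) i = barDown e (s + 1) i j hij from
      LinearMap.congr_fun this z
    refine bar_hom_ext fun a b hp y x => ?_
    rw [LinearMap.comp_apply, barMap_barMk]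
    rcases lt_or_ge b m with hb | hb
    · rw [barDown_barMk_of_lt g s hij hp hb, barDown_barMk_of_lt e s hij hp hb]
    · obtain ⟨c, rfl⟩ := Nat.exists_eq_add_of_le' hb
      have hq : 0 < a ∧ a + c = j := ⟨hp.1, by omega⟩
      rw [barDown_barMk g s hij hp hq rfl, barDown_barMk e s hij hp hq rfl, ih]

theorem barMap_barDown {f : ∀ i j, j + m = i → (M.obj i →ₗ[k] N.obj j)}
    {g : ∀ j, N.obj j →ₗ[k] P.obj j} {e : ∀ i j, j + m = i → (M.obj i →ₗ[k] P.obj j)}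
    (h : ∀ i j (hij : j + m = i) x, g j (f i j hij x) = e i j hij x) (s i j : ℕ) (hij : j + m = i)
    (z : (M.bar s).obj i) : barMap g s j (barDown f s i j hij z) = barDown e s i j hij z := by
  induction s generalizing i j with
  | zero => exact h i j hij z
  | succ s ih =>
    suffices barMap g (s + 1) j ∘ₗ barDown f (s + 1) i j hij = barDown e (s + 1) i j hij from
      LinearMap.congr_fun this z
    refine bar_hom_ext fun a b hp y x => ?_
    rw [LinearMap.comp_apply]
    rcases lt_or_ge b m with hb | hb
    · rw [barDown_barMk_of_lt f s hij hp hb, barDown_barMk_of_lt e s hij hp hb, map_zero]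
    · obtain ⟨c, rfl⟩ := Nat.exists_eq_add_of_le' hb
      have hq : 0 < a ∧ a + c = j := ⟨hp.1, by omega⟩
      rw [barDown_barMk f s hij hp hq rfl, barDown_barMk e s hij hp hq rfl, barMap_barMk, ih]

theorem barDown_barUp {f : ∀ i j, i + m = j → (M.obj i →ₗ[k] N.obj j)}
    {g : ∀ i j, j + m = i → (N.obj i →ₗ[k] P.obj j)} {e : ∀ j, M.obj j →ₗ[k] P.obj j}
    (h : ∀ i j (hij : i + m = j) x, g j i hij (f i j hij x) = e i x) (s i j : ℕ) (hij : i + m = j)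
    (z : (M.bar s).obj i) : barDown g s j i hij (barUp f s i j hij z) = barMap e s i z := by
  induction s generalizing i j with
  | zero => exact h i j hij z
  | succ s ih =>
    suffices barDown g (s + 1) j i hij ∘ₗ barUp f (s + 1) i j hij = barMap e (s + 1) i from
      LinearMap.congr_fun this z
    refine bar_hom_ext fun a b hp y x => ?_
    have hq : 0 < a ∧ a + (b + m) = j := ⟨hp.1, by omega⟩
    rw [LinearMap.comp_apply, barUp_barMk f s hij hp hq rfl, barDown_barMk g s hij hq hp rfl,
      ih, barMap_barMk]

theorem barUp_barDown {f : ∀ i j, i + m = j → (M.obj i →ₗ[k] N.obj j)}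
    {g : ∀ i j, j + m = i → (P.obj i →ₗ[k] M.obj j)} {e : ∀ j, P.obj j →ₗ[k] N.obj j}
    (h : ∀ i j (hij : j + m = i) x, f j i hij (g i j hij x) = e i x)
    (h' : ∀ j, j < m → ∀ x, e j x = 0) (s i j : ℕ) (hij : j + m = i)
    (z : (P.bar s).obj i) : barUp f s j i hij (barDown g s i j hij z) = barMap e s i z := by
  induction s generalizing i j with
  | zero => exact h i j hij z
  | succ s ih =>
    suffices barUp f (s + 1) j i hij ∘ₗ barDown g (s + 1) i j hij = barMap e (s + 1) i from
      LinearMap.congr_fun this z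
    refine bar_hom_ext fun a b hp y x => ?_
    rw [LinearMap.comp_apply, barMap_barMk]
    rcases lt_or_ge b m with hb | hb
    · rw [barDown_barMk_of_lt g s hij hp hb, map_zero]
      have : ∀ (s b : ℕ) (x : (P.bar s).obj b), b < m → barMap e s b x = 0 := by
        intro s
        induction s with
        | zero => exact fun b x hb => h' b hb x
        | succ s ihs =>
          intro b x hb
          suffices barMap e (s + 1) b = 0 from LinearMap.congr_fun this x
          refine bar_hom_ext fun a b hp y x => ?_
          rw [barMap_barMk, ihs _ _ (by omega), barMk_zero]
          rfl
      rw [this s b x hb, barMk_zero]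
    · obtain ⟨c, rfl⟩ := Nat.exists_eq_add_of_le' hb
      have hq : 0 < a ∧ a + c = j := ⟨hp.1, by omega⟩
      rw [barDown_barMk g s hij hp hq rfl, barUp_barMk f s hij hq hp rfl, ih]

theorem barUp_barD {f : ∀ i j, i + m = j → (M.obj i →ₗ[k] N.obj j)}
    (h : ∀ {n i i' j j' : ℕ} (hi : n + i = i') (hj : n + j = j') (hij : i + m = j)
      (hij' : i' + m = j') (a : 𝒜 n) (x : M.obj i),
      f i' j' hij' (M.act hi a x) = N.act hj a (f i j hij x))
    (s i j : ℕ) (hij : i + m = j) (z : (M.bar (s + 1)).obj i) :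
    barUp f s i j hij (M.barD s i z) = N.barD s j (barUp f (s + 1) i j hij z) := by
  induction s generalizing i j with
  | zero =>
    suffices barUp f 0 i j hij ∘ₗ M.barD 0 i = N.barD 0 j ∘ₗ barUp f 1 i j hij from
      LinearMap.congr_fun this z
    refine bar_hom_ext fun a b hp y x => ?_
    have hq : 0 < a ∧ a + (b + m) = j := ⟨hp.1, by omega⟩
    rw [LinearMap.comp_apply, LinearMap.comp_apply, barUp_barMk f 0 hij hp hq rfl]
    exact (congrArg _ (barD_zero_barMk hp y x)).trans
      ((h hp.2 hq.2 rfl hij y x).trans (barD_zero_barMk hq y _).symm)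
  | succ s ih =>
    suffices barUp f (s + 1) i j hij ∘ₗ M.barD (s + 1) i =
        N.barD (s + 1) j ∘ₗ barUp f (s + 2) i j hij from LinearMap.congr_fun this z
    refine bar_hom_ext fun a b hp y x => ?_
    have hq : 0 < a ∧ a + (b + m) = j := ⟨hp.1, by omega⟩
    rw [LinearMap.comp_apply, LinearMap.comp_apply, barUp_barMk f (s + 1) hij hp hq rfl,
      barD_succ_barMk, barD_succ_barMk, map_sub, barUp_barMk f s hij hp hq rfl, ih]
    congr 1
    -- both sides only change the first factor
    suffices barUp f (s + 1) i j hij ∘ₗ (M.bar (s + 1)).act hp.2 y =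
        (N.bar (s + 1)).act hq.2 y ∘ₗ barUp f (s + 1) b (b + m) rfl from
      LinearMap.congr_fun this x
    refine bar_hom_ext fun c d hr y' x' => ?_
    have hr' : 0 < c ∧ c + (d + m) = b + m := ⟨hr.1, by omega⟩
    rw [LinearMap.comp_apply, LinearMap.comp_apply, barUp_barMk f s rfl hr hr' rfl]
    rw [act_barMk, act_barMk]
    exact barUp_barMk f s hij _ _ rfl _ _

theorem barDown_barD {f : ∀ i j, j + m = i → (M.obj i →ₗ[k] N.obj j)}
    (h : ∀ {n i i' j j' : ℕ} (hi : n + i = i') (hj : n + j = j') (hij : j + m = i)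
      (hij' : j' + m = i') (a : 𝒜 n) (x : M.obj i),
      f i' j' hij' (M.act hi a x) = N.act hj a (f i j hij x))
    (h' : ∀ {n i i' j' : ℕ} (hi : n + i = i') (hij' : j' + m = i') (a : 𝒜 n) (x : M.obj i),
      i < m → f i' j' hij' (M.act hi a x) = 0)
    (s i j : ℕ) (hij : j + m = i) (z : (M.bar (s + 1)).obj i) :
    barDown f s i j hij (M.barD s i z) = N.barD s j (barDown f (s + 1) i j hij z) := by
  induction s generalizing i j with
  | zero =>
    suffices barDown f 0 i j hij ∘ₗ M.barD 0 i = N.barD 0 j ∘ₗ barDown f 1 i j hij from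
      LinearMap.congr_fun this z
    refine bar_hom_ext fun a b hp y x => ?_
    rw [LinearMap.comp_apply, LinearMap.comp_apply]
    rcases lt_or_ge b m with hb | hb
    · rw [barDown_barMk_of_lt f 0 hij hp hb, map_zero]
      exact (congrArg _ (barD_zero_barMk hp y x)).trans (h' hp.2 hij y x hb)
    · obtain ⟨c, rfl⟩ := Nat.exists_eq_add_of_le' hb
      have hq : 0 < a ∧ a + c = j := ⟨hp.1, by omega⟩
      rw [barDown_barMk f 0 hij hp hq rfl]
      exact (congrArg _ (barD_zero_barMk hp y x)).trans
        ((h hp.2 hq.2 rfl hij y x).trans (barD_zero_barMk hq y _).symm)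
  | succ s ih =>
    suffices barDown f (s + 1) i j hij ∘ₗ M.barD (s + 1) i =
        N.barD (s + 1) j ∘ₗ barDown f (s + 2) i j hij from LinearMap.congr_fun this z
    refine bar_hom_ext fun a b hp y x => ?_
    rw [LinearMap.comp_apply, LinearMap.comp_apply, barD_succ_barMk, map_sub]
    rcases lt_or_ge b m with hb | hb
    · rw [barDown_barMk_of_lt f (s + 1) hij hp hb, barDown_barMk_of_lt f s hij hp hb,
        map_zero, sub_zero]
      suffices barDown f (s + 1) i j hij ∘ₗ (M.bar (s + 1)).act hp.2 y = 0 from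
        LinearMap.congr_fun this x
      refine bar_hom_ext fun c d hr y' x' => ?_
      rw [LinearMap.comp_apply]
      rw [act_barMk]
      exact barDown_barMk_of_lt f s hij _ (by omega) _ _
    · obtain ⟨c, rfl⟩ := Nat.exists_eq_add_of_le' hb
      have hq : 0 < a ∧ a + c = j := ⟨hp.1, by omega⟩
      rw [barDown_barMk f (s + 1) hij hp hq rfl, barD_succ_barMk,
        barDown_barMk f s hij hp hq rfl, ih]
      congr 1
      suffices barDown f (s + 1) i j hij ∘ₗ (M.bar (s + 1)).act hp.2 y =
          (N.bar (s + 1)).act hq.2 y ∘ₗ barDown f (s + 1) (c + m) c rfl from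
        LinearMap.congr_fun this x
      refine bar_hom_ext fun d e hr y' x' => ?_
      rw [LinearMap.comp_apply, LinearMap.comp_apply]
      rw [act_barMk]
      rcases lt_or_ge e m with he | he
      · rw [barDown_barMk_of_lt f s rfl hr he, map_zero]
        exact barDown_barMk_of_lt f s hij _ he _ _
      · obtain ⟨e, rfl⟩ := Nat.exists_eq_add_of_le' he
        have hr' : 0 < d ∧ d + e = c := ⟨hr.1, by omega⟩
        rw [barDown_barMk f s rfl hr hr' rfl]
        rw [act_barMk]
        exact barDown_barMk f s hij _ _ rfl _ _

end GradedModule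

end QuasiKoszul

namespace QuasiKoszul

/-! ### The bar double complex of a complex of graded modules -/

/-- A complex of graded `A`-modules in nonnegative homological degrees. -/
structure ModComplex {k A : Type u} [Field k] [Ring A] [Algebra k A]
    (𝒜 : ℕ → Submodule k A) [GradedAlgebra 𝒜] where
  X : ℕ → GradedModule 𝒜
  d : ∀ s j, (X (s + 1)).obj j →ₗ[k] (X s).obj j
  d_d : ∀ s j x, d s j (d (s + 1) j x) = 0
  d_act : ∀ (s : ℕ) {n i j : ℕ} (h : n + i = j) (a : 𝒜 n) (x : (X (s + 1)).obj i),
    d s j ((X (s + 1)).act h a x) = (X s).act h a (d s i x)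

namespace ModComplex

open QuasiKoszul.GradedModule

variable {k A : Type u} [Field k] [Ring A] [Algebra k A]
  {𝒜 : ℕ → Submodule k A} [GradedAlgebra 𝒜] (C : ModComplex 𝒜) {c : ℕ}

/-- Families of elements of the double complex `A₊^{⊗ i} ⊗ C_s`, in internal degree `c`. -/
abbrev Tot (c : ℕ) : Type u := ∀ i s : ℕ, ((C.X s).bar i).obj c

/-- The differential of the total complex, on families which need not be homogeneous. -/
def totD (z : C.Tot c) : C.Tot c := fun i s =>
  (C.X s).barD i c (z (i + 1) s) + (-1 : k) ^ i • barMap (C.d s) i c (z i (s + 1))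

/-- The total complex is exact in the homological degree `t`. Only the components of the families
with `i + s = t` matter. -/
def TotExact (c t : ℕ) : Prop :=
  ∀ z : C.Tot c, (∀ i s, i + s + 1 = t → C.totD z i s = 0) →
    ∃ y : C.Tot c, ∀ i s, i + s = t → z i s = C.totD y i s

variable {C}

theorem totD_add (y z : C.Tot c) : C.totD (y + z) = C.totD y + C.totD z := by
  funext i s
  simp only [totD, Pi.add_apply, map_add, smul_add]
  abel

theorem totD_sub (y z : C.Tot c) : C.totD (y - z) = C.totD y - C.totD z := by
  funext i s
  simp only [totD, Pi.sub_apply, map_sub, smul_sub]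
  abel

theorem barMap_d_barD (s i : ℕ) (z : ((C.X (s + 1)).bar (i + 1)).obj c) :
    barMap (C.d s) i c ((C.X (s + 1)).barD i c z) =
      (C.X s).barD i c (barMap (C.d s) (i + 1) c z) :=
  barMap_barD_of_linear (fun h a x => C.d_act s h a x) i c z

theorem barMap_d_d (s i : ℕ) (z : ((C.X (s + 2)).bar i).obj c) :
    barMap (C.d s) i c (barMap (C.d (s + 1)) i c z) = 0 := by
  rw [barMap_comp (e := fun _ => 0) (fun j x => C.d_d s j x), barMap_eq_zero fun _ _ => rfl]

theorem totD_totD (z : C.Tot c) : C.totD (C.totD z) = 0 := by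
  funext i s
  simp only [totD, map_add, map_smul, barMap_d_d, barMap_d_barD, barD_barD, smul_zero, add_zero,
    zero_add, Pi.zero_apply, pow_succ, mul_neg_one, neg_smul, map_neg]
  exact neg_add_cancel _

theorem exists_of_sub {t : ℕ} (z y : C.Tot c)
    (h : ∃ y' : C.Tot c, ∀ i s, i + s = t → (z - C.totD y) i s = C.totD y' i s) :
    ∃ y' : C.Tot c, ∀ i s, i + s = t → z i s = C.totD y' i s := by
  obtain ⟨y', hy'⟩ := h
  refine ⟨y + y', fun i s his => ?_⟩
  rw [totD_add, Pi.add_apply, Pi.add_apply, ← hy' i s his, Pi.sub_apply, Pi.sub_apply,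
    add_sub_cancel]

theorem totD_sub_totD {t : ℕ} {z : C.Tot c} (hz : ∀ i s, i + s + 1 = t → C.totD z i s = 0)
    (y : C.Tot c) : ∀ i s, i + s + 1 = t → C.totD (z - C.totD y) i s = 0 := by
  intro i s his
  rw [totD_sub, totD_totD, sub_zero, hz i s his]

/-! ### Complexes with homology in a single degree -/

/-- A `k`-linear deformation retraction of the complex `C` onto a graded `A`-module `H` placed in
the homological degree `h`, where `H` is the homology of `C` as an `A`-module: the class map
`proj` respects the action on the cycles `sect y`. Here `e s` is the idempotent of `C_s` defined by
the retraction. -/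
structure Retraction (C : ModComplex 𝒜) (H : GradedModule 𝒜) (h : ℕ) where
  proj : ∀ j, (C.X h).obj j →ₗ[k] H.obj j
  sect : ∀ j, H.obj j →ₗ[k] (C.X h).obj j
  e : ∀ s j, (C.X s).obj j →ₗ[k] (C.X s).obj j
  θ : ∀ s j, (C.X s).obj j →ₗ[k] (C.X (s + 1)).obj j
  κ : ∀ s j, (C.X s).obj j →ₗ[k] (C.X (s + 1)).obj j
  e_add_zero : ∀ j x, e 0 j x + C.d 0 j (θ 0 j x) = x
  e_add_succ : ∀ s j x,
    e (s + 1) j x + C.d (s + 1) j (θ (s + 1) j x) + κ s j (C.d s j x) = x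
  e_of_ne : ∀ s, s ≠ h → ∀ j x, e s j x = 0
  e_self : ∀ j x, e h j x = sect j (proj j x)
  d_e : ∀ s j x, C.d s j (e (s + 1) j x) = 0
  proj_sect : ∀ j x, proj j (sect j x) = x
  proj_d : ∀ j x, proj j (C.d h j x) = 0
  proj_act_sect : ∀ {n i j : ℕ} (hij : n + i = j) (a : 𝒜 n) (x : H.obj i),
    proj j ((C.X h).act hij a (sect i x)) = H.act hij a x

end ModComplex

namespace GradedModule

variable {k A : Type u} [Field k] [Ring A] [Algebra k A]
  {𝒜 : ℕ → Submodule k A} [GradedAlgebra 𝒜]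

/-- The bar complex of `M` is exact in homological degree `i` and internal degree `j`. -/
def BarExact (M : GradedModule 𝒜) : ℕ → ℕ → Prop
  | 0, j => ∀ w : (M.bar 0).obj j, ∃ v, M.barD 0 j v = w
  | i + 1, j => ∀ w : (M.bar (i + 1)).obj j, M.barD i j w = 0 → ∃ v, M.barD (i + 1) j v = w

end GradedModule

namespace ModComplex

open QuasiKoszul.GradedModule

variable {k A : Type u} [Field k] [Ring A] [Algebra k A]
  {𝒜 : ℕ → Submodule k A} [GradedAlgebra 𝒜] {C : ModComplex 𝒜} {c : ℕ}

namespace Retraction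

variable {H : GradedModule 𝒜} {h : ℕ}

theorem bar_e_add_zero (R : C.Retraction H h) (i : ℕ) (z : ((C.X 0).bar i).obj c) :
    barMap (R.e 0) i c z + barMap (C.d 0) i c (barMap (R.θ 0) i c z) = z := by
  rw [barMap_comp (e := fun j => C.d 0 j ∘ₗ R.θ 0 j) (fun _ _ => rfl),
    barMap_add (e := fun _ => LinearMap.id) (fun j x => R.e_add_zero j x),
    barMap_eq_self fun _ _ _ => rfl]

theorem bar_e_add_succ (R : C.Retraction H h) (s i : ℕ) (z : ((C.X (s + 1)).bar i).obj c) :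
    barMap (R.e (s + 1)) i c z + barMap (C.d (s + 1)) i c (barMap (R.θ (s + 1)) i c z) +
      barMap (R.κ s) i c (barMap (C.d s) i c z) = z := by
  rw [barMap_comp (e := fun j => C.d (s + 1) j ∘ₗ R.θ (s + 1) j) (fun _ _ => rfl),
    barMap_comp (e := fun j => R.κ s j ∘ₗ C.d s j) (fun _ _ => rfl),
    barMap_add (e := fun j => R.e (s + 1) j + C.d (s + 1) j ∘ₗ R.θ (s + 1) j) (fun _ _ => rfl),
    barMap_add (e := fun _ => LinearMap.id) (fun j x => R.e_add_succ s j x),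
    barMap_eq_self fun _ _ _ => rfl]

theorem bar_e_of_ne (R : C.Retraction H h) {s : ℕ} (hs : s ≠ h) (i : ℕ)
    (z : ((C.X s).bar i).obj c) :
    barMap (R.e s) i c z = 0 :=
  barMap_eq_zero (R.e_of_ne s hs) i c z

theorem bar_e_self (R : C.Retraction H h) (i : ℕ) (z : ((C.X h).bar i).obj c) :
    barMap (R.e h) i c z = barMap R.sect i c (barMap R.proj i c z) :=
  (barMap_comp (fun j x => (R.e_self j x).symm) i c z).symm

theorem bar_d_e (R : C.Retraction H h) (s i : ℕ) (z : ((C.X (s + 1)).bar i).obj c) :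
    barMap (C.d s) i c (barMap (R.e (s + 1)) i c z) = 0 := by
  rw [barMap_comp (e := fun _ => 0) (fun j x => R.d_e s j x), barMap_eq_zero fun _ _ => rfl]

theorem bar_proj_sect (R : C.Retraction H h) (i : ℕ) (z : (H.bar i).obj c) :
    barMap R.proj i c (barMap R.sect i c z) = z := by
  rw [barMap_comp (e := fun _ => LinearMap.id) (fun j x => R.proj_sect j x),
    barMap_eq_self fun _ _ _ => rfl]

theorem bar_proj_d (R : C.Retraction H h) (i : ℕ) (z : ((C.X (h + 1)).bar i).obj c) :
    barMap R.proj i c (barMap (C.d h) i c z) = 0 := by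
  rw [barMap_comp (e := fun _ => 0) (fun j x => R.proj_d j x), barMap_eq_zero fun _ _ => rfl]

theorem bar_proj_barD_sect (R : C.Retraction H h) (i : ℕ) (z : (H.bar (i + 1)).obj c) :
    barMap R.proj i c ((C.X h).barD i c (barMap R.sect (i + 1) c z)) = H.barD i c z := by
  have := barMap_barD (f := R.proj) (e := R.sect) (g := fun _ => LinearMap.id)
    (fun hij a x => R.proj_act_sect hij a x) i c z
  rwa [barMap_eq_self (f := fun _ => LinearMap.id) fun _ _ _ => rfl] at this

/-- The family `(-1)^i θ z_{i,s}`, by which a cycle is changed to remove its component with the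
least `s`. -/
def contract (R : C.Retraction H h) (z : C.Tot c) : C.Tot c
  | _, 0 => 0
  | i, s + 1 => (-1 : k) ^ i • barMap (R.θ s) i c (z i s)

variable {t : ℕ} {z : C.Tot c}

/-- The components of a total cycle with the least `s` are vertical cycles. -/
theorem vertical_cycle {s₀ : ℕ} (hz : ∀ i s, i + s + 1 = t → C.totD z i s = 0)
    (hlow : ∀ i s, i + s = t → s < s₀ → z i s = 0) (i s : ℕ) (his : i + (s + 1) = t)
    (hs : s + 1 = s₀) : barMap (C.d s) i c (z i (s + 1)) = 0 := by
  have h₁ := hz i s his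
  rw [totD, hlow (i + 1) s (by omega) (by omega), map_zero, zero_add] at h₁
  exact (smul_eq_zero_iff_right (pow_ne_zero i (neg_ne_zero.2 one_ne_zero))).1 h₁

theorem sub_totD_contract (R : C.Retraction H h) {s₀ : ℕ}
    (hz : ∀ i s, i + s + 1 = t → C.totD z i s = 0)
    (hlow : ∀ i s, i + s = t → s < s₀ → z i s = 0)
    (he : ∀ i, i + s₀ = t → barMap (R.e s₀) i c (z i s₀) = 0) :
    ∀ i s, i + s = t → s < s₀ + 1 → (z - C.totD (R.contract z)) i s = 0 := by
  have sq : ∀ (i : ℕ) {V : Type u} [AddCommGroup V] [Module k V] (v : V),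
      (-1 : k) ^ i • (-1 : k) ^ i • v = v := fun i V _ _ v => by
    rw [smul_smul, ← mul_pow, neg_one_mul, neg_neg, one_pow, one_smul]
  intro i s his hs
  have key : z i s - barMap (C.d s) i c (barMap (R.θ s) i c (z i s)) = 0 := by
    rcases Nat.lt_succ_iff_lt_or_eq.1 hs with hs | rfl
    · rw [hlow i s his hs, map_zero, map_zero, sub_zero]
    · cases s with
      | zero =>
        have := R.bar_e_add_zero i (z i 0)
        rw [he i his, zero_add] at this
        rw [this, sub_self]
      | succ s =>
        have := R.bar_e_add_succ s i (z i (s + 1))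
        rw [he i his, zero_add, vertical_cycle hz hlow i s his rfl, map_zero, add_zero] at this
        rw [this, sub_self]
  have hv : (-1 : k) ^ i • barMap (C.d s) i c (R.contract z i (s + 1)) =
      barMap (C.d s) i c (barMap (R.θ s) i c (z i s)) := by
    rw [contract, map_smul, sq]
  rw [Pi.sub_apply, Pi.sub_apply, totD, hv]
  cases s with
  | zero => rwa [contract, map_zero, zero_add]
  | succ s =>
    rwa [contract, hlow (i + 1) s (by omega) (by omega), map_zero, smul_zero, map_zero, zero_add]

/-- A total cycle whose components below row `s₀` vanish is a boundary, if there is no homology in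
the rows from `s₀` on. -/
theorem exists_of_gt (R : C.Retraction H h) (n : ℕ) :
    ∀ (s₀ : ℕ) (z : C.Tot c), s₀ + n = t + 1 → h < s₀ →
    (∀ i s, i + s + 1 = t → C.totD z i s = 0) → (∀ i s, i + s = t → s < s₀ → z i s = 0) →
    ∃ y : C.Tot c, ∀ i s, i + s = t → z i s = C.totD y i s := by
  induction n with
  | zero =>
    intro s₀ z hs₀ _ _ hlow
    refine ⟨0, fun i s his => ?_⟩
    rw [hlow i s his (by omega)]
    simp [totD]
  | succ n ih =>
    intro s₀ z hs₀ hh hz hlow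
    refine exists_of_sub z (R.contract z) (ih (s₀ + 1) _ (by omega) (by omega)
      (totD_sub_totD hz _) ?_)
    exact R.sub_totD_contract hz hlow fun i _ => R.bar_e_of_ne (by omega) i _

/-- A total cycle whose components below row `h` vanish is a boundary: its component in row `h`
defines a cycle of the bar complex of `H`, which is a boundary by assumption. -/
theorem exists_of_eq (R : C.Retraction H h) (hH : ∀ i, i + h = t → H.BarExact i c)
    (hz : ∀ i s, i + s + 1 = t → C.totD z i s = 0)
    (hlow : ∀ i s, i + s = t → s < h → z i s = 0) :
    ∃ y : C.Tot c, ∀ i s, i + s = t → z i s = C.totD y i s := by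
  have hv : ∀ i, ∃ v : (H.bar (i + 1)).obj c, i + h = t →
      H.barD i c v = barMap R.proj i c (z i h) := by
    intro i
    by_cases hi : i + h = t
    · suffices ∃ v, H.barD i c v = barMap R.proj i c (z i h) from this.imp fun v hv _ => hv
      cases i with
      | zero => exact hH 0 hi _
      | succ i =>
        refine hH (i + 1) hi _ ?_
        have h₁ : barMap R.sect (i + 1) c (barMap R.proj (i + 1) c (z (i + 1) h)) =
            z (i + 1) h - barMap (C.d h) (i + 1) c (barMap (R.θ h) (i + 1) c (z (i + 1) h)) := by
          rw [← bar_e_self]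
          rcases h with _ | h
          · rw [eq_sub_iff_add_eq, R.bar_e_add_zero]
          · have := R.bar_e_add_succ h (i + 1) (z (i + 1) (h + 1))
            rw [vertical_cycle hz hlow (i + 1) h hi rfl, map_zero, add_zero] at this
            rw [eq_sub_iff_add_eq, this]
        have h₂ := hz i h (by omega)
        rw [totD, add_eq_zero_iff_eq_neg] at h₂
        rw [← bar_proj_barD_sect, h₁, map_sub, h₂, ← barMap_d_barD, map_sub, map_neg, map_smul,
          bar_proj_d, bar_proj_d, smul_zero, neg_zero, sub_zero]
    · exact ⟨0, fun h' => absurd h' hi⟩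
  choose v hv using hv
  let y : C.Tot c
    | 0 => 0
    | i + 1 => Pi.single h (barMap R.sect (i + 1) c (v i))
  have y_of_ne : ∀ i s, s ≠ h → y i s = 0 := by
    intro i s hs
    cases i with
    | zero => rfl
    | succ i => exact Pi.single_eq_of_ne hs _
  have y_self : ∀ i, y (i + 1) h = barMap R.sect (i + 1) c (v i) := fun i =>
    Pi.single_eq_same h _
  have e_y : ∀ i s, barMap (R.e s) i c (y i s) = y i s := by
    intro i s
    by_cases hs : s = h
    · subst hs
      cases i with
      | zero => exact map_zero _
      | succ i => rw [y_self, bar_e_self, bar_proj_sect]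
    · rw [y_of_ne i s hs, map_zero]
  have d_y : ∀ i s, barMap (C.d s) i c (y i (s + 1)) = 0 := fun i s => by
    rw [← e_y, bar_d_e]
  have hD : ∀ i s, C.totD y i s = (C.X s).barD i c (y (i + 1) s) := fun i s => by
    rw [totD, d_y, smul_zero, add_zero]
  have hz' := totD_sub_totD hz y
  have hlow' : ∀ i s, i + s = t → s < h → (z - C.totD y) i s = 0 := by
    intro i s his hs
    rw [Pi.sub_apply, Pi.sub_apply, hlow i s his hs, hD, y_of_ne (i + 1) s hs.ne, map_zero,
      sub_zero]
  have he : ∀ i, i + h = t → barMap (R.e h) i c ((z - C.totD y) i h) = 0 := by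
    intro i hi
    rw [Pi.sub_apply, Pi.sub_apply, hD, bar_e_self, y_self, map_sub, bar_proj_barD_sect, hv i hi,
      sub_self, map_zero]
  refine exists_of_sub z y (exists_of_sub _ (R.contract (z - C.totD y)) ?_)
  have hlow'' := R.sub_totD_contract hz' hlow' he
  rcases le_or_gt (h + 1) (t + 1) with hht | hht
  · obtain ⟨n, hn⟩ := Nat.exists_eq_add_of_le hht
    exact R.exists_of_gt n (h + 1) _ hn.symm (Nat.lt_succ_self h) (totD_sub_totD hz' _) hlow''
  · refine ⟨0, fun i s his => ?_⟩
    rw [hlow'' i s his (by omega)]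
    simp [totD]

/-- If `C` has no homology outside of the degree `h`, then the homology of the total complex is
that of the bar complex of `H_h(C)`, shifted by `h`. -/
theorem totExact (R : C.Retraction H h) (hH : ∀ i, i + h = t → H.BarExact i c) :
    C.TotExact c t := by
  suffices ∀ (n s₀ : ℕ) (z : C.Tot c), s₀ + n = h →
      (∀ i s, i + s + 1 = t → C.totD z i s = 0) → (∀ i s, i + s = t → s < s₀ → z i s = 0) →
      ∃ y : C.Tot c, ∀ i s, i + s = t → z i s = C.totD y i s from
    fun z hz => this h 0 z (zero_add h) hz fun _ _ _ h => absurd h (Nat.not_lt_zero _)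
  intro n
  induction n with
  | zero =>
    rintro s₀ z rfl hz hlow
    exact R.exists_of_eq hH hz hlow
  | succ n ih =>
    intro s₀ z hs₀ hz hlow
    refine exists_of_sub z (R.contract z) (ih (s₀ + 1) _ (by omega) (totD_sub_totD hz _) ?_)
    exact R.sub_totD_contract hz hlow fun i _ => R.bar_e_of_ne (by omega) i _

end Retraction

/-! ### Filtered complexes -/

/-- A filtration of the complex `C` by graded `A`-submodules, split over `k`, whose `m`-th
successive quotient is the complex `G m` with the internal degree shifted by `m`. Here `T m` is the
projection to the `m`-th term (the part with indices less than `m`), and `up`, `down` are the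
inclusion of the complement `G m` of the `m`-th term in the next one, and the projection to it. -/
structure Filtration (C : ModComplex 𝒜) (G : ℕ → ModComplex 𝒜) where
  T : ℕ → ∀ s j, (C.X s).obj j →ₗ[k] (C.X s).obj j
  up : ∀ m s i j, i + m = j → (((G m).X s).obj i →ₗ[k] (C.X s).obj j)
  down : ∀ m s i j, j + m = i → ((C.X s).obj i →ₗ[k] ((G m).X s).obj j)
  T_zero : ∀ s j x, T 0 s j x = 0
  T_of_lt : ∀ m s j, j < m → ∀ x, T m s j x = x
  T_succ : ∀ m s i j (h : j + m = i) x, T m s i x + up m s j i h (down m s i j h x) =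
    T (m + 1) s i x
  T_succ_of_lt : ∀ m s j, j < m → ∀ x, T (m + 1) s j x = T m s j x
  T_act : ∀ (m s : ℕ) {n i j : ℕ} (h : n + i = j) (a : 𝒜 n) (x : (C.X s).obj i),
    T m s j ((C.X s).act h a x) = (C.X s).act h a (T m s i x)
  up_act : ∀ (m s : ℕ) {n i i' j j' : ℕ} (hi : n + i = i') (hj : n + j = j') (hij : i + m = j)
    (hij' : i' + m = j') (a : 𝒜 n) (x : ((G m).X s).obj i),
    up m s i' j' hij' (((G m).X s).act hi a x) = (C.X s).act hj a (up m s i j hij x)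
  down_act : ∀ (m s : ℕ) {n i i' j j' : ℕ} (hi : n + i = i') (hj : n + j = j') (hij : j + m = i)
    (hij' : j' + m = i') (a : 𝒜 n) (x : (C.X s).obj i),
    down m s i' j' hij' ((C.X s).act hi a x) = ((G m).X s).act hj a (down m s i j hij x)
  down_act_of_lt : ∀ (m s : ℕ) {n i i' j' : ℕ} (hi : n + i = i') (hij' : j' + m = i') (a : 𝒜 n)
    (x : (C.X s).obj i), i < m → down m s i' j' hij' ((C.X s).act hi a x) = 0
  down_up : ∀ m s i j (h : i + m = j) x, down m s j i h (up m s i j h x) = x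
  T_up : ∀ m s i j (h : i + m = j) x, T (m + 1) s j (up m s i j h x) = up m s i j h x
  T_d_up : ∀ m s i j (h : i + m = j) x,
    T (m + 1) s j (C.d s j (up m (s + 1) i j h x)) = C.d s j (up m (s + 1) i j h x)
  down_d_up : ∀ m s i j (h : i + m = j) x,
    down m s j i h (C.d s j (up m (s + 1) i j h x)) = (G m).d s i x
  down_d_T : ∀ m s i j (h : j + m = i) x,
    down m s i j h (C.d s i (T (m + 1) (s + 1) i x)) = (G m).d s j (down m (s + 1) i j h x)

namespace Filtration

variable {G : ℕ → ModComplex 𝒜} {t : ℕ}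

/-- The total complex of a filtered complex is exact if those of the successive quotients are. -/
theorem totExact (F : C.Filtration G) (hG : ∀ m c', c' + m = c → (G m).TotExact c' t) :
    C.TotExact c t := by
  suffices ∀ m, m ≤ c + 1 → ∀ z : C.Tot c, (∀ i s, i + s + 1 = t → C.totD z i s = 0) →
      (∀ i s, i + s = t → barMap (F.T m s) i c (z i s) = z i s) →
      ∃ y : C.Tot c, ∀ i s, i + s = t → z i s = C.totD y i s from
    fun z hz => this (c + 1) le_rfl z hz fun i s _ =>
      barMap_eq_self (fun j hj x => F.T_of_lt _ _ _ (Nat.lt_succ_of_le hj) x) i _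
  intro m
  induction m with
  | zero =>
    intro _ z _ hT
    refine ⟨0, fun i s his => ?_⟩
    rw [← hT i s his, barMap_eq_zero (F.T_zero s)]
    simp [totD]
  | succ m ih =>
    intro hm z hz hT
    obtain ⟨c', hc'⟩ := Nat.exists_eq_add_of_le' (Nat.le_of_succ_le_succ hm)
    have hcc : c' + m = c := hc'.symm
    -- the image of `z` in the total complex of `G m` is a cycle, hence a boundary
    have hdown : ∀ (i s : ℕ) (w : ((C.X (s + 1)).bar i).obj c),
        barMap (F.T (m + 1) (s + 1)) i c w = w →
        barDown (F.down m s) i c c' hcc (barMap (C.d s) i c w) =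
          barMap ((G m).d s) i c' (barDown (F.down m (s + 1)) i c c' hcc w) := by
      intro i s w hw
      conv_lhs => rw [← hw]
      rw [barMap_comp (e := fun j => C.d s j ∘ₗ F.T (m + 1) (s + 1) j) (fun _ _ => rfl),
        barDown_barMap (e := fun i j h => (G m).d s j ∘ₗ F.down m (s + 1) i j h)
          (fun i j h x => F.down_d_T m s i j h x),
        barMap_barDown (e := fun i j h => (G m).d s j ∘ₗ F.down m (s + 1) i j h)
          (fun _ _ _ _ => rfl)]
    have hdownD : ∀ (i s : ℕ) (w : ((C.X s).bar (i + 1)).obj c),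
        barDown (F.down m s) i c c' hcc ((C.X s).barD i c w) =
          ((G m).X s).barD i c' (barDown (F.down m s) (i + 1) c c' hcc w) := fun i s w =>
      barDown_barD (F.down_act m s) (F.down_act_of_lt m s) i c c' hcc w
    have hupD : ∀ (i s : ℕ) (w : (((G m).X s).bar (i + 1)).obj c'),
        barUp (F.up m s) i c' c hcc (((G m).X s).barD i c' w) =
          (C.X s).barD i c (barUp (F.up m s) (i + 1) c' c hcc w) := fun i s w =>
      barUp_barD (F.up_act m s) i c' c hcc w
    have hdownup : ∀ (i s : ℕ) (w : (((G m).X s).bar i).obj c'),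
        barDown (F.down m s) i c c' hcc (barUp (F.up m s) i c' c hcc w) = w := fun i s w => by
      rw [barDown_barUp (e := fun _ => LinearMap.id) (F.down_up m s),
        barMap_eq_self fun _ _ _ => rfl]
    obtain ⟨y, hy⟩ := hG m c' hcc (fun i s => barDown (F.down m s) i c c' hcc (z i s)) (by
      intro i s his
      have := congrArg (barDown (F.down m s) i c c' hcc) (hz i s his)
      rwa [map_zero, totD, map_add, map_smul, hdown _ _ _ (hT i (s + 1) (by omega)),
        hdownD] at this)
    let y' : C.Tot c := fun i s => barUp (F.up m s) i c' c hcc (y i s)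
    have hTT : ∀ (i s : ℕ) (w : ((C.X s).bar i).obj c), barMap (F.T (m + 1) s) i c w =
        barMap (F.T m s) i c w +
          barUp (F.up m s) i c' c hcc (barDown (F.down m s) i c c' hcc w) := by
      intro i s w
      rw [barUp_barDown (e := fun j => F.T (m + 1) s j - F.T m s j)
        (fun i j h x => by rw [LinearMap.sub_apply, ← F.T_succ m s i j h, add_sub_cancel_left])
        (fun j hj x => by rw [LinearMap.sub_apply, F.T_succ_of_lt m s j hj, sub_self])]
      exact (barMap_add (fun j x => by rw [LinearMap.sub_apply, add_sub_cancel]) i c w).symm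
    have hTy : ∀ i s, barMap (F.T (m + 1) s) i c (C.totD y' i s) = C.totD y' i s := by
      intro i s
      rw [totD, map_add, map_smul, barMap_barD_of_linear (F.T_act (m + 1) s),
        barMap_barUp (F.T_up m s),
        barMap_barUp (e := fun i j h => C.d s j ∘ₗ F.up m (s + 1) i j h) (fun _ _ _ _ => rfl),
        barMap_barUp (e := fun i j h => C.d s j ∘ₗ F.up m (s + 1) i j h)
          (fun i j h x => F.T_d_up m s i j h x)]
    have hdowny : ∀ i s, barDown (F.down m s) i c c' hcc (C.totD y' i s) = (G m).totD y i s := by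
      intro i s
      rw [totD, map_add, map_smul, ← hupD, hdownup,
        barMap_barUp (e := fun i j h => C.d s j ∘ₗ F.up m (s + 1) i j h) (fun _ _ _ _ => rfl),
        barDown_barUp (e := (G m).d s) (fun i j h x => F.down_d_up m s i j h x), totD]
    refine exists_of_sub z y' (ih (by omega) _ (totD_sub_totD hz y') fun i s his => ?_)
    rw [Pi.sub_apply, Pi.sub_apply, eq_sub_of_add_eq (hTT i s _).symm, map_sub, map_sub,
      hT i s his, hTy, hdowny, hy i s his, sub_self, map_zero, sub_zero]

end Filtration

end ModComplex

end QuasiKoszul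

namespace QuasiKoszul

/-! ### Words refining a list of degrees -/

/-- The list `m, n_1, …, n_q` with the entry `m` omitted if it is `0`. -/
def consPos (m : ℕ) (n : List ℕ) : List ℕ := if m = 0 then n else m :: n

theorem consPos_of_pos {m : ℕ} (hm : 0 < m) (n : List ℕ) : consPos m n = m :: n := if_neg hm.ne'

theorem sum_consPos (m : ℕ) (n : List ℕ) : (consPos m n).sum = m + n.sum := by
  unfold consPos
  split_ifs with h
  · rw [h, zero_add]
  · rfl

theorem consPos_pos {n : List ℕ} (hn : ∀ b ∈ n, 1 ≤ b) (m : ℕ) : ∀ b ∈ consPos m n, 1 ≤ b := by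
  unfold consPos
  split_ifs with h
  · exact hn
  · intro b hb
    rcases List.mem_cons.1 hb with rfl | hb
    · omega
    · exact hn b hb

theorem Refines.pos {w n : List ℕ} (h : Refines w n) : ∀ a ∈ w, 0 < a := by
  obtain ⟨_, _, _, h⟩ := h
  exact h

theorem not_refines_nil {d : ℕ} (hd : 0 < d) (n : List ℕ) : ¬ Refines [] (d :: n) := by
  rintro ⟨W, h₁, h₂, -⟩
  cases W with
  | nil => simp at h₂
  | cons u W =>
    rw [List.flatten_cons, List.append_eq_nil_iff] at h₁
    rw [List.map_cons, h₁.1] at h₂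
    simp at h₂
    omega

/-- The recursive description of the words refining `d, n_1, …, n_q`. -/
theorem refines_cons_cons {z d : ℕ} (hd : 0 < d) {v n : List ℕ} :
    Refines (z :: v) (d :: n) ↔ 0 < z ∧ ∃ m, m + z = d ∧ Refines v (consPos m n) := by
  constructor
  · rintro ⟨W, h₁, h₂, h₃⟩
    have hv : ∀ a ∈ v, 0 < a := fun a ha => h₃ a (List.mem_cons_of_mem _ ha)
    refine ⟨h₃ z List.mem_cons_self, ?_⟩
    cases W with
    | nil => simp at h₂
    | cons u W =>
      obtain ⟨hu₀, rfl⟩ := List.cons.inj h₂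
      clear h₂
      cases u with
      | nil =>
        rw [List.sum_nil] at hu₀
        omega
      | cons z' u =>
        obtain ⟨rfl, rfl⟩ := List.cons.inj h₁
        refine ⟨u.sum, by rw [← hu₀, List.sum_cons, add_comm], ?_⟩
        rcases Nat.eq_zero_or_pos u.sum with hu | hu
        · have : u = [] := by
            cases u with
            | nil => rfl
            | cons b u =>
              have := hv b (by simp)
              rw [List.sum_cons] at hu
              omega
          subst this
          exact ⟨W, rfl, rfl, hv⟩
        · rw [consPos_of_pos hu]
          exact ⟨u :: W, rfl, rfl, hv⟩
  · rintro ⟨hz, m, rfl, W, rfl, h₂, h₃⟩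
    have h₃' : ∀ a ∈ z :: W.flatten, 0 < a := fun a ha => by
      rcases List.mem_cons.1 ha with rfl | ha
      · exact hz
      · exact h₃ a ha
    rcases Nat.eq_zero_or_pos m with rfl | hm
    · exact ⟨[z] :: W, rfl, by rw [List.map_cons, h₂]; simp [consPos], h₃'⟩
    · rw [consPos_of_pos hm] at h₂
      cases W with
      | nil => simp at h₂
      | cons u W =>
        obtain ⟨rfl, rfl⟩ := List.cons.inj h₂
        exact ⟨(z :: u) :: W, rfl, by simp [add_comm], h₃'⟩

theorem refines_add_cons_iff {z d a e : ℕ} (hz : 0 < z) (hd : 0 < d) (h : a + d = e)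
    {v n : List ℕ} : Refines ((a + z) :: v) (e :: n) ↔ Refines (z :: v) (d :: n) := by
  rw [refines_cons_cons hd, refines_cons_cons (by omega)]
  constructor
  · rintro ⟨_, m, hm, hv⟩
    exact ⟨hz, m, by omega, hv⟩
  · rintro ⟨_, m, hm, hv⟩
    exact ⟨by omega, m, by omega, hv⟩

theorem refines_cons_iff {d a e : ℕ} (ha : 0 < a) (hd : 0 < d) (h : a + d = e)
    {v n : List ℕ} : Refines (a :: v) (e :: n) ↔ Refines v (d :: n) := by
  rw [refines_cons_cons (by omega)]
  constructor
  · rintro ⟨_, m, hm, hv⟩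
    obtain rfl : m = d := by omega
    rwa [consPos_of_pos hd] at hv
  · intro hv
    exact ⟨ha, d, by omega, by rwa [consPos_of_pos hd]⟩

theorem Raise.append_cons (n : ℕ) (l : List ℕ) {a b : ℕ} (h : n + a = b) (v : List ℕ) :
    Raise n l.length (l ++ a :: v) (l ++ b :: v) := by
  subst h
  induction l with
  | nil => exact Raise.head a v
  | cons c l ih => exact Raise.cons c ih

theorem Raise.unique {n p : ℕ} {x y y' : List ℕ} (h : Raise n p x y) (h' : Raise n p x y') :
    y = y' := by
  induction h generalizing y' with
  | head => cases h'; rfl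
  | cons c _ ih =>
    cases h' with
    | cons _ h' => rw [ih h']

theorem Merge.append_cons_cons (l : List ℕ) {a b c : ℕ} (h : a + b = c) (v : List ℕ) :
    Merge l.length (l ++ a :: b :: v) (l ++ c :: v) := by
  subst h
  exact (Merge.head a b v).append_left l

theorem InsertZero.append_cast (l v : List ℕ) :
    InsertZero l.length (castWord (l ++ v)) (castWord (l ++ 0 :: v)) := by
  induction l with
  | nil => exact InsertZero.head (castWord v)
  | cons c l ih => exact InsertZero.cons (c : ℤ) ih

namespace QuasiAlgebra

variable {k : Type u} [Field k] (Z : QuasiAlgebra k)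

/-! ### Components indexed by arbitrary words -/

/-- The word `y` indexes a summand of the term of homological degree `i` of `E_{l; n}`. -/
def Valid (l n : List ℕ) (i : ℕ) (y : List ℕ) : Prop := ∃ w : BarWord n i, l ++ w.1 = y

theorem valid_append_iff {l n : List ℕ} {i : ℕ} {x : List ℕ} :
    Valid l n i (l ++ x) ↔ x.length = i ∧ Refines x n := by
  constructor
  · rintro ⟨w, hw⟩
    obtain rfl := List.append_cancel_left hw
    exact w.2
  · exact fun h => ⟨⟨x, h⟩, rfl⟩

open Classical in
/-- The inclusion of the component of `Z` indexed by the word `y` into the term of homological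
degree `i` of `E_{l; n}`, or `0` if this component does not occur there. -/
noncomputable def put (l n : List ℕ) (i : ℕ) (y : List ℕ) : Z.comp y →ₗ[k] Z.BarObj l n i :=
  if h : Valid l n i y then h.choose_spec ▸ Z.inc l h.choose else 0

variable {Z} {l l' n n' : List ℕ} {i i' : ℕ}

theorem put_word (w : BarWord n i) (z : Z.comp (l ++ w.1)) :
    Z.put l n i (l ++ w.1) z = Z.inc l w z := by
  have h : Valid l n i (l ++ w.1) := ⟨w, rfl⟩
  have key : ∀ (w₀ : BarWord n i) (e : l ++ w₀.1 = l ++ w.1),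
      (e ▸ Z.inc l w₀ : Z.comp (l ++ w.1) →ₗ[k] Z.BarObj l n i) = Z.inc l w := by
    intro w₀ e
    obtain rfl : w₀ = w := Subtype.ext (List.append_cancel_left e)
    rfl
  rw [put, dif_pos h, key]

theorem put_of_not_valid {y : List ℕ} (h : ¬ Valid l n i y) (z : Z.comp y) :
    Z.put l n i y z = 0 := by
  rw [put, dif_neg h, LinearMap.zero_apply]

/-- The linear map out of a term of `E_{l; n}` given by linear maps on the components. -/
def desc {V : Type*} [AddCommGroup V] [Module k V]
    (f : ∀ w : BarWord n i, Z.comp (l ++ w.1) →ₗ[k] V) : Z.BarObj l n i →ₗ[k] V :=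
  DirectSum.toModule k (BarWord n i) V f

theorem desc_inc {V : Type*} [AddCommGroup V] [Module k V]
    (f : ∀ w : BarWord n i, Z.comp (l ++ w.1) →ₗ[k] V) (w : BarWord n i)
    (z : Z.comp (l ++ w.1)) : desc f (Z.inc l w z) = f w z := by
  unfold desc inc
  exact DirectSum.toModule_lof (M := fun w : BarWord n i => Z.comp (l ++ w.1)) k w z

/-- Bilinear version of `desc`. -/
def desc₂ {B V : Type*} [AddCommGroup B] [Module k B] [AddCommGroup V] [Module k V]
    (f : ∀ w : BarWord n i, B →ₗ[k] Z.comp (l ++ w.1) →ₗ[k] V) :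
    B →ₗ[k] Z.BarObj l n i →ₗ[k] V :=
  (desc fun w => (f w).flip).flip

theorem desc₂_inc {B V : Type*} [AddCommGroup B] [Module k B] [AddCommGroup V] [Module k V]
    (f : ∀ w : BarWord n i, B →ₗ[k] Z.comp (l ++ w.1) →ₗ[k] V) (b : B) (w : BarWord n i)
    (z : Z.comp (l ++ w.1)) : desc₂ f b (Z.inc l w z) = f w b z := by
  rw [desc₂, LinearMap.flip_apply, desc_inc, LinearMap.flip_apply]

variable (Z) in
/-- The map between terms of the complexes `E_{l; n}` and `E_{l'; n'}` which is the identity on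
the components indexed by the same word. -/
noncomputable def reput (l n : List ℕ) (i : ℕ) (l' n' : List ℕ) (i' : ℕ) :
    Z.BarObj l n i →ₗ[k] Z.BarObj l' n' i' :=
  desc fun w => Z.put l' n' i' (l ++ w.1)

theorem reput_inc (w : BarWord n i) (z : Z.comp (l ++ w.1)) :
    Z.reput l n i l' n' i' (Z.inc l w z) = Z.put l' n' i' (l ++ w.1) z :=
  desc_inc _ w z

theorem reput_put {y : List ℕ} (h : Valid l' n' i' y → Valid l n i y) (z : Z.comp y) :
    Z.reput l n i l' n' i' (Z.put l n i y z) = Z.put l' n' i' y z := by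
  by_cases hy : Valid l n i y
  · obtain ⟨w, rfl⟩ := hy
    rw [put_word, reput_inc]
  · rw [put_of_not_valid hy, put_of_not_valid fun h' => hy (h h'), map_zero]

theorem reput_self (x : Z.BarObj l n i) : Z.reput l n i l n i x = x := by
  suffices Z.reput l n i l n i = LinearMap.id from LinearMap.congr_fun this x
  exact Z.barObj_ext fun w z => by rw [reput_inc, put_word, LinearMap.id_apply]

theorem face_inc_eq_put {t : ℕ} (w : BarWord n (i + 1)) {s : ℕ} (hs : s = l.length + t)
    {y : List ℕ} (h : Merge s (l ++ w.1) y) (z : Z.comp (l ++ w.1)) :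
    Z.face l n i t (Z.inc l w z) = Z.put l n i y (Z.nmul h z) := by
  subst hs
  have ht : t + 1 < w.1.length := by
    have := h.lt_length
    rw [List.length_append] at this
    omega
  obtain rfl := h.unique ((merge_mergeAt ht).append_left l)
  by_cases hv : Valid l n i (l ++ mergeAt t w.1)
  · let w' : BarWord n i := ⟨mergeAt t w.1, valid_append_iff.1 hv⟩
    exact (Z.face_inc w w' (merge_mergeAt ht) z).trans (put_word w' _).symm
  · rw [put_of_not_valid hv, Z.face_inc_eq_zero]
    intro w' hw'
    refine hv (valid_append_iff.2 ?_)
    rw [← hw'.unique (merge_mergeAt ht)]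
    exact w'.2

theorem barD_zero (x : Z.BarObj l n 1) : Z.barD l n 0 x = 0 := by
  rw [barD_apply, Finset.range_zero, Finset.sum_empty]

theorem barWord_subsingleton_of_isEmpty [IsEmpty (BarWord n i)] :
    Subsingleton (Z.BarObj l n i) := by
  refine subsingleton_of_forall_eq 0 fun x => ?_
  have : (LinearMap.id : Z.BarObj l n i →ₗ[k] Z.BarObj l n i) = 0 :=
    Z.barObj_ext fun w => isEmptyElim w
  exact LinearMap.congr_fun this x

/-! ### The action on the first letter of the words refining `d, n_1, …, n_q` -/

section Head

variable {A : Type u} [Ring A] [Algebra k A] {𝒜 : ℕ → Submodule k A} [GradedAlgebra 𝒜]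
  (α : LeftAction 𝒜 Z)

theorem BarWord.exists_cons {d : ℕ} (w : BarWord ((d + 1) :: n) i) :
    ∃ z v m, w.1 = z :: v ∧ 0 < z ∧ m + z = d + 1 ∧ v.length + 1 = i ∧
      Refines v (consPos m n) := by
  obtain ⟨w, hw, hr⟩ := w
  cases w with
  | nil => exact absurd hr (not_refines_nil (Nat.succ_pos d) n)
  | cons z v =>
    obtain ⟨hz, m, hm, hv⟩ := (refines_cons_cons (Nat.succ_pos d)).1 hr
    exact ⟨z, v, m, rfl, hz, hm, hw, hv⟩

theorem barObj_ext_cons {d : ℕ} {V : Type*} [AddCommGroup V] [Module k V]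
    {f g : Z.BarObj l ((d + 1) :: n) i →ₗ[k] V}
    (h : ∀ (a : ℕ) (v : List ℕ) (hw : (a :: v).length = i ∧ Refines (a :: v) ((d + 1) :: n)),
      0 < a → ∀ z : Z.comp (l ++ a :: v),
        f (Z.inc l ⟨a :: v, hw⟩ z) = g (Z.inc l ⟨a :: v, hw⟩ z)) : f = g := by
  refine Z.barObj_ext fun w z => ?_
  obtain ⟨w, hw⟩ := w
  cases w with
  | nil => exact absurd hw.2 (not_refines_nil (Nat.succ_pos d) n)
  | cons a v => exact h a v hw (hw.2.pos a List.mem_cons_self) z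

theorem raise_headAdd (a : ℕ) {d : ℕ} (w : BarWord ((d + 1) :: n) i) :
    Raise a l.length (l ++ w.1) (l ++ ((a + w.1.headI) :: w.1.tail)) := by
  obtain ⟨z, v, m, hw, -⟩ := w.exists_cons
  rw [hw]
  exact Raise.append_cons a l rfl v

/-- The action of `a` on the first letter of the words refining `d, n_1, …, n_q`. -/
noncomputable def headAct (l n : List ℕ) (i : ℕ) {a d e : ℕ} (_ : a + d = e) :
    𝒜 a →ₗ[k] Z.BarObj l ((d + 1) :: n) i →ₗ[k] Z.BarObj l ((e + 1) :: n) i :=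
  desc₂ fun w => (α.act (raise_headAdd a w)).compr₂ (Z.put l ((e + 1) :: n) i _)

theorem headAct_inc {a d e : ℕ} (h : a + d = e) (b : 𝒜 a) (w : BarWord ((d + 1) :: n) i)
    {y : List ℕ} (hy : Raise a l.length (l ++ w.1) y) (z : Z.comp (l ++ w.1)) :
    headAct α l n i h b (Z.inc l w z) = Z.put l ((e + 1) :: n) i y (α.act hy b z) := by
  obtain rfl := hy.unique (raise_headAdd a w)
  exact desc₂_inc _ b w z

theorem headAct_put {a d e : ℕ} (h : a + d = e) (b : 𝒜 a) {c : ℕ} (hc : 0 < c) {v x y : List ℕ}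
    (hx : x = l ++ c :: v) (hy : Raise a l.length x y) (z : Z.comp x) :
    headAct α l n i h b (Z.put l ((d + 1) :: n) i x z) =
      Z.put l ((e + 1) :: n) i y (α.act hy b z) := by
  subst hx
  obtain rfl := hy.unique (Raise.append_cons a l rfl v)
  by_cases hv : Valid l ((d + 1) :: n) i (l ++ c :: v)
  · let w : BarWord ((d + 1) :: n) i := ⟨c :: v, valid_append_iff.1 hv⟩
    exact (congrArg _ (put_word w z)).trans (headAct_inc α h b w hy z)
  · rw [put_of_not_valid hv, map_zero, put_of_not_valid]
    intro hv'
    refine hv (valid_append_iff.2 ?_)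
    rw [valid_append_iff, refines_add_cons_iff (d := d + 1) hc (Nat.succ_pos d) (by omega)] at hv'
    exact hv'

theorem face_headAct {a d e : ℕ} (h : a + d = e) (b : 𝒜 a) {t : ℕ} (ht : t < i)
    (x : Z.BarObj l ((d + 1) :: n) (i + 1)) :
    Z.face l ((e + 1) :: n) i t (headAct α l n (i + 1) h b x) =
      headAct α l n i h b (Z.face l ((d + 1) :: n) i t x) := by
  suffices Z.face l ((e + 1) :: n) i t ∘ₗ headAct α l n (i + 1) h b =
      headAct α l n i h b ∘ₗ Z.face l ((d + 1) :: n) i t from LinearMap.congr_fun this x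
  refine barObj_ext_cons fun c v hw hc z => ?_
  rw [LinearMap.comp_apply, LinearMap.comp_apply,
    headAct_inc α h b _ (Raise.append_cons a l rfl v)]
  have hw' : ((a + c) :: v).length = i + 1 ∧ Refines ((a + c) :: v) ((e + 1) :: n) :=
    ⟨hw.1, (refines_add_cons_iff (d := d + 1) hc (Nat.succ_pos d) (by omega)).2 hw.2⟩
  have e₁ : ∀ z', Z.put l ((e + 1) :: n) (i + 1) (l ++ (a + c) :: v) z' =
      Z.inc l ⟨(a + c) :: v, hw'⟩ z' := fun z' => put_word ⟨(a + c) :: v, hw'⟩ z'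
  rw [e₁]
  cases t with
  | zero =>
    cases v with
    | nil =>
      have := hw.1
      simp at this
      omega
    | cons c' v =>
      rw [face_inc_eq_put _ rfl (y := l ++ (a + (c + c')) :: v)
          (Merge.append_cons_cons l (add_assoc a c c') v),
        face_inc_eq_put _ rfl (y := l ++ (c + c') :: v) (Merge.append_cons_cons l rfl v),
        headAct_put α h b (Nat.add_pos_left hc c') rfl (Raise.append_cons a l rfl v),
        α.act_mul le_rfl]
  | succ t =>
    have hm : Merge t v (mergeAt t v) := merge_mergeAt (by
      have := hw.1
      rw [List.length_cons] at this
      omega)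
    rw [face_inc_eq_put _ rfl (y := l ++ (a + c) :: mergeAt t v)
        ((Merge.cons (a + c) hm).append_left l),
      face_inc_eq_put _ rfl (y := l ++ c :: mergeAt t v) ((Merge.cons c hm).append_left l),
      headAct_put α h b hc rfl (Raise.append_cons a l rfl _),
      α.act_mul (Nat.le_add_right _ _)]

theorem barD_headAct {a d e : ℕ} (h : a + d = e) (b : 𝒜 a)
    (x : Z.BarObj l ((d + 1) :: n) (i + 1)) :
    Z.barD l ((e + 1) :: n) i (headAct α l n (i + 1) h b x) =
      headAct α l n i h b (Z.barD l ((d + 1) :: n) i x) := by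
  rw [barD_apply, barD_apply, map_sum]
  refine Finset.sum_congr rfl fun t ht => ?_
  rw [map_smul, face_headAct α h b (Finset.mem_range.1 ht)]

theorem headAct_one {d : ℕ} (h : 0 + d = d) (x : Z.BarObj l ((d + 1) :: n) i) :
    headAct α l n i h ⟨1, SetLike.one_mem_graded 𝒜⟩ x = x := by
  suffices headAct α l n i h ⟨1, SetLike.one_mem_graded 𝒜⟩ = LinearMap.id from
    LinearMap.congr_fun this x
  refine barObj_ext_cons fun c v hw hc z => ?_
  rw [headAct_inc α h _ _ (Raise.append_cons 0 l (zero_add c) v), α.one_act]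
  exact put_word ⟨c :: v, hw⟩ z

theorem headAct_mul {a b d e f : ℕ} (h₁ : b + d = e) (h₂ : a + e = f) (h : (a + b) + d = f)
    (r : 𝒜 a) (s : 𝒜 b) (x : Z.BarObj l ((d + 1) :: n) i) :
    headAct α l n i h ⟨r.1 * s.1, SetLike.mul_mem_graded r.2 s.2⟩ x =
      headAct α l n i h₂ r (headAct α l n i h₁ s x) := by
  suffices headAct α l n i h ⟨r.1 * s.1, SetLike.mul_mem_graded r.2 s.2⟩ =
      headAct α l n i h₂ r ∘ₗ headAct α l n i h₁ s from LinearMap.congr_fun this x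
  refine barObj_ext_cons fun c v hw hc z => ?_
  rw [LinearMap.comp_apply, headAct_inc α h₁ s _ (Raise.append_cons b l rfl v),
    headAct_put α h₂ r (Nat.add_pos_right b hc) rfl (Raise.append_cons a l rfl v),
    headAct_inc α h _ _ (Raise.append_cons (a + b) l (add_assoc a b c) v), α.mul_act]

/-- The complex of graded `A`-modules whose component of internal degree `j` is the complex
`E_{l; j + 1, n_1, …, n_q}` with the homological degree lowered by `1`; the algebra `A` acts on
the first letter following `l`. -/
noncomputable def headComplex (l n : List ℕ) : ModComplex 𝒜 where
  X s :=
    { obj j := Z.BarObj l ((j + 1) :: n) (s + 1)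
      act h := headAct α l n (s + 1) h
      one_act h x := headAct_one α h x
      mul_act h₁ h₂ h a b x := headAct_mul α h₁ h₂ h a b x }
  d s j := Z.barD l ((j + 1) :: n) (s + 1)
  d_d s _ x := LinearMap.congr_fun (Z.barD_comp_barD (s + 1)) x
  d_act _ _ _ _ h a x := barD_headAct α h a x

/-! ### The null homotopy of the action of `A₊` -/

/-- The operation `a ⋆ x` of inserting the element `a = a · 1` of the algebra as a new letter
before the words refining `d, n_1, …, n_q`. -/
noncomputable def prepend (l n : List ℕ) (i : ℕ) {a d e : ℕ} (_ : a + d = e) :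
    𝒜 a →ₗ[k] Z.BarObj l ((d + 1) :: n) i →ₗ[k] Z.BarObj l ((e + 1) :: n) (i + 1) :=
  desc₂ fun w => ((α.act (Raise.append_cons a l (add_zero a) w.1)).compl₂
    (Z.unit (InsertZero.append_cast l w.1))).compr₂
      (Z.put l ((e + 1) :: n) (i + 1) (l ++ a :: w.1))

theorem prepend_inc {a d e : ℕ} (h : a + d = e) (b : 𝒜 a) (w : BarWord ((d + 1) :: n) i)
    (z : Z.comp (l ++ w.1)) :
    prepend α l n i h b (Z.inc l w z) = Z.put l ((e + 1) :: n) (i + 1) (l ++ a :: w.1)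
      (α.act (Raise.append_cons a l (add_zero a) w.1) b
        (Z.unit (InsertZero.append_cast l w.1) z)) :=
  desc₂_inc _ b w z

theorem prepend_put {a d e : ℕ} (ha : 0 < a) (h : a + d = e) (b : 𝒜 a) (v : List ℕ)
    (z : Z.comp (l ++ v)) :
    prepend α l n i h b (Z.put l ((d + 1) :: n) i (l ++ v) z) =
      Z.put l ((e + 1) :: n) (i + 1) (l ++ a :: v)
        (α.act (Raise.append_cons a l (add_zero a) v) b
          (Z.unit (InsertZero.append_cast l v) z)) := by
  by_cases hv : Valid l ((d + 1) :: n) i (l ++ v)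
  · let w : BarWord ((d + 1) :: n) i := ⟨v, valid_append_iff.1 hv⟩
    exact (congrArg _ (put_word w z)).trans (prepend_inc α h b w z)
  · rw [put_of_not_valid hv, map_zero, put_of_not_valid]
    intro hv'
    refine hv (valid_append_iff.2 ?_)
    rw [valid_append_iff, refines_cons_iff (d := d + 1) ha (Nat.succ_pos d) (by omega)] at hv'
    exact ⟨Nat.succ_injective hv'.1, hv'.2⟩

theorem headAct_prepend {a b d e f : ℕ} (hb : 0 < b) (h₁ : b + d = e) (h₂ : a + e = f)
    (h : (a + b) + d = f) (r : 𝒜 a) (s : 𝒜 b) (x : Z.BarObj l ((d + 1) :: n) i) :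
    headAct α l n (i + 1) h₂ r (prepend α l n i h₁ s x) =
      prepend α l n i h ⟨r.1 * s.1, SetLike.mul_mem_graded r.2 s.2⟩ x := by
  suffices headAct α l n (i + 1) h₂ r ∘ₗ prepend α l n i h₁ s =
      prepend α l n i h ⟨r.1 * s.1, SetLike.mul_mem_graded r.2 s.2⟩ from LinearMap.congr_fun this x
  refine Z.barObj_ext fun w z => ?_
  rw [LinearMap.comp_apply, prepend_inc, prepend_inc,
    headAct_put α h₂ r hb rfl (Raise.append_cons a l rfl w.1), ← α.mul_act]

theorem face_zero_prepend {a d e : ℕ} (ha : 0 < a) (h : a + d = e) (b : 𝒜 a)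
    (x : Z.BarObj l ((d + 1) :: n) (i + 1)) :
    Z.face l ((e + 1) :: n) (i + 1) 0 (prepend α l n (i + 1) h b x) =
      headAct α l n (i + 1) h b x := by
  suffices Z.face l ((e + 1) :: n) (i + 1) 0 ∘ₗ prepend α l n (i + 1) h b =
      headAct α l n (i + 1) h b from LinearMap.congr_fun this x
  refine barObj_ext_cons fun c v hw hc z => ?_
  have hw' : (a :: c :: v).length = i + 2 ∧ Refines (a :: c :: v) ((e + 1) :: n) :=
    ⟨congrArg Nat.succ hw.1,
      (refines_cons_iff (d := d + 1) ha (Nat.succ_pos d) (by omega)).2 hw.2⟩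
  have e₁ : ∀ z', Z.put l ((e + 1) :: n) (i + 2) (l ++ a :: c :: v) z' =
      Z.inc l ⟨a :: c :: v, hw'⟩ z' := fun z' => put_word ⟨a :: c :: v, hw'⟩ z'
  rw [LinearMap.comp_apply, prepend_inc, e₁,
    face_inc_eq_put _ rfl (y := l ++ (a + c) :: v) (Merge.append_cons_cons l rfl v),
    headAct_inc α h b _ (Raise.append_cons a l rfl v),
    ← α.act_mul le_rfl (Merge.append_cons_cons l (zero_add c) v)
      (Merge.append_cons_cons l rfl v) _ (Raise.append_cons a l rfl v)]
  congr 2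
  exact LinearMap.congr_fun (Z.mul_unit_left _ _) z

theorem face_succ_prepend {a d e : ℕ} (ha : 0 < a) (h : a + d = e) (b : 𝒜 a) {t : ℕ} (ht : t < i)
    (x : Z.BarObj l ((d + 1) :: n) (i + 1)) :
    Z.face l ((e + 1) :: n) (i + 1) (t + 1) (prepend α l n (i + 1) h b x) =
      prepend α l n i h b (Z.face l ((d + 1) :: n) i t x) := by
  suffices Z.face l ((e + 1) :: n) (i + 1) (t + 1) ∘ₗ prepend α l n (i + 1) h b =
      prepend α l n i h b ∘ₗ Z.face l ((d + 1) :: n) i t from LinearMap.congr_fun this x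
  refine Z.barObj_ext fun w z => ?_
  obtain ⟨v, hw⟩ := w
  have hw' : (a :: v).length = i + 2 ∧ Refines (a :: v) ((e + 1) :: n) :=
    ⟨congrArg Nat.succ hw.1,
      (refines_cons_iff (d := d + 1) ha (Nat.succ_pos d) (by omega)).2 hw.2⟩
  have e₁ : ∀ z', Z.put l ((e + 1) :: n) (i + 2) (l ++ a :: v) z' =
      Z.inc l ⟨a :: v, hw'⟩ z' := fun z' => put_word ⟨a :: v, hw'⟩ z'
  have hm : Merge t v (mergeAt t v) := merge_mergeAt (by
    have := hw.1
    omega)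
  rw [LinearMap.comp_apply, LinearMap.comp_apply, prepend_inc, e₁,
    face_inc_eq_put _ rfl (y := l ++ a :: mergeAt t v) ((Merge.cons a hm).append_left l),
    face_inc_eq_put _ rfl (y := l ++ mergeAt t v) (hm.append_left l), prepend_put α ha,
    ← α.act_mul (Nat.le_add_right _ _) ((Merge.cons 0 hm).append_left l)
      ((Merge.cons a hm).append_left l) _ (Raise.append_cons a l (add_zero a) _)]
  congr 2
  exact LinearMap.congr_fun (Z.mul_unit_of_ge (Nat.le_add_right _ _) _
    ((Merge.cons 0 hm).append_left l).cast (hm.append_left l).cast _) z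

/-- The operation `a ⋆ -` is a null homotopy of the action of `a`. -/
theorem barD_prepend {a d e : ℕ} (ha : 0 < a) (h : a + d = e) (b : 𝒜 a)
    (x : Z.BarObj l ((d + 1) :: n) (i + 1)) :
    Z.barD l ((e + 1) :: n) (i + 1) (prepend α l n (i + 1) h b x) =
      headAct α l n (i + 1) h b x - prepend α l n i h b (Z.barD l ((d + 1) :: n) i x) := by
  rw [barD_apply, barD_apply, Finset.sum_range_succ', face_zero_prepend α ha, pow_zero, one_smul,
    map_sum, eq_sub_iff_add_eq', ← add_assoc, ← Finset.sum_add_distrib, add_eq_right]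
  refine Finset.sum_eq_zero fun t ht => ?_
  rw [face_succ_prepend α ha h b (Finset.mem_range.1 ht), map_smul, pow_succ, mul_neg_one, neg_smul,
    add_neg_cancel]

end Head

end QuasiAlgebra

end QuasiKoszul

namespace QuasiKoszul

namespace QuasiAlgebra

open QuasiKoszul.GradedModule

variable {k A : Type u} [Field k] {Z : QuasiAlgebra k} [Ring A] [Algebra k A]
  {𝒜 : ℕ → Submodule k A} [GradedAlgebra 𝒜] (α : LeftAction 𝒜 Z) {l n : List ℕ}

/-! ### The retraction of the total complex onto its column `i = 0` -/

/-- The map `a₁ ⊗ ⋯ ⊗ a_i ⊗ x ↦ a₁ ⋆ (a₂ ⋆ ⋯ (a_i ⋆ x))`, followed by the projection to the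
homological degree `u` (where `u = s + 1 + i` is the only degree in which it is nonzero). -/
noncomputable def iterPrepend (l n : List ℕ) : ∀ i s u j : ℕ,
    (((headComplex α l n).X s).bar i).obj j →ₗ[k] Z.BarObj l ((j + 1) :: n) u
  | 0, s, u, j => Z.reput l ((j + 1) :: n) (s + 1) l ((j + 1) :: n) u
  | _ + 1, _, 0, _ => 0
  | i + 1, s, u + 1, _ => ((headComplex α l n).X s).barDesc fun _ b hp =>
      (prepend α l n u hp.2).compl₂ (iterPrepend l n i s u b)

theorem iterPrepend_barMk {i s u j a b : ℕ} (hp : 0 < a ∧ a + b = j) (y : 𝒜 a)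
    (x : (((headComplex α l n).X s).bar i).obj b) :
    iterPrepend α l n (i + 1) s (u + 1) j (((headComplex α l n).X s).barMk hp y x) =
      prepend α l n u hp.2 y (iterPrepend α l n i s u b x) := by
  rw [iterPrepend, barDesc_barMk]
  rfl

theorem iterPrepend_zero {s j : ℕ} (x : (((headComplex α l n).X s).bar 0).obj j) :
    iterPrepend α l n 0 s (s + 1) j x = x :=
  reput_self x

theorem iterPrepend_act {i s u : ℕ} (hu : s + 1 + i = u) {a r j : ℕ} (h : a + r = j) (y : 𝒜 a)
    (x : (((headComplex α l n).X s).bar i).obj r) :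
    iterPrepend α l n i s u j ((((headComplex α l n).X s).bar i).act h y x) =
      headAct α l n u h y (iterPrepend α l n i s u r x) := by
  subst hu
  cases i with
  | zero =>
    exact (iterPrepend_zero α _).trans (congrArg _ (iterPrepend_zero α _).symm)
  | succ i =>
    suffices iterPrepend α l n (i + 1) s (s + 1 + i + 1) j ∘ₗ
          (((headComplex α l n).X s).bar (i + 1)).act h y =
        headAct α l n (s + 1 + i + 1) h y ∘ₗ iterPrepend α l n (i + 1) s (s + 1 + i + 1) r from
      LinearMap.congr_fun this x
    refine bar_hom_ext fun b c hp y' x' => ?_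
    rw [LinearMap.comp_apply, LinearMap.comp_apply, act_barMk, iterPrepend_barMk,
      iterPrepend_barMk, headAct_prepend α hp.1]

/-- The contribution of the bar differential to the differential of `iterPrepend`. -/
noncomputable def iterPrependBar (l n : List ℕ) : ∀ i s u j : ℕ,
    (((headComplex α l n).X s).bar i).obj j →ₗ[k] Z.BarObj l ((j + 1) :: n) u
  | 0, _, _, _ => 0
  | i + 1, s, u, j => iterPrepend α l n i s u j ∘ₗ ((headComplex α l n).X s).barD i j

/-- The contribution of the differential of `headComplex` to the differential of `iterPrepend`. -/
noncomputable def iterPrependD (l n : List ℕ) : ∀ i s u j : ℕ,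
    (((headComplex α l n).X s).bar i).obj j →ₗ[k] Z.BarObj l ((j + 1) :: n) u
  | _, 0, _, _ => 0
  | i, s + 1, u, j => (-1 : k) ^ i •
      (iterPrepend α l n i s u j ∘ₗ barMap ((headComplex α l n).d s) i j)

/-- The maps `iterPrepend` form a morphism from the total complex. -/
theorem barD_iterPrepend (i : ℕ) : ∀ {s u j : ℕ}, s + 1 + i = u + 1 →
    ∀ x : (((headComplex α l n).X s).bar i).obj j,
    Z.barD l ((j + 1) :: n) u (iterPrepend α l n i s (u + 1) j x) =
      iterPrependBar α l n i s u j x + iterPrependD α l n i s u j x := by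
  induction i with
  | zero =>
    intro s u j hu x
    obtain rfl : s = u := by omega
    rw [iterPrepend_zero, iterPrependBar, LinearMap.zero_apply, zero_add]
    cases s with
    | zero => exact barD_zero _
    | succ s =>
      rw [iterPrependD, pow_zero, one_smul]
      exact (iterPrepend_zero α (Z.barD l ((j + 1) :: n) (s + 1) x)).symm
  | succ i ih =>
    intro s u j hu x
    obtain ⟨u, rfl⟩ : ∃ u', u = u' + 1 := ⟨s + i, by omega⟩
    suffices Z.barD l ((j + 1) :: n) (u + 1) ∘ₗ iterPrepend α l n (i + 1) s (u + 2) j =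
        iterPrependBar α l n (i + 1) s (u + 1) j + iterPrependD α l n (i + 1) s (u + 1) j from
      LinearMap.congr_fun this x
    refine bar_hom_ext fun a b hp y x' => ?_
    have hD : iterPrependD α l n (i + 1) s (u + 1) j (((headComplex α l n).X s).barMk hp y x') =
        -prepend α l n u hp.2 y (iterPrependD α l n i s u b x') := by
      cases s with
      | zero =>
        rw [iterPrependD, iterPrependD, LinearMap.zero_apply, LinearMap.zero_apply, map_zero,
          neg_zero]
      | succ s =>
        rw [iterPrependD, iterPrependD, LinearMap.smul_apply, LinearMap.smul_apply,
          LinearMap.comp_apply, LinearMap.comp_apply, barMap_barMk, iterPrepend_barMk, map_smul,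
          pow_succ, mul_neg_one, neg_smul]
    have hB : iterPrependBar α l n (i + 1) s (u + 1) j
        (((headComplex α l n).X s).barMk hp y x') =
        headAct α l n (u + 1) hp.2 y (iterPrepend α l n i s (u + 1) b x') -
          prepend α l n u hp.2 y (iterPrependBar α l n i s u b x') := by
      cases i with
      | zero =>
        rw [iterPrependBar, iterPrependBar, LinearMap.comp_apply, barD_zero_barMk,
          LinearMap.zero_apply, map_zero, sub_zero]
        exact iterPrepend_act α (i := 0) (by omega) hp.2 y x'
      | succ i =>
        rw [iterPrependBar, iterPrependBar, LinearMap.comp_apply, barD_succ_barMk, map_sub,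
          iterPrepend_act α (by omega), iterPrepend_barMk, LinearMap.comp_apply]
    rw [LinearMap.comp_apply, LinearMap.add_apply, hB, hD, iterPrepend_barMk, barD_prepend α hp.1,
      ih (by omega), map_add]
    abel

/-- If the total complex is exact, then so is its direct summand `E_{l; c + 1, n_1, …, n_q}`. -/
theorem exists_of_totExact {c t : ℕ} (h : (headComplex α l n).TotExact c t)
    (x : Z.BarObj l ((c + 1) :: n) (t + 1)) (hx : Z.barD l ((c + 1) :: n) t x = 0) :
    ∃ y, Z.barD l ((c + 1) :: n) (t + 1) y = x := by
  let z : (headComplex α l n).Tot c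
    | 0 => Pi.single t x
    | _ + 1 => 0
  have z_succ : ∀ i s, z (i + 1) s = 0 := fun _ _ => rfl
  have z_zero : z 0 t = x := Pi.single_eq_same t _
  have z_zero_of_ne : ∀ s, s ≠ t → z 0 s = 0 := fun s hs => Pi.single_eq_of_ne hs _
  obtain ⟨y, hy⟩ := h z (by
    intro i s his
    rw [ModComplex.totD, z_succ, map_zero, zero_add]
    cases i with
    | zero =>
      obtain rfl : s + 1 = t := by omega
      rw [z_zero, pow_zero, one_smul]
      exact hx
    | succ i => rw [z_succ, map_zero, smul_zero])
  refine ⟨∑ p ∈ Finset.HasAntidiagonal.antidiagonal (t + 1),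
    iterPrepend α l n p.1 p.2 (t + 2) c (y p.1 p.2), ?_⟩
  have h₁ : ∀ p ∈ Finset.HasAntidiagonal.antidiagonal (t + 1),
      Z.barD l ((c + 1) :: n) (t + 1) (iterPrepend α l n p.1 p.2 (t + 2) c (y p.1 p.2)) =
        iterPrependBar α l n p.1 p.2 (t + 1) c (y p.1 p.2) +
          iterPrependD α l n p.1 p.2 (t + 1) c (y p.1 p.2) := fun p hp =>
    barD_iterPrepend α p.1 (by have := Finset.HasAntidiagonal.mem_antidiagonal.1 hp; omega) _
  have h₂ : ∀ p ∈ Finset.HasAntidiagonal.antidiagonal t,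
      iterPrependBar α l n (p.1 + 1) p.2 (t + 1) c (y (p.1 + 1) p.2) +
        iterPrependD α l n p.1 (p.2 + 1) (t + 1) c (y p.1 (p.2 + 1)) =
      iterPrepend α l n p.1 p.2 (t + 1) c (z p.1 p.2) := fun p hp => by
    rw [hy p.1 p.2 (Finset.HasAntidiagonal.mem_antidiagonal.1 hp), ModComplex.totD, map_add,
      map_smul, iterPrependBar, iterPrependD]
    rfl
  rw [map_sum, Finset.sum_congr rfl h₁, Finset.sum_add_distrib,
    Finset.Nat.sum_antidiagonal_succ, Finset.Nat.sum_antidiagonal_succ', iterPrependBar,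
    LinearMap.zero_apply, zero_add]
  have h₃ : iterPrependD α l n (t + 1) 0 (t + 1) c (y (t + 1) 0) = 0 := by
    rw [iterPrependD, LinearMap.zero_apply]
  rw [h₃, zero_add, ← Finset.sum_add_distrib, Finset.sum_congr rfl h₂,
    Finset.sum_eq_single (0, t)]
  · dsimp only
    rw [z_zero]
    exact iterPrepend_zero α x
  · rintro ⟨i, s⟩ hp hne
    cases i with
    | zero =>
      have := Finset.HasAntidiagonal.mem_antidiagonal.1 hp
      dsimp only at this
      exact absurd (by rw [← this, zero_add]) hne
    | succ i =>
      dsimp only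
      rw [z_succ, map_zero]
  · exact fun h => absurd (Finset.HasAntidiagonal.mem_antidiagonal.2 (zero_add t)) h

end QuasiAlgebra

end QuasiKoszul

namespace QuasiKoszul

namespace QuasiAlgebra

open QuasiKoszul.GradedModule

variable {k A : Type u} [Field k] {Z : QuasiAlgebra k} [Ring A] [Algebra k A]
  {𝒜 : ℕ → Submodule k A} [GradedAlgebra 𝒜] (α : LeftAction 𝒜 Z) {l n : List ℕ} {i : ℕ}

/-! ### The filtration by the degree remaining after the first letter -/

/-- The graded `A`-module with the component of internal degree `j` equal to the term of homological
degree `s` of the complex `E_{l, j + 1; n}`. -/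
noncomputable def tailModule (l n : List ℕ) (s : ℕ) : GradedModule 𝒜 where
  obj j := Z.BarObj (l ++ [j + 1]) n s
  act h :=
    { toFun a := α.barAct (Raise.last h l) n a s
      map_add' a b := by
        refine Z.barObj_ext fun w z => ?_
        rw [LinearMap.add_apply, α.barAct_inc, α.barAct_inc, α.barAct_inc, map_add,
          LinearMap.add_apply, map_add]
      map_smul' r a := by
        refine Z.barObj_ext fun w z => ?_
        rw [RingHom.id_apply, LinearMap.smul_apply, α.barAct_inc, α.barAct_inc, map_smul,
          LinearMap.smul_apply, map_smul] }
  one_act {j} h x := by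
    suffices α.barAct (Raise.last h l) n ⟨1, SetLike.one_mem_graded 𝒜⟩ s = LinearMap.id from
      LinearMap.congr_fun this x
    refine Z.barObj_ext fun w z => ?_
    rw [α.barAct_inc, α.one_act, LinearMap.id_apply]
  mul_act {a b _ _ _} h₁ h₂ h r r' x := by
    suffices α.barAct (Raise.last h l) n
        (⟨r.1 * r'.1, SetLike.mul_mem_graded r.2 r'.2⟩ : 𝒜 (a + b)) s =
        α.barAct (Raise.last h₂ l) n r s ∘ₗ α.barAct (Raise.last h₁ l) n r' s from
      LinearMap.congr_fun this x
    refine Z.barObj_ext fun w z => ?_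
    rw [LinearMap.comp_apply, α.barAct_inc, α.barAct_inc, α.barAct_inc]
    congr 1
    exact α.mul_act _ _ _ r r' z

theorem barD_barAct {p m : ℕ} {l' : List ℕ} (h : Raise m p l l') (a : 𝒜 m)
    (x : Z.BarObj l n (i + 1)) :
    Z.barD l' n i (α.barAct h n a (i + 1) x) = α.barAct h n a i (Z.barD l n i x) := by
  rw [barD_apply, barD_apply, map_sum]
  refine Finset.sum_congr rfl fun t _ => ?_
  rw [map_smul]
  congr 1
  exact LinearMap.congr_fun (α.face_barAct h n a i t) x

/-- The complex of graded `A`-modules with the component `E_{l, j + 1; n}` of internal degree `j`,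
with the opposite differential: a multiplication in a given position of the word after `j + 1`
takes place one position further to the right in the word starting with `j + 1`. -/
noncomputable def tailComplex (l n : List ℕ) : ModComplex 𝒜 where
  X s := tailModule α l n s
  d s j := -Z.barD (l ++ [j + 1]) n s
  d_d s j x := by
    have h : Z.barD (l ++ [j + 1]) n s (Z.barD (l ++ [j + 1]) n (s + 1) x) = 0 :=
      LinearMap.congr_fun (Z.barD_comp_barD (l := l ++ [j + 1]) (n := n) s) x
    exact (congrArg Neg.neg (map_neg (Z.barD (l ++ [j + 1]) n s) _)).trans
      ((neg_neg _).trans h)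
  d_act s _ i j h a x :=
    (congrArg Neg.neg (barD_barAct α (Raise.last h l) a x)).trans
      (map_neg (α.barAct (Raise.last h l) n a s) (Z.barD (l ++ [i + 1]) n s x)).symm

theorem valid_append_singleton_iff {b c : ℕ} {v : List ℕ} :
    Valid (l ++ [b]) n i (l ++ c :: v) ↔ c = b ∧ v.length = i ∧ Refines v n := by
  constructor
  · rintro ⟨w, hw⟩
    rw [List.append_assoc, List.append_cancel_left_eq, List.singleton_append] at hw
    obtain ⟨rfl, rfl⟩ := List.cons.inj hw
    exact ⟨rfl, w.2⟩
  · rintro ⟨rfl, h⟩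
    exact ⟨⟨v, h⟩, by rw [List.append_assoc, List.singleton_append]⟩

theorem valid_cons_of_valid {m b d : ℕ} (hb : 0 < b) (hmb : m + b = d + 1) {y : List ℕ}
    (hy : Valid (l ++ [b]) (consPos m n) i y) : Valid l ((d + 1) :: n) (i + 1) y := by
  obtain ⟨w, rfl⟩ := hy
  rw [List.append_assoc, List.singleton_append, valid_append_iff,
    refines_cons_cons (Nat.succ_pos d)]
  exact ⟨congrArg Nat.succ w.2.1, hb, m, hmb, w.2.2⟩

theorem barAct_put {a b c : ℕ} (hab : a + b = c) (r : 𝒜 a) {v x y : List ℕ}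
    (hx : x = l ++ (b + 1) :: v) (hy : Raise a l.length x y) (z : Z.comp x) :
    α.barAct (Raise.last hab l) n r i (Z.put (l ++ [b + 1]) n i x z) =
      Z.put (l ++ [c + 1]) n i y (α.act hy r z) := by
  have hx' : x = (l ++ [b + 1]) ++ v := by rw [hx, List.append_assoc, List.singleton_append]
  clear hx
  subst hx'
  obtain rfl := hy.unique ((Raise.last hab l).append_right v)
  by_cases hv : v.length = i ∧ Refines v n
  · let w : BarWord n i := ⟨v, hv⟩
    refine (congrArg _ (put_word w z)).trans ?_
    rw [α.barAct_inc]
    exact (put_word w _).symm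
  · rw [put_of_not_valid (fun h => hv (valid_append_iff.1 h)),
      put_of_not_valid (fun h => hv (valid_append_iff.1 h)), map_zero]

/-- The projection to the sum of the components indexed by the words `w` refining
`j + 1, n_1, …, n_q` such that `j + 1 - w_0 < m`, where `w_0` is the first letter. -/
noncomputable def trunc (m : ℕ) (l n : List ℕ) (i j : ℕ) :
    Z.BarObj l ((j + 1) :: n) i →ₗ[k] Z.BarObj l ((j + 1) :: n) i :=
  desc fun w => if j + 1 < m + w.1.headI then Z.inc l w else 0

theorem trunc_inc {m j : ℕ} {a : ℕ} {v : List ℕ} (h : j + 1 < m + a)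
    (hw : (a :: v).length = i ∧ Refines (a :: v) ((j + 1) :: n)) (z : Z.comp (l ++ a :: v)) :
    trunc m l n i j (Z.inc l ⟨a :: v, hw⟩ z) = Z.inc l ⟨a :: v, hw⟩ z := by
  rw [trunc, desc_inc]
  exact LinearMap.congr_fun (if_pos (show j + 1 < m + a from h)) z

theorem trunc_inc_of_le {m j : ℕ} {a : ℕ} {v : List ℕ} (h : m + a ≤ j + 1)
    (hw : (a :: v).length = i ∧ Refines (a :: v) ((j + 1) :: n)) (z : Z.comp (l ++ a :: v)) :
    trunc m l n i j (Z.inc l ⟨a :: v, hw⟩ z) = 0 := by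
  rw [trunc, desc_inc]
  exact LinearMap.congr_fun (if_neg (show ¬ j + 1 < m + a from h.not_gt)) z

theorem trunc_put {m j : ℕ} {a : ℕ} {v y : List ℕ} (h : j + 1 < m + a) (hy : y = l ++ a :: v)
    (z : Z.comp y) :
    trunc m l n i j (Z.put l ((j + 1) :: n) i y z) = Z.put l ((j + 1) :: n) i y z := by
  subst hy
  by_cases hv : Valid l ((j + 1) :: n) i (l ++ a :: v)
  · let w : BarWord ((j + 1) :: n) i := ⟨a :: v, valid_append_iff.1 hv⟩
    rw [show Z.put l ((j + 1) :: n) i (l ++ a :: v) z = Z.inc l w z from put_word w z]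
    exact trunc_inc h w.2 z
  · rw [put_of_not_valid hv, map_zero]

theorem first_le {j : ℕ} {a : ℕ} {v : List ℕ} (h : Refines (a :: v) ((j + 1) :: n)) :
    0 < a ∧ a ≤ j + 1 := by
  obtain ⟨ha, m, hm, -⟩ := (refines_cons_cons (Nat.succ_pos j)).1 h
  exact ⟨ha, by omega⟩

/-- The first letter does not decrease under the differential: every face of the component of the
word `a, v` lies in a component whose first letter is at least `a`. -/
theorem exists_face_inc {j t : ℕ} {a : ℕ} {v : List ℕ} (ht : t < i)
    (hw : (a :: v).length = i + 1 ∧ Refines (a :: v) ((j + 1) :: n)) (z : Z.comp (l ++ a :: v)) :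
    ∃ (a' : ℕ) (v' : List ℕ) (z' : Z.comp (l ++ a' :: v')), a ≤ a' ∧ (t = 0 → a < a') ∧
      Z.face l ((j + 1) :: n) i t (Z.inc l ⟨a :: v, hw⟩ z) =
        Z.put l ((j + 1) :: n) i (l ++ a' :: v') z' := by
  cases t with
  | zero =>
    cases v with
    | nil =>
      have := hw.1
      rw [List.length_singleton] at this
      omega
    | cons b v =>
      have hb := hw.2.pos b (by simp)
      have hm : Merge (l.length + 0) (l ++ a :: b :: v) (l ++ (a + b) :: v) :=
        Merge.append_cons_cons l rfl v
      have e := face_inc_eq_put (Z := Z) (⟨a :: b :: v, hw⟩ : BarWord ((j + 1) :: n) (i + 1))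
        rfl hm z
      refine ⟨a + b, v, Z.nmul hm z, by omega, fun _ => by omega, e⟩
  | succ t =>
    have hm : Merge t v (mergeAt t v) := merge_mergeAt (by
      have := hw.1
      rw [List.length_cons] at this
      omega)
    have hm' : Merge (l.length + (t + 1)) (l ++ a :: v) (l ++ a :: mergeAt t v) :=
      (Merge.cons a hm).append_left l
    have e := face_inc_eq_put (Z := Z) (⟨a :: v, hw⟩ : BarWord ((j + 1) :: n) (i + 1)) rfl hm' z
    exact ⟨a, mergeAt t v, Z.nmul hm' z, le_rfl, fun h => absurd h (Nat.succ_ne_zero t), e⟩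

/-- The inclusion of the successive quotient of the filtration. -/
noncomputable abbrev tailUp (l n : List ℕ) (m s b d : ℕ) :
    Z.BarObj (l ++ [b + 1]) (consPos m n) s →ₗ[k] Z.BarObj l ((d + 1) :: n) (s + 1) :=
  Z.reput (l ++ [b + 1]) (consPos m n) s l ((d + 1) :: n) (s + 1)

/-- The projection to the successive quotient of the filtration. -/
noncomputable abbrev tailDown (l n : List ℕ) (m s d b : ℕ) :
    Z.BarObj l ((d + 1) :: n) (s + 1) →ₗ[k] Z.BarObj (l ++ [b + 1]) (consPos m n) s :=
  Z.reput l ((d + 1) :: n) (s + 1) (l ++ [b + 1]) (consPos m n) s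

theorem tailDown_put {m s b d : ℕ} (h : b + m = d) {y : List ℕ} (z : Z.comp y) :
    tailDown l n m s d b (Z.put l ((d + 1) :: n) (s + 1) y z) =
      Z.put (l ++ [b + 1]) (consPos m n) s y z :=
  reput_put (valid_cons_of_valid (Nat.succ_pos b) (by omega)) z

theorem tailDown_put_of_ne {m s b d : ℕ} (h : b + m = d) {a : ℕ} (ha : a ≠ b + 1) {v : List ℕ}
    (z : Z.comp (l ++ a :: v)) :
    tailDown l n m s d b (Z.put l ((d + 1) :: n) (s + 1) (l ++ a :: v) z) = 0 := by
  rw [tailDown_put h, put_of_not_valid fun hv => ha (valid_append_singleton_iff.1 hv).1]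

theorem tailDown_tailUp {m s b d : ℕ} (h : b + m = d)
    (x : Z.BarObj (l ++ [b + 1]) (consPos m n) s) :
    tailDown l n m s d b (tailUp l n m s b d x) = x := by
  suffices tailDown l n m s d b ∘ₗ tailUp l n m s b d = LinearMap.id from
    LinearMap.congr_fun this x
  refine Z.barObj_ext fun w z => ?_
  rw [LinearMap.comp_apply, reput_inc, tailDown_put h, put_word, LinearMap.id_apply]

theorem tailUp_inc {m s b d : ℕ} (h : b + m = d) {v : List ℕ} (hv : v.length = s ∧
    Refines v (consPos m n)) (z : Z.comp ((l ++ [b + 1]) ++ v)) :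
    ∃ (hw : ((b + 1) :: v).length = s + 1 ∧ Refines ((b + 1) :: v) ((d + 1) :: n))
      (z' : Z.comp (l ++ (b + 1) :: v)),
      tailUp l n m s b d (Z.inc (l ++ [b + 1]) ⟨v, hv⟩ z) = Z.inc l ⟨(b + 1) :: v, hw⟩ z' := by
  have hw : ((b + 1) :: v).length = s + 1 ∧ Refines ((b + 1) :: v) ((d + 1) :: n) :=
    ⟨congrArg Nat.succ hv.1,
      (refines_cons_cons (Nat.succ_pos d)).2 ⟨Nat.succ_pos b, m, by omega, hv.2⟩⟩
  refine ⟨hw, ?_⟩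
  rw [reput_inc]
  dsimp only
  generalize hy : (l ++ [b + 1]) ++ v = y at z
  obtain rfl : l ++ (b + 1) :: v = y := by rw [← hy, List.append_assoc, List.singleton_append]
  exact ⟨z, put_word ⟨(b + 1) :: v, hw⟩ z⟩

theorem tailDown_barD_tailUp {m s b d : ℕ} (h : b + m = d)
    (x : Z.BarObj (l ++ [b + 1]) (consPos m n) (s + 1)) :
    tailDown l n m s d b
        (Z.barD l ((d + 1) :: n) (s + 1) (tailUp l n m (s + 1) b d x)) =
      -Z.barD (l ++ [b + 1]) (consPos m n) s x := by
  suffices tailDown l n m s d b ∘ₗ Z.barD l ((d + 1) :: n) (s + 1) ∘ₗ tailUp l n m (s + 1) b d =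
      -Z.barD (l ++ [b + 1]) (consPos m n) s from LinearMap.congr_fun this x
  refine Z.barObj_ext ?_
  rintro ⟨v, hv⟩ z
  rw [LinearMap.comp_apply, LinearMap.comp_apply, LinearMap.neg_apply, barD_apply, barD_apply,
    Finset.sum_range_succ', map_add, map_sum, ← Finset.sum_neg_distrib]
  have h₀ : tailDown l n m s d b ((-1 : k) ^ 0 • Z.face l ((d + 1) :: n) (s + 1) 0
      (tailUp l n m (s + 1) b d (Z.inc (l ++ [b + 1]) ⟨v, hv⟩ z))) = 0 := by
    obtain ⟨hw, z', hz'⟩ := tailUp_inc h hv z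
    obtain ⟨a', v', z'', -, ha', e⟩ := exists_face_inc (Nat.succ_pos s) hw z'
    rw [hz', e, map_smul, tailDown_put_of_ne h (ha' rfl).ne', smul_zero]
  rw [h₀, add_zero]
  refine Finset.sum_congr rfl fun t ht => ?_
  rw [map_smul, pow_succ, mul_neg_one, neg_smul]
  congr 2
  have hm : Merge t v (mergeAt t v) := merge_mergeAt (by
    have := Finset.mem_range.1 ht
    have := hv.1
    omega)
  have hw : ((b + 1) :: v).length = s + 1 + 1 ∧ Refines ((b + 1) :: v) ((d + 1) :: n) :=
    ⟨congrArg Nat.succ hv.1,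
      (refines_cons_cons (Nat.succ_pos d)).2 ⟨Nat.succ_pos b, m, by omega, hv.2⟩⟩
  have hM := hm.append_left (l ++ [b + 1])
  rw [face_inc_eq_put ⟨v, hv⟩ rfl hM, reput_inc]
  -- the words `(l ++ [b + 1]) ++ v` and `l ++ ((b + 1) :: v)` are equal but not definitionally so
  have key : ∀ (y y' : List ℕ) (hy : y = l ++ (b + 1) :: v) (p q : ℕ) (hpq : p = q)
      (hp : Merge p y y') (hq : q = l.length + (t + 1)) (z : Z.comp y),
      tailDown l n m s d b (Z.face l ((d + 1) :: n) (s + 1) (t + 1)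
        (Z.put l ((d + 1) :: n) (s + 1 + 1) y z)) =
      Z.put (l ++ [b + 1]) (consPos m n) s y' (Z.nmul hp z) := by
    rintro y y' rfl p q rfl hp hq z
    rw [show Z.put l ((d + 1) :: n) (s + 1 + 1) (l ++ (b + 1) :: v) z =
      Z.inc l ⟨(b + 1) :: v, hw⟩ z from put_word ⟨(b + 1) :: v, hw⟩ z,
      face_inc_eq_put _ hq hp, tailDown_put h]
  exact key _ _ (by rw [List.append_assoc, List.singleton_append]) _ _ rfl hM
    (by rw [List.length_append, List.length_singleton]; omega) z

theorem barD_inc_trunc {m j : ℕ} {a : ℕ} {v : List ℕ} (h : j + 1 < m + a)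
    (hw : (a :: v).length = i + 1 ∧ Refines (a :: v) ((j + 1) :: n)) (z : Z.comp (l ++ a :: v)) :
    trunc m l n i j (Z.barD l ((j + 1) :: n) i (Z.inc l ⟨a :: v, hw⟩ z)) =
      Z.barD l ((j + 1) :: n) i (Z.inc l ⟨a :: v, hw⟩ z) := by
  rw [barD_apply, map_sum]
  refine Finset.sum_congr rfl fun t ht => ?_
  obtain ⟨a', v', z', ha', -, e⟩ := exists_face_inc (Finset.mem_range.1 ht) hw z
  rw [map_smul, e, trunc_put (by omega) rfl]

theorem tailDown_barD_trunc {m s j b : ℕ} (h : b + m = j)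
    (x : Z.BarObj l ((j + 1) :: n) (s + 1 + 1)) :
    tailDown l n m s j b
      (Z.barD l ((j + 1) :: n) (s + 1) (trunc m l n (s + 1 + 1) j x)) = 0 := by
  suffices tailDown l n m s j b ∘ₗ Z.barD l ((j + 1) :: n) (s + 1) ∘ₗ
      trunc m l n (s + 1 + 1) j = 0 from LinearMap.congr_fun this x
  refine barObj_ext_cons fun a v hw ha z => ?_
  rw [LinearMap.comp_apply, LinearMap.comp_apply, LinearMap.zero_apply]
  rcases lt_or_ge (j + 1) (m + a) with hma | hma
  · rw [trunc_inc hma, barD_apply, map_sum]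
    refine Finset.sum_eq_zero fun t ht => ?_
    obtain ⟨a', v', z', ha', -, e⟩ := exists_face_inc (Finset.mem_range.1 ht) hw z
    rw [map_smul, e, tailDown_put_of_ne h (by omega), smul_zero]
  · rw [trunc_inc_of_le hma, map_zero, map_zero]

theorem trunc_add_tail {m s i j : ℕ} (h : j + m = i) (x : Z.BarObj l ((i + 1) :: n) (s + 1)) :
    trunc m l n (s + 1) i x + tailUp l n m s j i (tailDown l n m s i j x) =
      trunc (m + 1) l n (s + 1) i x := by
  suffices trunc m l n (s + 1) i + tailUp l n m s j i ∘ₗ tailDown l n m s i j =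
      trunc (m + 1) l n (s + 1) i from LinearMap.congr_fun this x
  refine barObj_ext_cons fun a v hw ha z => ?_
  rw [LinearMap.add_apply, LinearMap.comp_apply, reput_inc]
  dsimp only
  obtain ⟨-, m', hm', hv⟩ := (refines_cons_cons (Nat.succ_pos i)).1 hw.2
  rcases lt_trichotomy (i + 1) (m + a) with hma | hma | hma
  · rw [trunc_inc hma, trunc_inc (by omega),
      put_of_not_valid fun hv => absurd (valid_append_singleton_iff.1 hv).1 (by omega), map_zero,
      add_zero]
  · obtain rfl : m' = m := by omega
    rw [trunc_inc_of_le hma.ge, trunc_inc (by omega), zero_add,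
      reput_put fun _ => valid_append_singleton_iff.2
        ⟨by omega, Nat.succ_injective hw.1, hv⟩]
    exact put_word ⟨a :: v, hw⟩ z
  · rw [trunc_inc_of_le hma.le, trunc_inc_of_le (by omega),
      put_of_not_valid fun hv => absurd (valid_append_singleton_iff.1 hv).1 (by omega), map_zero,
      add_zero]

theorem tailDown_barD_trunc_succ {m s b d : ℕ} (h : b + m = d)
    (x : Z.BarObj l ((d + 1) :: n) (s + 1 + 1)) :
    tailDown l n m s d b
        (Z.barD l ((d + 1) :: n) (s + 1) (trunc (m + 1) l n (s + 1 + 1) d x)) =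
      -Z.barD (l ++ [b + 1]) (consPos m n) s (tailDown l n m (s + 1) d b x) := by
  rw [← trunc_add_tail h, map_add, map_add, tailDown_barD_trunc h, zero_add,
    tailDown_barD_tailUp h]

theorem trunc_headAct {m a d e : ℕ} (h : a + d = e) (b : 𝒜 a)
    (x : Z.BarObj l ((d + 1) :: n) i) :
    trunc m l n i e (headAct α l n i h b x) = headAct α l n i h b (trunc m l n i d x) := by
  suffices trunc m l n i e ∘ₗ headAct α l n i h b = headAct α l n i h b ∘ₗ trunc m l n i d from
    LinearMap.congr_fun this x
  refine barObj_ext_cons fun c v hw hc z => ?_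
  have hw' : ((a + c) :: v).length = i ∧ Refines ((a + c) :: v) ((e + 1) :: n) :=
    ⟨hw.1, (refines_add_cons_iff (d := d + 1) hc (Nat.succ_pos d) (by omega)).2 hw.2⟩
  rw [LinearMap.comp_apply, LinearMap.comp_apply,
    headAct_inc α h b _ (Raise.append_cons a l rfl v),
    show ∀ z', Z.put l ((e + 1) :: n) i (l ++ (a + c) :: v) z' = Z.inc l ⟨(a + c) :: v, hw'⟩ z'
      from fun z' => put_word ⟨(a + c) :: v, hw'⟩ z']
  rcases lt_or_ge (d + 1) (m + c) with hmc | hmc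
  · rw [trunc_inc hmc, trunc_inc (by omega), headAct_inc α h b _ (Raise.append_cons a l rfl v)]
    exact (put_word ⟨(a + c) :: v, hw'⟩ _).symm
  · rw [trunc_inc_of_le hmc, trunc_inc_of_le (by omega), map_zero]

/-- The filtration of `headComplex l n` by the part `m` of the degree of the first factor `B`
which is left after the first letter. Its successive quotients are the complexes
`E_{l, j + 1; m, n_1, …, n_q}`. -/
noncomputable def headFiltration (l n : List ℕ) :
    (headComplex α l n).Filtration fun m => tailComplex α l (consPos m n) where
  T m s j := trunc m l n (s + 1) j
  up m s b d _ := tailUp l n m s b d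
  down m s d b _ := tailDown l n m s d b
  T_zero s j x := by
    suffices trunc 0 l n (s + 1) j = 0 from LinearMap.congr_fun this x
    refine barObj_ext_cons fun a v hw _ z => ?_
    rw [trunc_inc_of_le (by have := first_le hw.2; omega), LinearMap.zero_apply]
  T_of_lt m s j h x := by
    suffices trunc m l n (s + 1) j = LinearMap.id from LinearMap.congr_fun this x
    refine barObj_ext_cons fun a v hw ha z => ?_
    rw [trunc_inc (by omega), LinearMap.id_apply]
  T_succ m s i j h x := trunc_add_tail h x
  T_succ_of_lt m s j h x := by
    suffices trunc (m + 1) l n (s + 1) j = trunc m l n (s + 1) j from LinearMap.congr_fun this x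
    refine barObj_ext_cons fun a v hw ha z => ?_
    rw [trunc_inc (by omega), trunc_inc (by omega)]
  T_act m s _ _ _ h a x := trunc_headAct α h a x
  up_act m s {_ b b' d d'} hi hj hij hij' a x := by
    suffices tailUp l n m s b' d' ∘ₗ α.barAct (Raise.last hi l) (consPos m n) a s =
      headAct α l n (s + 1) hj a ∘ₗ tailUp l n m s b d from LinearMap.congr_fun this x
    refine Z.barObj_ext fun w z => ?_
    rw [LinearMap.comp_apply, LinearMap.comp_apply, α.barAct_inc, reput_inc, reput_inc,
      headAct_put α hj a (Nat.succ_pos b) (v := w.1)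
        (by rw [List.append_assoc, List.singleton_append])]
  down_act m s {_ d d' b b'} hi hj hij hij' a x := by
    suffices tailDown l n m s d' b' ∘ₗ headAct α l n (s + 1) hi a =
      α.barAct (Raise.last hj l) (consPos m n) a s ∘ₗ tailDown l n m s d b from
      LinearMap.congr_fun this x
    refine barObj_ext_cons fun c v hw hc z => ?_
    rw [LinearMap.comp_apply, LinearMap.comp_apply,
      headAct_inc α hi a _ (Raise.append_cons _ l rfl v), reput_inc]
    by_cases hcb : c = b + 1
    · subst hcb
      rw [tailDown_put hij', barAct_put α hj a rfl]
    · rw [tailDown_put_of_ne hij' (by omega), put_of_not_valid, map_zero]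
      exact fun hv => hcb (valid_append_singleton_iff.1 hv).1
  down_act_of_lt m s {_ d d' b'} hi hij' a x hd := by
    suffices tailDown l n m s d' b' ∘ₗ headAct α l n (s + 1) hi a = 0 from
      LinearMap.congr_fun this x
    refine barObj_ext_cons fun c v hw hc z => ?_
    rw [LinearMap.comp_apply, headAct_inc α hi a _ (Raise.append_cons _ l rfl v),
      tailDown_put_of_ne hij' (by omega), LinearMap.zero_apply]
  down_up m s b d h x := tailDown_tailUp h x
  T_up m s b d h x := by
    suffices trunc (m + 1) l n (s + 1) d ∘ₗ tailUp l n m s b d = tailUp l n m s b d from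
      LinearMap.congr_fun this x
    refine Z.barObj_ext fun w z => ?_
    rw [LinearMap.comp_apply, reput_inc, trunc_put (a := b + 1) (v := w.1) (by omega)
      (by rw [List.append_assoc, List.singleton_append])]
  T_d_up m s b d h x := by
    suffices trunc (m + 1) l n (s + 1) d ∘ₗ Z.barD l ((d + 1) :: n) (s + 1) ∘ₗ
        tailUp l n m (s + 1) b d = Z.barD l ((d + 1) :: n) (s + 1) ∘ₗ tailUp l n m (s + 1) b d from
      LinearMap.congr_fun this x
    refine Z.barObj_ext fun w z => ?_
    obtain ⟨hw, z', hz'⟩ := tailUp_inc h w.2 z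
    rw [LinearMap.comp_apply, LinearMap.comp_apply]
    refine (congrArg (fun y => trunc (m + 1) l n (s + 1) d (Z.barD l ((d + 1) :: n) (s + 1) y))
      hz').trans (Eq.trans ?_ (congrArg (Z.barD l ((d + 1) :: n) (s + 1)) hz').symm)
    exact barD_inc_trunc (by omega) hw z'
  down_d_up m s b d h x := tailDown_barD_tailUp h x
  down_d_T m s d b h x := tailDown_barD_trunc_succ h x

end QuasiAlgebra

end QuasiKoszul

namespace QuasiKoszul

/-! ### Homology of complexes of vector spaces in terms of elements -/

section Homology

variable {k : Type u} [Field k] {K L : ChainComplex (ModuleCat.{u} k) ℕ}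

/-- For `i = 0` the successor of `i` in the complex shape is `0` itself, and `K.d 0 0 = 0`, so that
all elements are cycles. -/
theorem isZero_homology_iff (i : ℕ) : Limits.IsZero (K.homology i) ↔
    ∀ x, (K.d i ((ComplexShape.down ℕ).next i)).hom x = 0 → ∃ y, (K.d (i + 1) i).hom y = x := by
  rw [← HomologicalComplex.exactAt_iff_isZero_homology,
    K.exactAt_iff' (i + 1) i _ (ChainComplex.prev ℕ i) rfl, ShortComplex.moduleCat_exact_iff]
  rfl

theorem exists_linear_section {V W : Type*} [AddCommGroup V] [Module k V] [AddCommGroup W]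
    [Module k W] (f : V →ₗ[k] W) (hf : Function.Surjective f) : ∃ g : W →ₗ[k] V, ∀ x, f (g x) = x :=
  (f.exists_rightInverse_of_surjective (LinearMap.range_eq_top.2 hf)).imp fun _ h =>
    LinearMap.congr_fun h

theorem homologyπ_surjective (K : ChainComplex (ModuleCat.{u} k) ℕ) (i : ℕ) :
    Function.Surjective (K.homologyπ i).hom :=
  (ModuleCat.epi_iff_surjective _).1 inferInstance

/-- A linear map to the homology, defined on all chains, which takes every cycle to its class. -/
noncomputable def classMap (K : ChainComplex (ModuleCat.{u} k) ℕ) (i : ℕ) :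
    K.X i →ₗ[k] K.homology i :=
  (K.homologyπ i).hom ∘ₗ (K.iCycles i).hom.leftInverse

/-- A linear choice of cycles representing the homology classes. -/
noncomputable def classRep (K : ChainComplex (ModuleCat.{u} k) ℕ) (i : ℕ) :
    K.homology i →ₗ[k] K.X i :=
  (K.iCycles i).hom ∘ₗ (exists_linear_section _ (homologyπ_surjective K i)).choose

theorem classMap_iCycles (i : ℕ) (z : K.cycles i) :
    classMap K i ((K.iCycles i).hom z) = (K.homologyπ i).hom z := by
  rw [classMap, LinearMap.comp_apply, LinearMap.leftInverse_apply_of_inj]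
  exact LinearMap.ker_eq_bot.2 ((ModuleCat.mono_iff_injective _).1 inferInstance)

theorem exists_classRep_eq (i : ℕ) (c : K.homology i) :
    ∃ z, (K.homologyπ i).hom z = c ∧ classRep K i c = (K.iCycles i).hom z :=
  ⟨_, (exists_linear_section _ (homologyπ_surjective K i)).choose_spec c, rfl⟩

theorem d_classRep (i j : ℕ) (c : K.homology i) : (K.d i j).hom (classRep K i c) = 0 := by
  obtain ⟨z, -, hz⟩ := exists_classRep_eq i c
  rw [hz]
  exact LinearMap.congr_fun (congrArg ModuleCat.Hom.hom (K.iCycles_d i j)) z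

theorem classMap_classRep (i : ℕ) (c : K.homology i) : classMap K i (classRep K i c) = c := by
  obtain ⟨z, rfl, hz⟩ := exists_classRep_eq i c
  rw [hz, classMap_iCycles]

theorem classMap_d (i j : ℕ) (x : K.X i) : classMap K j ((K.d i j).hom x) = 0 := by
  rw [← K.toCycles_i i j]
  refine (classMap_iCycles j ((K.toCycles i j).hom x)).trans ?_
  exact LinearMap.congr_fun (congrArg ModuleCat.Hom.hom (K.toCycles_comp_homologyπ i j)) x

theorem exists_iCycles_eq (i : ℕ) (x : K.X i)
    (hx : (K.d i ((ComplexShape.down ℕ).next i)).hom x = 0) :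
    ∃ z, (K.iCycles i).hom z = x := by
  let f : ModuleCat.of k k ⟶ K.X i := ModuleCat.ofHom (LinearMap.toSpanSingleton k (K.X i) x)
  have hf : f ≫ K.d i ((ComplexShape.down ℕ).next i) = 0 := by
    refine ModuleCat.hom_ext (LinearMap.ext_ring ?_)
    refine (congrArg _ (one_smul k x)).trans hx
  refine ⟨(K.liftCycles f _ rfl hf).hom 1, ?_⟩
  exact (LinearMap.congr_fun (congrArg ModuleCat.Hom.hom (K.liftCycles_i f _ rfl hf)) 1).trans
    (one_smul k x)

theorem exists_d_eq_sub_classRep (i : ℕ) (x : K.X i)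
    (hx : (K.d i ((ComplexShape.down ℕ).next i)).hom x = 0) :
    ∃ y, (K.d (i + 1) i).hom y = x - classRep K i (classMap K i x) := by
  obtain ⟨z, rfl⟩ := exists_iCycles_eq i x hx
  rw [classMap_iCycles]
  obtain ⟨z', h, hz'⟩ := exists_classRep_eq i ((K.homologyπ i).hom z)
  have hex := (ShortComplex.moduleCat_exact_iff _).1 (ShortComplex.exact_of_g_is_cokernel
    (ShortComplex.mk _ _ (K.toCycles_comp_homologyπ (i + 1) i))
    (K.homologyIsCokernel (i + 1) i (ChainComplex.prev ℕ i)))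
  obtain ⟨y, hy⟩ := hex (z - z') ((map_sub (K.homologyπ i).hom z z').trans (sub_eq_zero.2 h.symm))
  refine ⟨y, ?_⟩
  rw [hz', ← map_sub]
  refine Eq.trans ?_ (congrArg (K.iCycles i).hom hy)
  exact (LinearMap.congr_fun (congrArg ModuleCat.Hom.hom (K.toCycles_i (i + 1) i)) y).symm

theorem classMap_hom_classRep (f : K ⟶ L) (i : ℕ) (c : K.homology i) :
    classMap L i ((f.f i).hom (classRep K i c)) = (HomologicalComplex.homologyMap f i).hom c := by
  obtain ⟨z, rfl, hz⟩ := exists_classRep_eq i c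
  rw [hz]
  have h₁ : (f.f i).hom ((K.iCycles i).hom z) =
      (L.iCycles i).hom ((HomologicalComplex.cyclesMap f i).hom z) :=
    (LinearMap.congr_fun (congrArg ModuleCat.Hom.hom (HomologicalComplex.cyclesMap_i f i)) z).symm
  rw [h₁, classMap_iCycles]
  exact (LinearMap.congr_fun
    (congrArg ModuleCat.Hom.hom (HomologicalComplex.homologyπ_naturality f i)) z).symm

end Homology

/-! ### Construction of retractions -/

/-- If `e` differs from the identity by boundaries on the cycles, then `1 - e` is the sum of a map
factoring through the incoming differential and of a map factoring through the outgoing one. -/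
theorem exists_homotopy {k V₀ V₁ V₂ : Type*} [Field k] [AddCommGroup V₀] [Module k V₀]
    [AddCommGroup V₁] [Module k V₁] [AddCommGroup V₂] [Module k V₂] (d : V₁ →ₗ[k] V₀)
    (d' : V₂ →ₗ[k] V₁) (e : V₁ →ₗ[k] V₁) (h : ∀ x, d x = 0 → ∃ y, d' y = x - e x) :
    ∃ (θ : V₁ →ₗ[k] V₂) (κ : V₀ →ₗ[k] V₁), ∀ x, e x + d' (θ x) + κ (d x) = x := by
  obtain ⟨r, hr⟩ := (LinearMap.ker d).subtype.exists_leftInverse_of_injective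
    (LinearMap.ker d).ker_subtype
  obtain ⟨σ, hσ⟩ := d'.rangeRestrict.exists_rightInverse_of_surjective d'.range_rangeRestrict
  let g : LinearMap.ker d →ₗ[k] LinearMap.range d' :=
    ((LinearMap.id - e) ∘ₗ (LinearMap.ker d).subtype).codRestrict _ fun x => by
      obtain ⟨y, hy⟩ := h x.1 x.2
      exact ⟨y, hy⟩
  let θ : V₁ →ₗ[k] V₂ := σ ∘ₗ g ∘ₗ r
  have hθ : ∀ x, d x = 0 → d' (θ x) = x - e x := by
    intro x hx
    have h₁ : r x = ⟨x, hx⟩ := LinearMap.congr_fun hr ⟨x, hx⟩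
    have h₂ := congrArg Subtype.val (LinearMap.congr_fun hσ (g ⟨x, hx⟩))
    change d' (σ (g (r x))) = _
    rw [h₁]
    exact h₂
  obtain ⟨τ, hτ⟩ := d.rangeRestrict.exists_rightInverse_of_surjective d.range_rangeRestrict
  obtain ⟨κ, hκ⟩ := ((LinearMap.id - e - d' ∘ₗ θ) ∘ₗ τ).exists_extend
  refine ⟨θ, κ, fun x => ?_⟩
  have h₁ : κ (d x) = (LinearMap.id - e - d' ∘ₗ θ : V₁ →ₗ[k] V₁) (τ ⟨d x, x, rfl⟩) :=
    LinearMap.congr_fun hκ ⟨d x, x, rfl⟩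
  have h₂ : d (x - τ ⟨d x, x, rfl⟩) = 0 := by
    rw [map_sub, sub_eq_zero]
    exact (congrArg Subtype.val (LinearMap.congr_fun hτ ⟨d x, x, rfl⟩)).symm
  have h₃ := hθ _ h₂
  simp only [map_sub] at h₃
  rw [h₁]
  simp only [LinearMap.sub_apply, LinearMap.id_apply, LinearMap.comp_apply]
  rw [eq_add_of_sub_eq h₃]
  abel

namespace ModComplex

variable {k A : Type u} [Field k] [Ring A] [Algebra k A]
  {𝒜 : ℕ → Submodule k A} [GradedAlgebra 𝒜] (C : ModComplex 𝒜)

/-- The cycles of a complex of graded modules; every element of degree `0` is a cycle. -/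
def IsCycle : ∀ s j, (C.X s).obj j → Prop
  | 0, _, _ => True
  | s + 1, j, x => C.d s j x = 0

variable {C}

theorem isCycle_zero : ∀ s j, C.IsCycle s j 0
  | 0, _ => trivial
  | s + 1, j => map_zero (C.d s j)

/-- A retraction is obtained from class maps and representing cycles, since all the exact sequences
involved split over the field `k`. -/
theorem exists_retraction {H : GradedModule 𝒜} {h : ℕ} (proj : ∀ j, (C.X h).obj j →ₗ[k] H.obj j)
    (sect : ∀ j, H.obj j →ₗ[k] (C.X h).obj j) (sect_cycle : ∀ j y, C.IsCycle h j (sect j y))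
    (proj_sect : ∀ j x, proj j (sect j x) = x) (proj_d : ∀ j x, proj j (C.d h j x) = 0)
    (proj_act_sect : ∀ {n i j : ℕ} (hij : n + i = j) (a : 𝒜 n) (x : H.obj i),
      proj j ((C.X h).act hij a (sect i x)) = H.act hij a x)
    (sub_sect_proj : ∀ j x, C.IsCycle h j x → ∃ y, C.d h j y = x - sect j (proj j x))
    (exact_of_ne : ∀ s, s ≠ h → ∀ j x, C.IsCycle s j x → ∃ y, C.d s j y = x) :
    Nonempty (C.Retraction H h) := by
  obtain ⟨e, e_self, e_of_ne⟩ : ∃ e : ∀ s j, (C.X s).obj j →ₗ[k] (C.X s).obj j,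
      (∀ j x, e h j x = sect j (proj j x)) ∧ ∀ s, s ≠ h → ∀ j x, e s j x = 0 := by
    refine ⟨fun s => if hs : s = h then hs ▸ fun j => sect j ∘ₗ proj j else 0, fun j x => ?_,
      fun s hs j x => ?_⟩
    · beta_reduce
      rw [dif_pos rfl]
      rfl
    · beta_reduce
      rw [dif_neg hs]
      rfl
  have e_cycle : ∀ s j x, C.IsCycle s j (e s j x) := by
    intro s j x
    by_cases hs : s = h
    · subst hs
      rw [e_self]
      exact sect_cycle j _
    · rw [e_of_ne s hs]
      exact isCycle_zero s j
  have sub_e : ∀ s j x, C.IsCycle s j x → ∃ y, C.d s j y = x - e s j x := by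
    intro s j x hx
    by_cases hs : s = h
    · subst hs
      rw [e_self]
      exact sub_sect_proj j x hx
    · rw [e_of_ne s hs, sub_zero]
      exact exact_of_ne s hs j x hx
  choose θ₀ κ₀ h₀ using fun j =>
    exists_homotopy (0 : (C.X 0).obj j →ₗ[k] (C.X 0).obj j) (C.d 0 j) (e 0 j)
      fun x _ => sub_e 0 j x trivial
  choose θ κ hθ using fun s j =>
    exists_homotopy (C.d s j) (C.d (s + 1) j) (e (s + 1) j) fun x hx => sub_e (s + 1) j x hx
  exact ⟨{
    proj := proj
    sect := sect
    e := e
    θ := fun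
      | 0, j => θ₀ j
      | s + 1, j => θ s j
    κ := κ
    e_add_zero := fun j x => by
      have := h₀ j x
      rwa [LinearMap.zero_apply, map_zero, add_zero] at this
    e_add_succ := hθ
    e_of_ne := e_of_ne
    e_self := e_self
    d_e := fun s j x => e_cycle (s + 1) j x
    proj_sect := proj_sect
    proj_d := proj_d
    proj_act_sect := proj_act_sect }⟩

end ModComplex

end QuasiKoszul

namespace QuasiKoszul

/-! ### Vanishing of the homology in terms of elements -/

namespace GradedModule

variable {k A : Type u} [Field k] [Ring A] [Algebra k A]
  {𝒜 : ℕ → Submodule k A} [GradedAlgebra 𝒜]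

theorem barComplex_d (M : GradedModule 𝒜) (i j : ℕ) :
    (M.barComplex j).d (i + 1) i = ModuleCat.ofHom (M.barD i j) :=
  ChainComplex.of_d (fun i => ModuleCat.of k ((M.bar i).obj j))
    (fun i => ModuleCat.ofHom (M.barD i j)) i

theorem IsKoszul.barExact {M : GradedModule 𝒜} (hM : M.IsKoszul) {i j : ℕ} (hij : i ≠ j) :
    M.BarExact i j := by
  have h := (isZero_homology_iff i).1 (hM i j hij)
  rw [barComplex_d] at h
  cases i with
  | zero =>
    refine fun w => h w ?_
    rw [HomologicalComplex.shape _ _ _ (by rw [ChainComplex.next_nat_zero]; simp)]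
    rfl
  | succ i =>
    refine fun w hw => h w ?_
    rw [ChainComplex.next_nat_succ, barComplex_d]
    exact hw

end GradedModule

namespace QuasiAlgebra

section

variable {k : Type u} [Field k] {Z : QuasiAlgebra k} {l n n' : List ℕ} {i : ℕ}

theorem barComplex_d (i : ℕ) :
    (Z.barComplex l n).d (i + 1) i = ModuleCat.ofHom (Z.barD l n i) :=
  ChainComplex.of_d (fun i => ModuleCat.of k (Z.BarObj l n i))
    (fun i => ModuleCat.ofHom (Z.barD l n i)) i

theorem isZero_homology_zero_iff : Limits.IsZero ((Z.barComplex l n).homology 0) ↔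
    ∀ x : Z.BarObj l n 0, ∃ y, Z.barD l n 0 y = x := by
  rw [isZero_homology_iff, barComplex_d,
    HomologicalComplex.shape _ _ _ (by rw [ChainComplex.next_nat_zero]; simp)]
  exact ⟨fun h x => h x rfl, fun h x _ => h x⟩

theorem isZero_homology_succ_iff : Limits.IsZero ((Z.barComplex l n).homology (i + 1)) ↔
    ∀ x : Z.BarObj l n (i + 1), Z.barD l n i x = 0 → ∃ y, Z.barD l n (i + 1) y = x := by
  rw [isZero_homology_iff, barComplex_d, ChainComplex.next_nat_succ, barComplex_d]
  exact Iff.rfl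

theorem isZero_homology_of_isEmpty [h : IsEmpty (BarWord n i)] :
    Limits.IsZero ((Z.barComplex l n).homology i) := by
  have := barWord_subsingleton_of_isEmpty (Z := Z) (l := l) (n := n) (i := i)
  cases i with
  | zero => exact isZero_homology_zero_iff.2 fun x => ⟨0, Subsingleton.elim _ _⟩
  | succ i => exact isZero_homology_succ_iff.2 fun x _ => ⟨0, Subsingleton.elim _ _⟩

/-! ### Omission of the zero degrees -/

theorem barD_reput (h : ∀ w, Refines w n ↔ Refines w n') (x : Z.BarObj l n (i + 1)) :
    Z.barD l n' i (Z.reput l n (i + 1) l n' (i + 1) x) =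
      Z.reput l n i l n' i (Z.barD l n i x) := by
  rw [barD_apply, barD_apply, map_sum]
  refine Finset.sum_congr rfl fun t ht => ?_
  rw [map_smul]
  congr 1
  suffices Z.face l n' i t ∘ₗ Z.reput l n (i + 1) l n' (i + 1) =
      Z.reput l n i l n' i ∘ₗ Z.face l n i t from LinearMap.congr_fun this x
  refine Z.barObj_ext fun w z => ?_
  let w' : BarWord n' (i + 1) := ⟨w.1, w.2.1, (h w.1).1 w.2.2⟩
  have hm : Merge (l.length + t) (l ++ w.1) (l ++ mergeAt t w.1) :=
    (merge_mergeAt (by rw [w.2.1]; exact Nat.succ_lt_succ (Finset.mem_range.1 ht))).append_left l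
  rw [LinearMap.comp_apply, LinearMap.comp_apply, reput_inc,
    show Z.put l n' (i + 1) (l ++ w.1) z = Z.inc l w' z from put_word w' z,
    face_inc_eq_put w rfl hm, reput_put]
  · exact face_inc_eq_put w' rfl hm z
  · rw [valid_append_iff, valid_append_iff]
    exact fun hv => ⟨hv.1, (h _).2 hv.2⟩

theorem reput_reput (h : ∀ w, Refines w n ↔ Refines w n') (x : Z.BarObj l n i) :
    Z.reput l n' i l n i (Z.reput l n i l n' i x) = x := by
  suffices Z.reput l n' i l n i ∘ₗ Z.reput l n i l n' i = LinearMap.id from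
    LinearMap.congr_fun this x
  refine Z.barObj_ext fun w z => ?_
  rw [LinearMap.comp_apply, reput_inc, reput_put, put_word, LinearMap.id_apply]
  rw [valid_append_iff, valid_append_iff]
  exact fun hv => ⟨hv.1, (h _).1 hv.2⟩

theorem isZero_homology_congr (h : ∀ w, Refines w n ↔ Refines w n')
    (hi : Limits.IsZero ((Z.barComplex l n').homology i)) :
    Limits.IsZero ((Z.barComplex l n).homology i) := by
  have lift : ∀ (i : ℕ) (x : Z.BarObj l n i),
      (∃ y, Z.barD l n' i y = Z.reput l n i l n' i x) → ∃ y, Z.barD l n i y = x := by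
    rintro i x ⟨y, hy⟩
    refine ⟨Z.reput l n' (i + 1) l n (i + 1) y, ?_⟩
    rw [barD_reput fun w => (h w).symm, hy, reput_reput h]
  cases i with
  | zero => exact isZero_homology_zero_iff.2 fun x => lift 0 x (isZero_homology_zero_iff.1 hi _)
  | succ i =>
    refine isZero_homology_succ_iff.2 fun x hx => lift (i + 1) x ?_
    refine isZero_homology_succ_iff.1 hi _ ?_
    rw [barD_reput h, hx, map_zero]

end

end QuasiAlgebra

theorem refines_cons_iff_append {d : ℕ} {w n : List ℕ} : Refines w (d :: n) ↔
    ∃ u v, u ++ v = w ∧ u.sum = d ∧ (∀ a ∈ u, 0 < a) ∧ Refines v n := by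
  constructor
  · rintro ⟨W, rfl, h₂, h₃⟩
    cases W with
    | nil => simp at h₂
    | cons u W =>
      obtain ⟨hd, rfl⟩ := List.cons.inj h₂
      rw [List.flatten_cons] at h₃
      exact ⟨u, W.flatten, rfl, hd, fun a ha => h₃ a (List.mem_append_left _ ha), W, rfl, rfl,
        fun a ha => h₃ a (List.mem_append_right _ ha)⟩
  · rintro ⟨u, v, rfl, rfl, hu, W, rfl, rfl, h⟩
    exact ⟨u :: W, rfl, rfl, fun a ha => (List.mem_append.1 ha).elim (hu a) (h a)⟩

theorem refines_zero_cons_iff {w n : List ℕ} : Refines w (0 :: n) ↔ Refines w n := by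
  rw [refines_cons_iff_append]
  constructor
  · rintro ⟨u, v, rfl, hu, hu', hv⟩
    cases u with
    | nil => exact hv
    | cons a u =>
      have := hu' a List.mem_cons_self
      rw [List.sum_cons] at hu
      omega
  · exact fun h => ⟨[], w, rfl, rfl, fun a ha => absurd ha List.not_mem_nil, h⟩

theorem refines_filter_iff (n w : List ℕ) :
    Refines w n ↔ Refines w (n.filter fun a => 0 < a) := by
  induction n generalizing w with
  | nil => rfl
  | cons d n ih =>
    cases d with
    | zero => rw [refines_zero_cons_iff, ih, List.filter_cons_of_neg (by simp)]
    | succ d =>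
      rw [List.filter_cons_of_pos (by simp), refines_cons_iff_append, refines_cons_iff_append]
      simp only [ih]

theorem sum_filter_pos (n : List ℕ) : (n.filter fun a => 0 < a).sum = n.sum := by
  induction n with
  | nil => rfl
  | cons d n ih =>
    cases d with
    | zero => rw [List.filter_cons_of_neg (by simp), ih, List.sum_cons, zero_add]
    | succ d => rw [List.filter_cons_of_pos (by simp), List.sum_cons, ih, List.sum_cons]

/-! ### Induction on the total degree -/

namespace QuasiAlgebra

variable {k A : Type u} [Field k] {Z : QuasiAlgebra k} [Ring A] [Algebra k A]
  {𝒜 : ℕ → Submodule k A} [GradedAlgebra 𝒜] (α : LeftAction 𝒜 Z)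

theorem tailComplex_isCycle_iff {l n : List ℕ} {s j : ℕ} (x : Z.BarObj (l ++ [j + 1]) n s) :
    (tailComplex α l n).IsCycle s j x ↔
      ((Z.barComplex (l ++ [j + 1]) n).d s ((ComplexShape.down ℕ).next s)).hom x = 0 := by
  cases s with
  | zero =>
    rw [HomologicalComplex.shape _ _ _ (by rw [ChainComplex.next_nat_zero]; simp)]
    exact ⟨fun _ => rfl, fun _ => trivial⟩
  | succ s =>
    rw [ChainComplex.next_nat_succ, barComplex_d]
    exact neg_eq_zero (a := Z.barD (l ++ [j + 1]) n s x)

/-- If the complexes `E_{l, j + 1; n}` have no homology outside of the degree `n_1 + ⋯ + n_q`, then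
the complex of graded modules they form retracts onto its homology. -/
theorem nonempty_retraction {l n : List ℕ}
    (h : ∀ j s, s ≠ n.sum → Limits.IsZero ((Z.barComplex (l ++ [j + 1]) n).homology s)) :
    Nonempty ((tailComplex α l n).Retraction (α.homologyModule l n) n.sum) := by
  have neg : ∀ (s j : ℕ) (x : Z.BarObj (l ++ [j + 1]) n s),
      (∃ y, ((Z.barComplex (l ++ [j + 1]) n).d (s + 1) s).hom y = x) →
        ∃ y, (tailComplex α l n).d s j y = x := by
    rintro s j x ⟨y, hy⟩
    rw [barComplex_d] at hy
    exact ⟨-y, (congrArg Neg.neg (map_neg (Z.barD (l ++ [j + 1]) n s) y)).trans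
      ((neg_neg _).trans hy)⟩
  refine ModComplex.exists_retraction (fun j => classMap (Z.barComplex (l ++ [j + 1]) n) n.sum)
    (fun j => classRep (Z.barComplex (l ++ [j + 1]) n) n.sum) ?_ ?_ ?_ ?_ ?_ ?_
  · exact fun j y => (tailComplex_isCycle_iff α _).2 (d_classRep _ _ _)
  · exact fun j x => classMap_classRep _ x
  · intro j x
    have := classMap_d (K := Z.barComplex (l ++ [j + 1]) n) (n.sum + 1) n.sum x
    rw [barComplex_d] at this
    exact (map_neg (classMap (Z.barComplex (l ++ [j + 1]) n) n.sum) _).trans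
      (neg_eq_zero.2 this)
  · exact fun {_ i j} hij a x => classMap_hom_classRep (α.barHom (Raise.last hij l) n a) n.sum x
  · exact fun j x hx => neg _ j _
      (exists_d_eq_sub_classRep n.sum x ((tailComplex_isCycle_iff α _).1 hx))
  · exact fun s hs j x hx => neg s j x
      ((isZero_homology_iff s).1 (h j s hs) x ((tailComplex_isCycle_iff α _).1 hx))

/-- The assertion for positive degrees, by induction on `n_1 + ⋯ + n_q`. All `l` have to be
considered at once, as the first letter of a word refining `n` is moved to `l` in the induction
step. -/
theorem isZero_homology_of_pos
    (hα : ∀ l n : List ℕ, (∀ a ∈ l, 1 ≤ a) → (∀ b ∈ n, 1 ≤ b) → (α.homologyModule l n).IsKoszul)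
    (N : ℕ) : ∀ l n : List ℕ, (∀ a ∈ l, 1 ≤ a) → (∀ b ∈ n, 1 ≤ b) → n.sum = N →
      ∀ i, i ≠ n.sum → Limits.IsZero ((Z.barComplex l n).homology i) := by
  induction N using Nat.strong_induction_on with
  | _ N ih =>
  rintro l n hl hn rfl i hi
  cases n with
  | nil =>
    have : IsEmpty (BarWord [] i) := by
      refine ⟨?_⟩
      rintro ⟨w, hw, W, rfl, hW, -⟩
      rw [List.map_eq_nil_iff.1 hW] at hw
      exact hi hw.symm
    exact isZero_homology_of_isEmpty
  | cons b n =>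
    obtain ⟨c, rfl⟩ := Nat.exists_eq_add_of_le' (hn b List.mem_cons_self)
    have hn' : ∀ b ∈ n, 1 ≤ b := fun b hb => hn b (List.mem_cons_of_mem _ hb)
    rw [List.sum_cons] at hi ih
    cases i with
    | zero =>
      have : IsEmpty (BarWord ((c + 1) :: n) 0) := by
        refine ⟨?_⟩
        rintro ⟨w, hw, hr⟩
        rw [List.length_eq_zero_iff.1 hw] at hr
        exact not_refines_nil (Nat.succ_pos c) n hr
      exact isZero_homology_of_isEmpty
    | succ t =>
      refine isZero_homology_succ_iff.2 (exists_of_totExact α ?_)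
      refine (headFiltration α l n).totExact fun m c' hm => ?_
      obtain ⟨R⟩ := nonempty_retraction α (l := l) (n := consPos m n) fun j s hs =>
        ih _ (by rw [sum_consPos]; omega) _ _ (by
          intro a ha
          rcases List.mem_append.1 ha with ha | ha
          · exact hl a ha
          · rw [List.mem_singleton.1 ha]
            exact Nat.le_add_left 1 j) (consPos_pos hn' m) rfl s hs
      refine R.totExact fun i hit => (hα l _ hl (consPos_pos hn' m)).barExact ?_
      rw [sum_consPos] at hit
      omega

end QuasiAlgebra

end QuasiKoszul

theorem mainTheorem3 {k A : Type u} [Field k] [Ring A] [Algebra k A]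
    (𝒜 : ℕ → Submodule k A) [GradedAlgebra 𝒜]
    (hA : QuasiKoszul.IsKoszulAlgebra 𝒜)
    (Z : QuasiKoszul.QuasiAlgebra k) (hZ : Z.IsPositive)
    (α : QuasiKoszul.QuasiAlgebra.LeftAction 𝒜 Z)
    (hα : ∀ l n : List ℕ, (∀ a ∈ l, 1 ≤ a) → (∀ b ∈ n, 1 ≤ b) →
      (α.homologyModule l n).IsKoszul) :
    Z.IsKoszul := by
  intro n i hi
  refine QuasiKoszul.QuasiAlgebra.isZero_homology_congr
    (QuasiKoszul.refines_filter_iff n) ?_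
  refine QuasiKoszul.QuasiAlgebra.isZero_homology_of_pos α hα _ [] _
    (fun a ha => absurd ha List.not_mem_nil) (fun b hb => ?_) rfl i ?_
  · exact of_decide_eq_true (List.mem_filter.1 hb).2
  · rwa [QuasiKoszul.sum_filter_pos]
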